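/- For a finite simple graph $G=(V,E)$, a pair $(A,B)$ of disjoint subsets of $V$ is a \emph{pair of perfectly matched sets} if every vertex of $A$ has exactly one neighbour in $B$ and every vertex of $B$ has exactly one neighbour in $A$; its size is $|A|=|B|$. A \emph{cluster graph} is a vertex-disjoint union of cliques, and the \emph{distance to cluster} of $G$ is the smallest size of a set $X\subseteq V$ such that $G-X$ is a cluster graph. The optimization version of PERFECTLY MATCHED SETS asks, given $G$, for a pair of perfectly matched sets of maximum size. \textbf{Theorem.} There is an algorithm (a program for a random access machine that is given the adjacency matrix of the input graph) that solves the optimization version of PERFECTLY MATCHED SETS and that, on every $n$-vertex graph with distance to cluster at most $k$, runs in time $O(3^k\cdot k^k\cdot \mathrm{poly}(n))$, with the convention $0^0=1$. That is, there are one such algorithm and one polynomial $p$ such that, for all $n,k\ge 0$ and every $n$-vertex graph $G$ with distance to cluster at most $k$, the algorithm halts on input $G$ after at most $3^k\cdot k^k\cdot p(n)$ steps and outputs a pair $(A,B)$ of perfectly matched sets of $G$ of maximum size. -/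

import Mathlib

/-! ### Perfectly matched sets -/

/-- `(A, B)` is a pair of perfectly matched sets of `G`: the sets are disjoint, every vertex of `A`
has exactly one neighbour in `B`, and every vertex of `B` has exactly one neighbour in `A`. -/
def PerfectlyMatched {V : Type*} (G : SimpleGraph V) (A B : Finset V) : Prop :=
  Disjoint A B ∧
    (∀ a ∈ A, ∃! b, b ∈ B ∧ G.Adj a b) ∧
    (∀ b ∈ B, ∃! a, a ∈ A ∧ G.Adj b a)

/-- `(A, B)` is a pair of perfectly matched sets of maximum size `|A| = |B|`. -/
def IsMaximumPerfectlyMatched {V : Type*} (G : SimpleGraph V) (A B : Finset V) : Prop :=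
  PerfectlyMatched G A B ∧
    ∀ A' B' : Finset V, PerfectlyMatched G A' B' → A'.card ≤ A.card

/-! ### Distance to cluster -/

/-- A cluster graph is a vertex-disjoint union of cliques: the vertex set is partitioned into
classes so that two distinct vertices are adjacent exactly when they are in the same class. -/
def IsClusterGraph {V : Type*} (G : SimpleGraph V) : Prop :=
  ∃ r : Setoid V, ∀ u v : V, G.Adj u v ↔ u ≠ v ∧ r u v

/-- `X` is a cluster deletion set of `G`: the graph `G - X` is a cluster graph. -/
def IsClusterDeletionSet {V : Type*} (G : SimpleGraph V) (X : Finset V) : Prop :=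
  IsClusterGraph (G.induce {v | v ∉ X})

/-- The smallest size of a cluster deletion set. On a finite graph the set on the right is not
empty, because the set of all vertices is a cluster deletion set. -/
noncomputable def distanceToCluster {V : Type*} (G : SimpleGraph V) : ℕ :=
  sInf {m | ∃ X : Finset V, IsClusterDeletionSet G X ∧ X.card = m}

/-! ### Random access machines

A program uses finitely many registers and finitely many arrays, all holding natural numbers. The
only arithmetic operations are successor and predecessor, so that in `t` steps no number can grow
beyond the input and the constants of the program by more than `t`. Hence one step never hides an
operation on long numbers, and the unit-cost measure below is justified. -/

namespace RAM

/-- The contents of the registers and of the arrays. -/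
structure State where
  reg : ℕ → ℕ
  arr : ℕ → ℕ → ℕ

/-- Write the value `v` into register `x`. -/
def State.setReg (s : State) (x v : ℕ) : State :=
  { s with reg := Function.update s.reg x v }

/-- Write the value `v` into cell `i` of array `a`. -/
def State.setArr (s : State) (a i v : ℕ) : State :=
  { s with arr := Function.update s.arr a (Function.update (s.arr a) i v) }

/-- Elementary instructions; `x`, `y` name registers, `a` names an array, `c` is a constant. -/
inductive Instr where
  /-- `x := c` -/
  | const (x c : ℕ)
  /-- `x := y` -/
  | copy (x y : ℕ)
  /-- `x := y + 1` -/
  | succ (x y : ℕ)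
  /-- `x := y - 1` (and `0` if `y` holds `0`) -/
  | pred (x y : ℕ)
  /-- `x := a[y]` -/
  | load (x a y : ℕ)
  /-- `a[x] := y` -/
  | store (a x y : ℕ)

/-- The effect of an instruction. -/
def Instr.run : Instr → State → State
  | .const x c, s => s.setReg x c
  | .copy x y, s => s.setReg x (s.reg y)
  | .succ x y, s => s.setReg x (s.reg y + 1)
  | .pred x y, s => s.setReg x (s.reg y - 1)
  | .load x a y, s => s.setReg x (s.arr a (s.reg y))
  | .store a x y, s => s.setArr a (s.reg x) (s.reg y)

/-- Tests comparing two registers. -/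
inductive Test where
  | eq (x y : ℕ)
  | lt (x y : ℕ)

/-- The test succeeds in a given state. -/
def Test.Holds : Test → State → Prop
  | .eq x y, s => s.reg x = s.reg y
  | .lt x y, s => s.reg x < s.reg y

/-- Programs: elementary instructions, the empty program, sequential composition,
`if b then p else q`, and `while b do p`. -/
inductive Prog where
  | instr (i : Instr)
  | skip
  | seq (p q : Prog)
  | branch (b : Test) (p q : Prog)
  | loop (b : Test) (p : Prog)

/-- `Exec p s t s'`: started in state `s`, the program `p` halts after exactly `t` steps, in state
`s'`. Every elementary instruction, every empty program and every evaluation of a test counts as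
one step. -/
inductive Exec : Prog → State → ℕ → State → Prop
  | instr (i : Instr) (s : State) : Exec (.instr i) s 1 (i.run s)
  | skip (s : State) : Exec .skip s 1 s
  | seq {p q : Prog} {s s₁ s₂ : State} {t₁ t₂ : ℕ}
      (hp : Exec p s t₁ s₁) (hq : Exec q s₁ t₂ s₂) : Exec (.seq p q) s (t₁ + t₂) s₂
  | branch_true {b : Test} {p q : Prog} {s s' : State} {t : ℕ}
      (hb : b.Holds s) (hp : Exec p s t s') : Exec (.branch b p q) s (t + 1) s'
  | branch_false {b : Test} {p q : Prog} {s s' : State} {t : ℕ}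
      (hb : ¬ b.Holds s) (hq : Exec q s t s') : Exec (.branch b p q) s (t + 1) s'
  | loop_false {b : Test} {p : Prog} {s : State}
      (hb : ¬ b.Holds s) : Exec (.loop b p) s 1 s
  | loop_true {b : Test} {p : Prog} {s s₁ s₂ : State} {t₁ t₂ : ℕ}
      (hb : b.Holds s) (hp : Exec p s t₁ s₁) (hl : Exec (.loop b p) s₁ t₂ s₂) :
      Exec (.loop b p) s (t₁ + t₂ + 1) s₂

/-- Execution is deterministic, so a program has at most one run on each input. -/
theorem Exec.deterministic {p : Prog} {s s₁ : State} {t₁ : ℕ} (h₁ : Exec p s t₁ s₁) :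
    ∀ {t₂ : ℕ} {s₂ : State}, Exec p s t₂ s₂ → t₁ = t₂ ∧ s₁ = s₂ := by
  induction h₁ with
  | instr i s => intro _ _ h; cases h; exact ⟨rfl, rfl⟩
  | skip s => intro _ _ h; cases h; exact ⟨rfl, rfl⟩
  | seq _ _ ihp ihq =>
    intro _ _ h
    cases h with
    | seq hp hq =>
      obtain ⟨rfl, rfl⟩ := ihp hp
      obtain ⟨rfl, rfl⟩ := ihq hq
      exact ⟨rfl, rfl⟩
  | branch_true hb _ ih =>
    intro _ _ h
    cases h with
    | branch_true _ hp => obtain ⟨rfl, rfl⟩ := ih hp; exact ⟨rfl, rfl⟩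
    | branch_false hb' _ => exact absurd hb hb'
  | branch_false hb _ ih =>
    intro _ _ h
    cases h with
    | branch_true hb' _ => exact absurd hb' hb
    | branch_false _ hp => obtain ⟨rfl, rfl⟩ := ih hp; exact ⟨rfl, rfl⟩
  | loop_false hb =>
    intro _ _ h
    cases h with
    | loop_false _ => exact ⟨rfl, rfl⟩
    | loop_true hb' _ _ => exact absurd hb' hb
  | loop_true hb _ _ ihp ihl =>
    intro _ _ h
    cases h with
    | loop_false hb' => exact absurd hb hb'
    | loop_true _ hp hl =>
      obtain ⟨rfl, rfl⟩ := ihp hp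
      obtain ⟨rfl, rfl⟩ := ihl hl
      exact ⟨rfl, rfl⟩

open Classical in
/-- The input: register `0` holds the number `n` of vertices, and array `0` holds the adjacency
matrix of the graph in row-major order. Everything else is `0`. -/
noncomputable def graphInput {n : ℕ} (G : SimpleGraph (Fin n)) : State where
  reg x := if x = 0 then n else 0
  arr a i :=
    if a = 0 ∧ ∃ u v : Fin n, i = (u : ℕ) * n + (v : ℕ) ∧ G.Adj u v then 1 else 0

/-- The vertex set whose indicator vector is in the first `n` cells of array `a`. -/
def State.vertexSet (s : State) (a n : ℕ) : Finset (Fin n) :=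
  Finset.univ.filter fun v => s.arr a (v : ℕ) = 1

end RAM

/-! ### A structured language with expressions, compiled to the random access machine -/

namespace RAM

/-! The proof gives a bound of the form c^k · poly(n) for a constant c. This is enough, because b^k
≤ b^b · k^k for every positive constant b (`pow_le_const_mul_self_pow`).

A pair (A, B) is encoded by a colouring: 1 on A, 2 on B, 0 elsewhere. It is perfectly matched
exactly when every coloured vertex has exactly one neighbour of the other colour (`IsMatched`). Let
X be the union of a maximal family of vertex-disjoint induced paths on three vertices, found
greedily. Every cluster deletion set meets each of these paths, so |X| ≤ 3k; by maximality G - X has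
no induced path on three vertices, so it is a union of cliques, called blocks and named by their
least vertices.

A dynamic programme starts with all colourings of X. Block after block, and pair after pair (v, w)
within a block, it optionally adds a matching edge with colour 1 at v, colour 2 at w, and at least
one end in the block. A partial solution is summarised by its key: for each x in X its colour and
its number of neighbours of the other colour, capped at 2, together with the colours present in the
current block. There are at most 4 · 9^|X| keys, and for each of them only a heaviest colouring
found is kept.

Keeping one is enough by an exchange argument. If σ has the same key as the part of a solution τ
built so far, then the next edge of τ can also be added to σ (`exchange`), the two keys stay equal
(`Joins.key_congr`), and both weights grow by the same amount (`Joins.weight`). So the table always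
has an entry with the key of the part of τ and at least its weight (`join_step_spec`, `links_spec`).
At the end, equal digits make this entry matched on X, and the conditions of each join make it
matched elsewhere.

For the running time, the algorithm is written in a small language with `for` loops.
`Stmt.compile_runs` bounds the time of the compiled program by a polynomial in any bound M on the
numbers stored during the run, and M = n + 4 · 9^(3k) is such a bound. -/

/-- The program halts within `T` steps in a state satisfying `Q`. -/
def Runs (p : Prog) (s : State) (T : ℕ) (Q : State → Prop) : Prop :=
  ∃ t s', Exec p s t s' ∧ t ≤ T ∧ Q s'

theorem Runs.mono {p : Prog} {s : State} {T T' : ℕ} {Q Q' : State → Prop}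
    (h : Runs p s T Q) (hT : T ≤ T') (hQ : ∀ s', Q s' → Q' s') : Runs p s T' Q' := by
  obtain ⟨t, s', h1, h2, h3⟩ := h
  exact ⟨t, s', h1, h2.trans hT, hQ _ h3⟩

theorem Runs.instr {i : Instr} {s : State} {Q : State → Prop} (h : Q (i.run s)) :
    Runs (.instr i) s 1 Q :=
  ⟨1, _, .instr i s, le_rfl, h⟩

theorem Runs.seq {p q : Prog} {s : State} {T U : ℕ} {Q : State → Prop}
    (h : Runs p s T fun s₁ => Runs q s₁ U Q) : Runs (.seq p q) s (T + U) Q := by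
  obtain ⟨t, s', h1, h2, t', s'', h3, h4, h5⟩ := h
  exact ⟨_, _, .seq h1 h3, add_le_add h2 h4, h5⟩

theorem Runs.branch {b : Test} {p q : Prog} {s : State} {T : ℕ} {Q : State → Prop}
    (hp : b.Holds s → Runs p s T Q) (hq : ¬ b.Holds s → Runs q s T Q) :
    Runs (.branch b p q) s (T + 1) Q := by
  by_cases hb : b.Holds s
  · obtain ⟨t, s', h1, h2, h3⟩ := hp hb
    exact ⟨_, _, .branch_true hb h1, by omega, h3⟩
  · obtain ⟨t, s', h1, h2, h3⟩ := hq hb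
    exact ⟨_, _, .branch_false hb h1, by omega, h3⟩

/-- The invariant is indexed by the number of completed iterations, and `hb` makes the test succeed
exactly while this number is below `N`. Each iteration costs its body and one test; the last `+ 1`
is the failing test. -/
theorem Runs.loop {b : Test} {p : Prog} {T : ℕ} (I : ℕ → State → Prop) (N : ℕ)
    (hb : ∀ j s, j ≤ N → I j s → (b.Holds s ↔ j < N))
    (hp : ∀ j s, j < N → I j s → Runs p s T (I (j + 1))) {s : State} (h0 : I 0 s) :
    Runs (.loop b p) s (N * (T + 1) + 1) (I N) := by
  have key : ∀ m j s, j + m = N → I j s → Runs (.loop b p) s (m * (T + 1) + 1) (I N) := by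
    intro m
    induction m with
    | zero =>
      intro j s hj hI
      have : j = N := by omega
      subst this
      exact ⟨1, s, .loop_false (by rw [hb j s le_rfl hI]; omega), by omega, hI⟩
    | succ m ih =>
      intro j s hj hI
      obtain ⟨t, s', h1, h2, h3⟩ := hp j s (by omega) hI
      obtain ⟨t', s'', h4, h5, h6⟩ := ih (j + 1) s' (by omega) h3
      refine ⟨_, _, .loop_true ((hb j s (by omega) hI).2 (by omega)) h1 h4, ?_, h6⟩
      rw [Nat.succ_mul]; omega
  exact key N 0 s (by omega) h0

/-! ### Agreement of states and bounds on their contents -/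

/-- The states have the same arrays and the same registers below `d`. -/
def Agree (d : ℕ) (s s' : State) : Prop :=
  (∀ x < d, s.reg x = s'.reg x) ∧ s.arr = s'.arr

theorem Agree.refl (d : ℕ) (s : State) : Agree d s s := ⟨fun _ _ => rfl, rfl⟩

theorem Agree.symm {d : ℕ} {s s' : State} (h : Agree d s s') : Agree d s' s :=
  ⟨fun x hx => (h.1 x hx).symm, h.2.symm⟩

theorem Agree.trans {d : ℕ} {s s' s'' : State} (h : Agree d s s') (h' : Agree d s' s'') :
    Agree d s s'' :=
  ⟨fun x hx => (h.1 x hx).trans (h'.1 x hx), h.2.trans h'.2⟩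

theorem Agree.mono {d d' : ℕ} {s s' : State} (h : Agree d s s') (hd : d' ≤ d) : Agree d' s s' :=
  ⟨fun x hx => h.1 x (hx.trans_le hd), h.2⟩

@[simp] theorem State.setReg_reg (s : State) (x v y : ℕ) :
    (s.setReg x v).reg y = if y = x then v else s.reg y := by
  simp [State.setReg, Function.update_apply]

@[simp] theorem State.setReg_arr (s : State) (x v : ℕ) : (s.setReg x v).arr = s.arr := rfl

@[simp] theorem State.setArr_reg (s : State) (a i v : ℕ) : (s.setArr a i v).reg = s.reg := rfl

theorem State.setArr_arr (s : State) (a i v b : ℕ) :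
    (s.setArr a i v).arr b = if b = a then Function.update (s.arr a) i v else s.arr b := by
  simp only [State.setArr, Function.update_apply]

theorem Agree.setReg {d : ℕ} {s s' : State} (h : Agree d s s') (x v : ℕ) :
    Agree d (s.setReg x v) (s'.setReg x v) := by
  refine ⟨fun y hy => ?_, h.2⟩
  simp [h.1 y hy]

/-- The registers below `m` and all array cells hold numbers that are at most `M`. -/
def Bounded (m M : ℕ) (s : State) : Prop :=
  (∀ x < m, s.reg x ≤ M) ∧ ∀ a i, s.arr a i ≤ M

theorem Bounded.congr {m M : ℕ} {s s' : State} (h : Bounded m M s) (hs : Agree m s s') :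
    Bounded m M s' :=
  ⟨fun x hx => (hs.1 x hx) ▸ h.1 x hx, fun a i => hs.2 ▸ h.2 a i⟩

theorem Bounded.setReg {m M : ℕ} {s : State} (h : Bounded m M s) (x : ℕ) {v : ℕ} (hv : v ≤ M) :
    Bounded m M (s.setReg x v) := by
  refine ⟨fun y hy => ?_, h.2⟩
  rw [State.setReg_reg]
  split
  · exact hv
  · exact h.1 y hy

theorem Bounded.setArr {m M : ℕ} {s : State} (h : Bounded m M s) (a i : ℕ) {v : ℕ} (hv : v ≤ M) :
    Bounded m M (s.setArr a i v) := by
  refine ⟨h.1, fun b j => ?_⟩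
  rw [State.setArr_arr]
  split
  · rw [Function.update_apply]
    split
    · exact hv
    · exact h.2 a j
  · exact h.2 b j

theorem Bounded.mono {m M M' : ℕ} {s : State} (h : Bounded m M s) (hM : M ≤ M') :
    Bounded m M' s :=
  ⟨fun x hx => (h.1 x hx).trans hM, fun a i => (h.2 a i).trans hM⟩

/-! ### Arithmetic expressions and their compilation -/

/-- Arithmetic expressions; `sum x e f` is the sum of the values of `f` for `x` from `0` to
`e - 1`. Comparisons have value `0` or `1`. -/
inductive Expr where
  | lit (c : ℕ)
  | var (x : ℕ)
  | get (a : ℕ) (e : Expr)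
  | add (e f : Expr)
  | mul (e f : Expr)
  | lt (e f : Expr)
  | eq (e f : Expr)
  | sum (x : ℕ) (e f : Expr)

namespace Expr

/-- The value of an expression. -/
def eval : Expr → State → ℕ
  | lit c, _ => c
  | var x, s => s.reg x
  | get a e, s => s.arr a (e.eval s)
  | add e f, s => e.eval s + f.eval s
  | mul e f, s => e.eval s * f.eval s
  | lt e f, s => if e.eval s < f.eval s then 1 else 0
  | eq e f, s => if e.eval s = f.eval s then 1 else 0
  | sum x e f, s => ∑ i ∈ Finset.range (e.eval s), f.eval (s.setReg x i)

/-- All registers that occur in the expression are below this number. -/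
def fresh : Expr → ℕ
  | lit _ => 0
  | var x => x + 1
  | get _ e => e.fresh
  | add e f => max e.fresh f.fresh
  | mul e f => max e.fresh f.fresh
  | lt e f => max e.fresh f.fresh
  | eq e f => max e.fresh f.fresh
  | sum x e f => max (x + 1) (max e.fresh f.fresh)

/-- A bound for the value of the expression in terms of a bound for the state. -/
noncomputable def size : Expr → Polynomial ℕ
  | lit c => Polynomial.C c
  | var _ => Polynomial.X
  | get _ _ => Polynomial.X
  | add e f => e.size + f.size
  | mul e f => e.size * f.size
  | lt _ _ => 1
  | eq _ _ => 1
  | sum _ e f => e.size * f.size.comp (Polynomial.X + e.size)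

theorem eval_congr (e : Expr) {m : ℕ} : ∀ {s s' : State}, e.fresh ≤ m → Agree m s s' →
    e.eval s = e.eval s' := by
  induction e with
  | lit c => intros; rfl
  | var x => intro s s' h hs; exact hs.1 x h
  | get a e ih => intro s s' h hs; simp only [eval]; rw [ih h hs, hs.2]
  | add e f ihe ihf | mul e f ihe ihf | lt e f ihe ihf | eq e f ihe ihf =>
    intro s s' h hs
    simp only [fresh, max_le_iff] at h
    simp only [eval]; rw [ihe h.1 hs, ihf h.2 hs]
  | sum x e f ihe ihf =>
    intro s s' h hs
    simp only [fresh, max_le_iff] at h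
    simp only [eval]
    rw [ihe h.2.1 hs]
    exact Finset.sum_congr rfl fun i _ => ihf h.2.2 (hs.setReg x i)

theorem eval_le_size (e : Expr) {m : ℕ} : ∀ {M : ℕ} {s : State}, e.fresh ≤ m → Bounded m M s →
    e.eval s ≤ e.size.eval M := by
  induction e with
  | lit c => intros; simp [eval, size]
  | var x => intro M s h hs; simpa [eval, size] using hs.1 x h
  | get a e ih => intro M s h hs; simpa [eval, size] using hs.2 _ _
  | add e f ihe ihf =>
    intro M s h hs
    simp only [fresh, max_le_iff] at h
    simpa [eval, size] using add_le_add (ihe h.1 hs) (ihf h.2 hs)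
  | mul e f ihe ihf =>
    intro M s h hs
    simp only [fresh, max_le_iff] at h
    simpa [eval, size] using Nat.mul_le_mul (ihe h.1 hs) (ihf h.2 hs)
  | lt e f => intro M s _ _; simp only [eval, size, Polynomial.eval_one]; split <;> simp
  | eq e f => intro M s _ _; simp only [eval, size, Polynomial.eval_one]; split <;> simp
  | sum x e f ihe ihf =>
    intro M s h hs
    simp only [fresh, max_le_iff] at h
    have he := ihe h.2.1 hs
    simp only [eval, size, Polynomial.eval_mul, Polynomial.eval_comp, Polynomial.eval_add,
      Polynomial.eval_X]
    calc _ ≤ ∑ i ∈ Finset.range (e.eval s), f.size.eval (M + e.size.eval M) := by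
          -- The summation register holds an index below the value of `e`, so the body sees a state
          -- bounded by `M + e.size.eval M`; hence the composition in `size`.
          refine Finset.sum_le_sum fun i hi => ihf h.2.2 ?_
          exact (hs.mono (Nat.le_add_right _ _)).setReg x (by
            have := Finset.mem_range.1 hi; omega)
      _ ≤ _ := by
          simp only [Finset.sum_const, Finset.card_range, smul_eq_mul]
          exact Nat.mul_le_mul_right _ he

end Expr

/-- Add register `y` to register `d`, using `z` as the constant `0`. -/
def addTo (d y z : ℕ) : Prog :=
  .seq (.instr (.const z 0)) (.loop (.lt z y) (.seq (.instr (.succ d d)) (.instr (.pred y y))))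

/-- Register `y` counts down to 0 while `d` counts up, at two instructions and one test per unit.
The content of `y` is lost. -/
theorem addTo_runs {d y z : ℕ} (h1 : d ≠ y) (h2 : d ≠ z) (h3 : y ≠ z) (s : State) :
    Runs (addTo d y z) s (3 * s.reg y + 2) fun s' =>
      s'.reg d = s.reg d + s.reg y ∧ s'.arr = s.arr ∧
        ∀ x, x ≠ d → x ≠ y → x ≠ z → s'.reg x = s.reg x := by
  have hl : Runs (.loop (.lt z y) (.seq (.instr (.succ d d)) (.instr (.pred y y))))
      (s.setReg z 0) (s.reg y * (2 + 1) + 1) fun s' =>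
      s'.reg d = s.reg d + s.reg y ∧ s'.reg y = s.reg y - s.reg y ∧ s'.reg z = 0 ∧
        s'.arr = s.arr ∧ ∀ x, x ≠ d → x ≠ y → x ≠ z → s'.reg x = s.reg x := by
    refine Runs.loop (fun j s' => s'.reg d = s.reg d + j ∧ s'.reg y = s.reg y - j ∧ s'.reg z = 0 ∧
        s'.arr = s.arr ∧ ∀ x, x ≠ d → x ≠ y → x ≠ z → s'.reg x = s.reg x) (s.reg y) ?_ ?_ ?_
    · rintro j s' hj ⟨-, hy, hz, -⟩
      simp only [Test.Holds, hy, hz]; omega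
    · rintro j s' hj ⟨hd, hy, hz, ha, hx⟩
      refine Runs.seq (T := 1) (U := 1) (Runs.instr (Runs.instr ?_))
      simp only [Instr.run, State.setReg_reg, State.setReg_arr]
      refine ⟨?_, ?_, ?_, ha, fun x hxd hxy hxz => ?_⟩
      · simp [h1, hd]; omega
      · simp [h1.symm, hy]; omega
      · simp [h2.symm, h3.symm, hz]
      · simp [hxd, hxy, hx x hxd hxy hxz]
    · simp [h2, h3]
      intro x _ _ hz hz'; exact absurd hz' hz
  refine Runs.mono (Runs.seq (Runs.instr (hl))) (by omega) ?_
  rintro s' ⟨a, -, -, b, c⟩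
  exact ⟨a, b, c⟩

namespace Expr

/-- The code that evaluates an expression into register `d`; it uses registers from `d` on. -/
def compile : Expr → ℕ → Prog
  | lit c, d => .instr (.const d c)
  | var x, d => .instr (.copy d x)
  | get a e, d => .seq (e.compile d) (.instr (.load d a d))
  | add e f, d => .seq (e.compile d) (.seq (f.compile (d + 1)) (addTo d (d + 1) (d + 2)))
  | mul e f, d => .seq (e.compile d) (.seq (f.compile (d + 1)) (.seq (.instr (.const (d + 2) 0))
      (.seq (.instr (.const (d + 3) 0)) (.seq (.loop (.lt (d + 3) d) (.seq (.instr (.pred d d))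
        (.seq (.instr (.copy (d + 4) (d + 1))) (addTo (d + 2) (d + 4) (d + 5)))))
        (.instr (.copy d (d + 2)))))))
  | lt e f, d => .seq (e.compile d) (.seq (f.compile (d + 1))
      (.branch (.lt d (d + 1)) (.instr (.const d 1)) (.instr (.const d 0))))
  | eq e f, d => .seq (e.compile d) (.seq (f.compile (d + 1))
      (.branch (.eq d (d + 1)) (.instr (.const d 1)) (.instr (.const d 0))))
  | sum x e f, d => .seq (e.compile (d + 1)) (.seq (.instr (.copy (d + 2) x))
      (.seq (.instr (.const d 0)) (.seq (.instr (.const (d + 3) 0))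
        (.seq (.loop (.lt (d + 3) (d + 1)) (.seq (.instr (.copy x (d + 3)))
          (.seq (f.compile (d + 4)) (.seq (addTo d (d + 4) (d + 5))
            (.instr (.succ (d + 3) (d + 3)))))))
          (.instr (.copy x (d + 2)))))))

/-- A bound for the running time of the code of an expression. -/
noncomputable def cost : Expr → Polynomial ℕ
  | lit _ => 1
  | var _ => 1
  | get _ e => e.cost + 1
  | add e f => e.cost + (f.cost + (3 * f.size + 2))
  | mul e f => e.cost + (f.cost + (1 + (1 + ((e.size * (1 + (1 + (3 * f.size + 2)) + 1) + 1) + 1))))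
  | lt e f => e.cost + (f.cost + 2)
  | eq e f => e.cost + (f.cost + 2)
  | sum _ e f => e.cost + (1 + (1 + (1 + ((e.size * (1 + (f.cost.comp (Polynomial.X + e.size) +
      ((3 * f.size.comp (Polynomial.X + e.size) + 2) + 1)) + 1) + 1) + 1))))

/-- Temporaries live in registers from `d` on, clear of the program variables below `m`. Agreement
is claimed below `d` and not only below `m`, so that the value of a first subexpression, held in
register `d`, survives the evaluation of a second one compiled at `d + 1`. -/
theorem compile_runs (e : Expr) {m : ℕ} : ∀ {d M : ℕ} {s : State}, e.fresh ≤ m → m ≤ d →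
    Bounded m M s → Runs (e.compile d) s (e.cost.eval M) fun s' =>
      Agree d s s' ∧ s'.reg d = e.eval s := by
  induction e with
  | lit c =>
    intro d M s _ _ _
    simp only [cost, Polynomial.eval_one]
    refine Runs.instr ⟨⟨fun x hx => ?_, rfl⟩, ?_⟩ <;> simp [Instr.run, eval]
    omega
  | var y =>
    intro d M s _ _ _
    simp only [cost, Polynomial.eval_one]
    refine Runs.instr ⟨⟨fun x hx => ?_, rfl⟩, ?_⟩ <;> simp [Instr.run, eval]
    omega
  | get a e ih =>
    intro d M s h hd hs
    simp only [cost, Polynomial.eval_one, Polynomial.eval_add]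
    refine Runs.seq ((ih h hd hs).mono le_rfl ?_)
    rintro s' ⟨h1, h2⟩
    refine Runs.instr ⟨⟨fun x hx => ?_, h1.2⟩, ?_⟩
    · have : x ≠ d := by omega
      simp [Instr.run, this, h1.1 x hx]
    · simp [Instr.run, eval, h2, h1.2]
  | lt e f ihe ihf | eq e f ihe ihf =>
    intro d M s h hd hs
    simp only [fresh, max_le_iff] at h
    simp only [cost, Polynomial.eval_add, Polynomial.eval_ofNat]
    refine Runs.seq ((ihe h.1 hd hs).mono le_rfl ?_)
    rintro s' ⟨h1, h2⟩
    have hs' := h1.mono hd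
    refine Runs.seq ((ihf (d := d + 1) h.2 (by omega) (hs.congr hs')).mono le_rfl ?_)
    rintro s'' ⟨h3, h4⟩
    have e1 := h3.1 d (by omega)
    have e2 := f.eval_congr h.2 hs'
    refine Runs.branch (T := 1) (fun hb => Runs.instr ?_) (fun hb => Runs.instr ?_)
    all_goals
      simp only [Test.Holds, ← e1, h2, h4, ← e2] at hb
      refine ⟨⟨fun x hx => ?_, h1.2.trans h3.2⟩, ?_⟩
      · have : x ≠ d := by omega
        simp [Instr.run, this, h1.1 x hx, h3.1 x (by omega)]
      · simp [Instr.run, eval, hb]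
  | add e f ihe ihf =>
    intro d M s h hd hs
    simp only [fresh, max_le_iff] at h
    simp only [cost, Polynomial.eval_add, Polynomial.eval_ofNat, Polynomial.eval_mul]
    refine Runs.seq ((ihe h.1 hd hs).mono le_rfl ?_)
    rintro s' ⟨h1, h2⟩
    have hs' := h1.mono hd
    refine Runs.seq ((ihf (d := d + 1) h.2 (by omega) (hs.congr hs')).mono le_rfl ?_)
    rintro s'' ⟨h3, h4⟩
    have e1 := h3.1 d (by omega)
    have e2 := f.eval_congr h.2 hs'
    have e3 := f.eval_le_size h.2 hs
    refine (addTo_runs (by omega) (by omega) (by omega) s'').mono (by rw [h4, ← e2]; omega) ?_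
    rintro t ⟨h5, h6, h7⟩
    refine ⟨⟨fun x hx => ?_, h1.2.trans (h3.2.trans h6.symm)⟩, ?_⟩
    · rw [h7 x (by omega) (by omega) (by omega), ← h3.1 x (by omega), h1.1 x hx]
    · rw [h5, h4, ← e1, h2, ← e2]; rfl
  | mul e f ihe ihf =>
    intro d M s h hd hs
    simp only [fresh, max_le_iff] at h
    simp only [cost, Polynomial.eval_add, Polynomial.eval_ofNat, Polynomial.eval_mul,
      Polynomial.eval_one]
    refine Runs.seq ((ihe h.1 hd hs).mono le_rfl ?_)
    rintro s' ⟨h1, h2⟩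
    have hs' := h1.mono hd
    refine Runs.seq ((ihf (d := d + 1) h.2 (by omega) (hs.congr hs')).mono le_rfl ?_)
    rintro s'' ⟨h3, h4⟩
    have e1 := h3.1 d (by omega)
    have e2 := f.eval_congr h.2 hs'
    have e3 := f.eval_le_size h.2 hs
    have e4 := e.eval_le_size h.1 hs
    refine Runs.seq (Runs.instr (Runs.seq (Runs.instr (Runs.seq ?_))))
    set N := e.eval s with hN
    set K := f.eval s with hK
    -- Repeated addition: `d` counts down the first factor and `d + 2` accumulates. The second
    -- factor is copied to `d + 4` in each round because `addTo` empties its source.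
    have hloop := Runs.loop (b := .lt (d + 3) d) (p := .seq (.instr (.pred d d))
        (.seq (.instr (.copy (d + 4) (d + 1))) (addTo (d + 2) (d + 4) (d + 5))))
        (T := 1 + (1 + (3 * K + 2)))
        (fun j t => t.reg d = N - j ∧ t.reg (d + 1) = K ∧ t.reg (d + 2) = j * K ∧
          t.reg (d + 3) = 0 ∧ Agree d s t) N
        (by
          rintro j t hj ⟨a1, a2, a3, a4, a5⟩
          simp only [Test.Holds, a1, a4]; omega)
        (by
          rintro j t hj ⟨a1, a2, a3, a4, a5⟩
          refine Runs.seq (Runs.instr (Runs.seq (Runs.instr ?_)))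
          refine (addTo_runs (by omega) (by omega) (by omega) _).mono ?_ ?_
          · simp [Instr.run, a2]
          · rintro t' ⟨b1, b2, b3⟩
            refine ⟨?_, ?_, ?_, ?_, ⟨fun x hx => ?_, ?_⟩⟩
            · rw [b3 _ (by omega) (by omega) (by omega)]; simp [Instr.run, a1]; omega
            · rw [b3 _ (by omega) (by omega) (by omega)]; simp [Instr.run, a2]
            · rw [b1]; simp [Instr.run, a2, a3, Nat.succ_mul]
            · rw [b3 _ (by omega) (by omega) (by omega)]; simp [Instr.run, a4]
            · rw [b3 _ (by omega) (by omega) (by omega), a5.1 x hx]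
              have q1 : x ≠ d := by omega
              have q2 : x ≠ d + 4 := by omega
              simp [Instr.run, q1, q2]
            · rw [b2, a5.2]; rfl)
        (s := (Instr.const (d + 3) 0).run ((Instr.const (d + 2) 0).run s'')) (by
          refine ⟨?_, ?_, ?_, ?_, ⟨fun x hx => ?_, ?_⟩⟩
          · simp [Instr.run, ← e1, h2]
          · simp [Instr.run, h4, ← e2]
          · simp [Instr.run]
          · simp [Instr.run]
          · have q1 : x ≠ d + 2 := by omega
            have q2 : x ≠ d + 3 := by omega
            simp [Instr.run, q1, q2, h1.1 x hx, h3.1 x (by omega)]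
          · exact h1.2.trans h3.2)
    refine hloop.mono (by gcongr) ?_
    rintro t ⟨a1, a2, a3, a4, a5⟩
    refine Runs.instr ⟨⟨fun x hx => ?_, a5.2⟩, ?_⟩
    · have : x ≠ d := by omega
      simp [Instr.run, this, a5.1 x hx]
    · simp [Instr.run, eval, a3, hN, hK]
  | sum x e f ihe ihf =>
    intro d M s h hd hs
    simp only [fresh, max_le_iff] at h
    simp only [cost, Polynomial.eval_add, Polynomial.eval_ofNat, Polynomial.eval_mul,
      Polynomial.eval_one, Polynomial.eval_comp, Polynomial.eval_X]
    refine Runs.seq ((ihe (d := d + 1) h.2.1 (by omega) hs).mono le_rfl ?_)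
    rintro s' ⟨h1, h2⟩
    have e4 := e.eval_le_size h.2.1 hs
    have hB := hs.mono (Nat.le_add_right M (e.size.eval M))
    refine Runs.seq (Runs.instr (Runs.seq (Runs.instr (Runs.seq (Runs.instr (Runs.seq ?_))))))
    set N := e.eval s with hN
    set M' := M + e.size.eval M with hM'
    -- The summation register `x` lies below `d` and must be intact at the end. It is saved in `d +
    -- 2` and restored after the loop, so the invariant exempts it.
    have hloop := Runs.loop (b := .lt (d + 3) (d + 1)) (p := .seq (.instr (.copy x (d + 3)))
          (.seq (f.compile (d + 4)) (.seq (addTo d (d + 4) (d + 5))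
            (.instr (.succ (d + 3) (d + 3))))))
        (T := 1 + (f.cost.eval M' + ((3 * f.size.eval M' + 2) + 1)))
        (fun j t => t.reg (d + 1) = N ∧ t.reg (d + 2) = s.reg x ∧
          t.reg d = ∑ i ∈ Finset.range j, f.eval (s.setReg x i) ∧
          t.reg (d + 3) = j ∧ t.arr = s.arr ∧ ∀ y < d, y ≠ x → t.reg y = s.reg y) N
        (by
          rintro j t hj ⟨a1, a2, a3, a4, a5⟩
          simp only [Test.Holds, a1, a4])
        (by
          rintro j t hj ⟨a1, a2, a3, a4, a5, a6⟩
          refine Runs.seq (Runs.instr ?_)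
          have hag : Agree m (s.setReg x j) ((Instr.copy x (d + 3)).run t) := by
            refine ⟨fun y hy => ?_, a5.symm⟩
            by_cases hyx : y = x
            · simp [Instr.run, hyx, a4]
            · simp [Instr.run, hyx, a6 y (by omega) hyx]
          have hbd : Bounded m M' (s.setReg x j) := hB.setReg x (by omega)
          have e5 := f.eval_congr h.2.2 hag
          have e6 := f.eval_le_size h.2.2 hbd
          refine Runs.seq ((ihf (d := d + 4) h.2.2 (by omega) (hbd.congr hag)).mono le_rfl ?_)
          rintro t' ⟨b1, b2⟩
          rw [← e5] at b2
          refine Runs.seq ((addTo_runs (by omega) (by omega) (by omega) _).mono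
            (by rw [b2]; omega) ?_)
          rintro t'' ⟨c1, c2, c3⟩
          refine Runs.instr ⟨?_, ?_, ?_, ?_, ?_, fun y hy hyx => ?_⟩
          · have := b1.1 (d + 1) (by omega)
            have q1 : d + 1 ≠ x := by omega
            simp [Instr.run, c3 (d + 1), ← this, a1, q1]
          · have := b1.1 (d + 2) (by omega)
            have q1 : d + 2 ≠ x := by omega
            simp [Instr.run, c3 (d + 2), ← this, a2, q1]
          · have := b1.1 d (by omega)
            have q1 : d ≠ x := by omega
            rw [Finset.sum_range_succ]
            simp [Instr.run, c1, b2, ← this, a3, q1]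
          · have := b1.1 (d + 3) (by omega)
            have q1 : d + 3 ≠ x := by omega
            simp [Instr.run, c3 (d + 3), ← this, a4, q1]
          · exact c2.trans (b1.2.symm.trans a5)
          · have := b1.1 y (by omega)
            have q0 : y ≠ d + 3 := by omega
            simp only [Instr.run, State.setReg_reg, q0, if_false]
            rw [c3 y (by omega) (by omega) (by omega), ← this]
            simp [Instr.run, hyx, a6 y hy hyx])
        (s := (Instr.const (d + 3) 0).run ((Instr.const d 0).run ((Instr.copy (d + 2) x).run s'))) (by
          refine ⟨?_, ?_, ?_, ?_, ?_, fun y hy hyx => ?_⟩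
          · simp [Instr.run, h2]
          · simp [Instr.run, h1.1 x (by omega)]
          · simp [Instr.run]
          · simp [Instr.run]
          · exact h1.2.symm
          · have q1 : y ≠ d + 2 := by omega
            have q2 : y ≠ d + 3 := by omega
            have q3 : y ≠ d := by omega
            simp [Instr.run, q1, q2, q3, h1.1 y (by omega)])
    refine hloop.mono (by gcongr) ?_
    rintro t ⟨a1, a2, a3, a4, a5, a6⟩
    refine Runs.instr ⟨⟨fun y hy => ?_, a5.symm⟩, ?_⟩
    · by_cases hyx : y = x
      · simp [Instr.run, hyx, a2]
      · simp [Instr.run, hyx, a6 y hy hyx]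
    · have : d ≠ x := by omega
      simp [Instr.run, eval, a3, hN, this]

end Expr

end RAM

namespace RAM

/-! ### Structured statements and their compilation -/

/-- Structured statements: `assign x e` is `x := e`, `store a e f` is `a[e] := f`, `cond e p q`
runs `p` if `e` is positive and `q` otherwise, and `for_ x e p` runs `p` for `x` from `0` to
`e - 1`, where the bound `e` is evaluated once. -/
inductive Stmt where
  | assign (x : ℕ) (e : Expr)
  | store (a : ℕ) (e f : Expr)
  | skip
  | seq (p q : Stmt)
  | cond (e : Expr) (p q : Stmt)
  | for_ (x : ℕ) (e : Expr) (p : Stmt)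

namespace Stmt

/-- The states at the beginning of the iterations of a loop. -/
def iter (x : ℕ) (f : State → State) (s : State) : ℕ → State
  | 0 => s
  | i + 1 => f ((iter x f s i).setReg x i)

/-- The effect of a statement. -/
def eval : Stmt → State → State
  | assign x e, s => s.setReg x (e.eval s)
  | store a e f, s => s.setArr a (e.eval s) (f.eval s)
  | skip, s => s
  | seq p q, s => q.eval (p.eval s)
  | cond e p q, s => if 0 < e.eval s then p.eval s else q.eval s
  | for_ x e p, s => iter x p.eval s (e.eval s)

/-- All registers that occur in the statement are below this number. -/
def fresh : Stmt → ℕ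
  | assign x e => max (x + 1) e.fresh
  | store _ e f => max e.fresh f.fresh
  | skip => 0
  | seq p q => max p.fresh q.fresh
  | cond e p q => max e.fresh (max p.fresh q.fresh)
  | for_ x e p => max (x + 1) (max e.fresh p.fresh)

/-- The code of a statement; it uses registers from `d` on for intermediate results. -/
def compile : Stmt → ℕ → Prog
  | assign x e, d => .seq (e.compile d) (.instr (.copy x d))
  | store a e f, d => .seq (e.compile d) (.seq (f.compile (d + 1)) (.instr (.store a d (d + 1))))
  | skip, _ => .skip
  | seq p q, d => .seq (p.compile d) (q.compile d)
  | cond e p q, d => .seq (e.compile d) (.seq (.instr (.const (d + 1) 0))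
      (.branch (.lt (d + 1) d) (p.compile d) (q.compile d)))
  | for_ x e p, d => .seq (e.compile d) (.seq (.instr (.const (d + 1) 0))
      (.loop (.lt (d + 1) d) (.seq (.instr (.copy x (d + 1)))
        (.seq (p.compile (d + 2)) (.instr (.succ (d + 1) (d + 1)))))))

/-- A bound for the running time of the code of a statement, in terms of a bound for all states
that occur. -/
noncomputable def cost : Stmt → Polynomial ℕ
  | assign _ e => e.cost + 1
  | store _ e f => e.cost + (f.cost + 1)
  | skip => 1
  | seq p q => p.cost + q.cost
  | cond e p q => e.cost + (1 + (p.cost + q.cost + 1))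
  | for_ _ e p => e.cost + (1 + (e.size * (1 + (p.cost + 1) + 1) + 1))

/-- All states that occur in the run of the statement are bounded by `M`. -/
def Safe (m M : ℕ) : Stmt → State → Prop
  | assign _ _, s => Bounded m M s
  | store _ _ _, s => Bounded m M s
  | skip, _ => True
  | seq p q, s => p.Safe m M s ∧ q.Safe m M (p.eval s)
  | cond e p q, s => Bounded m M s ∧ (0 < e.eval s → p.Safe m M s) ∧
      (¬ 0 < e.eval s → q.Safe m M s)
  | for_ x e p, s => Bounded m M s ∧ ∀ i < e.eval s, p.Safe m M ((iter x p.eval s i).setReg x i)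

/-- The machine state `s` and the abstract state `s₀` agree only below `m`, since higher registers
hold temporaries. Preservation of the registers in [m, d) is what loops need: their bound and
counter sit in `d` and `d + 1` while the body is compiled at `d + 2`. -/
theorem compile_runs (p : Stmt) {m M : ℕ} : ∀ {d : ℕ} {s s₀ : State}, p.fresh ≤ m → m ≤ d →
    Agree m s s₀ → p.Safe m M s₀ → Runs (p.compile d) s (p.cost.eval M) fun s' =>
      Agree m s' (p.eval s₀) ∧ ∀ x, m ≤ x → x < d → s'.reg x = s.reg x := by
  induction p with
  | assign x e =>
    intro d s s₀ h hd hs hB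
    simp only [fresh, max_le_iff] at h
    simp only [cost, Polynomial.eval_add, Polynomial.eval_one]
    have hB' : Bounded m M s₀ := hB
    refine Runs.seq ((e.compile_runs h.2 hd (hB'.congr hs.symm)).mono le_rfl ?_)
    rintro s' ⟨h1, h2⟩
    refine Runs.instr ⟨⟨fun y hy => ?_, h1.2.symm.trans hs.2⟩, fun y hy hyd => ?_⟩
    · simp [Instr.run, eval, h2, e.eval_congr h.2 hs, ← h1.1 y (by omega), hs.1 y hy]
    · have : y ≠ x := by omega
      simp [Instr.run, this, h1.1 y hyd]
  | store a e f =>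
    intro d s s₀ h hd hs hB
    simp only [fresh, max_le_iff] at h
    simp only [cost, Polynomial.eval_add, Polynomial.eval_one]
    have hB' : Bounded m M s₀ := hB
    refine Runs.seq ((e.compile_runs h.1 hd (hB'.congr hs.symm)).mono le_rfl ?_)
    rintro s' ⟨h1, h2⟩
    have hs' := (h1.mono hd).symm.trans hs
    refine Runs.seq ((f.compile_runs (d := d + 1) h.2 (by omega) (hB'.congr hs'.symm)).mono
      le_rfl ?_)
    rintro s'' ⟨h3, h4⟩
    refine Runs.instr ⟨⟨fun y hy => ?_, ?_⟩, fun y hy hyd => ?_⟩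
    · simp [Instr.run, eval, ← h3.1 y (by omega), hs'.1 y hy]
    · have ha : s''.arr = s₀.arr := h3.2.symm.trans hs'.2
      simp only [Instr.run, eval, State.setArr, ha, h4, ← h3.1 d (by omega), h2,
        e.eval_congr h.1 hs, f.eval_congr h.2 hs']
    · simp [Instr.run, ← h3.1 y (by omega), ← h1.1 y hyd]
  | skip =>
    intro d s s₀ h hd hs hB
    exact ⟨1, s, .skip s, by simp [cost], hs, fun _ _ _ => rfl⟩
  | seq p q ihp ihq =>
    intro d s s₀ h hd hs hB
    simp only [fresh, max_le_iff] at h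
    simp only [cost, Polynomial.eval_add]
    refine Runs.seq ((ihp h.1 hd hs hB.1).mono le_rfl ?_)
    rintro s' ⟨h1, h2⟩
    refine (ihq h.2 hd h1 hB.2).mono le_rfl ?_
    rintro s'' ⟨h3, h4⟩
    exact ⟨h3, fun x hx hxd => (h4 x hx hxd).trans (h2 x hx hxd)⟩
  | cond e p q ihp ihq =>
    intro d s s₀ h hd hs hB
    simp only [fresh, max_le_iff] at h
    simp only [cost, Polynomial.eval_add, Polynomial.eval_one]
    obtain ⟨hB, hp, hq⟩ := hB
    refine Runs.seq ((e.compile_runs h.1 hd (hB.congr hs.symm)).mono le_rfl ?_)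
    rintro s' ⟨h1, h2⟩
    have hs' := (h1.mono hd).symm.trans hs
    have hag : Agree m ((Instr.const (d + 1) 0).run s') s₀ := by
      refine ⟨fun y hy => ?_, hs'.2⟩
      have : y ≠ d + 1 := by omega
      simp [Instr.run, this, hs'.1 y hy]
    have hfr : ∀ y < d, ((Instr.const (d + 1) 0).run s').reg y = s.reg y := by
      intro y hy
      have : y ≠ d + 1 := by omega
      simp [Instr.run, this, h1.1 y hy]
    have hv : (Test.lt (d + 1) d).Holds ((Instr.const (d + 1) 0).run s') ↔ 0 < e.eval s₀ := by
      simp [Test.Holds, Instr.run, h2, e.eval_congr h.1 hs]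
    refine Runs.seq (Runs.instr (Runs.branch (fun hb => ?_) (fun hb => ?_)))
    · rw [hv] at hb
      refine (ihp h.2.1 hd hag (hp hb)).mono (Nat.le_add_right _ _) ?_
      rintro s'' ⟨h3, h4⟩
      simp only [eval, hb, if_true]
      exact ⟨h3, fun x hx hxd => (h4 x hx hxd).trans (hfr x hxd)⟩
    · rw [hv] at hb
      refine (ihq h.2.2 hd hag (hq hb)).mono (Nat.le_add_left _ _) ?_
      rintro s'' ⟨h3, h4⟩
      simp only [eval, hb, if_false]
      exact ⟨h3, fun x hx hxd => (h4 x hx hxd).trans (hfr x hxd)⟩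
  | for_ x e p ih =>
    intro d s s₀ h hd hs hB
    simp only [fresh, max_le_iff] at h
    simp only [cost, Polynomial.eval_add, Polynomial.eval_one, Polynomial.eval_mul]
    obtain ⟨hB, hp⟩ := hB
    refine Runs.seq ((e.compile_runs h.2.1 hd (hB.congr hs.symm)).mono le_rfl ?_)
    rintro s' ⟨h1, h2⟩
    have hs' := (h1.mono hd).symm.trans hs
    rw [e.eval_congr h.2.1 hs] at h2
    refine Runs.seq (Runs.instr ?_)
    have hloop := Runs.loop (b := .lt (d + 1) d) (p := .seq (.instr (.copy x (d + 1)))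
        (.seq (p.compile (d + 2)) (.instr (.succ (d + 1) (d + 1)))))
        (T := 1 + (p.cost.eval M + 1))
        (fun j t => t.reg d = e.eval s₀ ∧ t.reg (d + 1) = j ∧ Agree m t (iter x p.eval s₀ j) ∧
          ∀ y, m ≤ y → y < d → t.reg y = s.reg y) (e.eval s₀)
        (by
          rintro j t hj ⟨a1, a2, -⟩
          simp only [Test.Holds, a1, a2])
        (by
          rintro j t hj ⟨a1, a2, a3, a4⟩
          refine Runs.seq (Runs.instr ?_)
          have hag : Agree m ((Instr.copy x (d + 1)).run t) ((iter x p.eval s₀ j).setReg x j) := by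
            have := a3.setReg x j
            simpa only [Instr.run, a2] using this
          refine Runs.seq ((ih (d := d + 2) h.2.2 (by omega) hag (hp j hj)).mono le_rfl ?_)
          rintro t' ⟨b1, b2⟩
          refine Runs.instr ⟨?_, ?_, ⟨fun y hy => ?_, b1.2⟩, fun y hy hyd => ?_⟩
          · have q : d ≠ x := by omega
            simp [Instr.run, b2 d hd (by omega), q, a1]
          · have q : d + 1 ≠ x := by omega
            simp [Instr.run, b2 (d + 1) (by omega) (by omega), q, a2]
          · have q : y ≠ d + 1 := by omega
            simpa [Instr.run, q, iter] using b1.1 y hy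
          · have q : y ≠ d + 1 := by omega
            have q' : y ≠ x := by omega
            simp [Instr.run, q, b2 y hy (by omega), q', a4 y hy hyd])
        (s := (Instr.const (d + 1) 0).run s') (by
          refine ⟨?_, ?_, ⟨fun y hy => ?_, hs'.2⟩, fun y hy hyd => ?_⟩
          · simp [Instr.run, h2]
          · simp [Instr.run]
          · have q : y ≠ d + 1 := by omega
            simp [Instr.run, q, iter, hs'.1 y hy]
          · have q : y ≠ d + 1 := by omega
            simp [Instr.run, q, h1.1 y hyd])
    refine hloop.mono ?_ ?_
    · gcongr
      exact e.eval_le_size h.2.1 hB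
    · rintro t ⟨-, -, a3, a4⟩
      exact ⟨a3, a4⟩

/-! ### Bounded runs, loop induction and frame rules -/

/-- Expressions whose values obviously do not exceed the bound for the state. -/
def _root_.RAM.Expr.Small (C : ℕ) : Expr → Prop
  | .lit c => c ≤ C
  | .var _ => True
  | .get _ _ => True
  | .eq _ _ => 1 ≤ C
  | _ => False

/-- Statements that write only constants up to `C` and numbers that are already there. -/
def Small (C : ℕ) : Stmt → Prop
  | assign _ e => e.Small C
  | store _ _ f => f.Small C
  | skip => True
  | seq p q => p.Small C ∧ q.Small C
  | cond _ p q => p.Small C ∧ q.Small C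
  | for_ _ e p => e.Small C ∧ p.Small C

theorem _root_.RAM.Expr.Small.eval_le {C m M : ℕ} {e : Expr} (h : e.Small C) (hC : C ≤ M)
    (he : e.fresh ≤ m) {s : State} (hs : Bounded m M s) : e.eval s ≤ M := by
  cases e with
  | lit c => exact le_trans h hC
  | var x => exact hs.1 x he
  | get a e => exact hs.2 _ _
  | eq e f =>
    have h' : 1 ≤ C := h
    simp only [Expr.eval]
    split <;> omega
  | _ => exact h.elim

/-- No stored number can exceed `M`: it is a constant up to `C`, or a copy, or a loop index below a
bound that is itself `Small`. Tests and array indices are unrestricted, because their intermediate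
values are never stored in the abstract state and are charged through `Expr.size`. -/
theorem Small.safe {C m M : ℕ} (hC : C ≤ M) {p : Stmt} : ∀ {s : State}, p.Small C → p.fresh ≤ m →
    Bounded m M s → p.Safe m M s ∧ Bounded m M (p.eval s) := by
  induction p with
  | assign x e =>
    intro s h hf hs
    simp only [fresh, max_le_iff] at hf
    exact ⟨hs, hs.setReg _ (Expr.Small.eval_le h hC hf.2 hs)⟩
  | store a e f =>
    intro s h hf hs
    simp only [fresh, max_le_iff] at hf
    exact ⟨hs, hs.setArr _ _ (Expr.Small.eval_le h hC hf.2 hs)⟩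
  | skip => intro s _ _ hs; exact ⟨trivial, hs⟩
  | seq p q ihp ihq =>
    intro s h hf hs
    simp only [fresh, max_le_iff] at hf
    have h1 := ihp h.1 hf.1 hs
    have h2 := ihq h.2 hf.2 h1.2
    exact ⟨⟨h1.1, h2.1⟩, h2.2⟩
  | cond e p q ihp ihq =>
    intro s h hf hs
    simp only [fresh, max_le_iff] at hf
    have h1 := ihp h.1 hf.2.1 hs
    have h2 := ihq h.2 hf.2.2 hs
    refine ⟨⟨hs, fun _ => h1.1, fun _ => h2.1⟩, ?_⟩
    simp only [eval]
    split
    · exact h1.2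
    · exact h2.2
  | for_ x e p ih =>
    intro s h hf hs
    simp only [fresh, max_le_iff] at hf
    have he := Expr.Small.eval_le h.1 hC hf.2.1 hs
    have key : ∀ i ≤ e.eval s, Bounded m M (iter x p.eval s i) := by
      intro i
      induction i with
      | zero => intro _; exact hs
      | succ i ih' =>
        intro hi
        exact (ih h.2 hf.2.2 ((ih' (by omega)).setReg x (by omega))).2
    exact ⟨⟨hs, fun i hi => (ih h.2 hf.2.2 ((key i hi.le).setReg x (by omega))).1⟩, key _ le_rfl⟩

/-- The induction principle for loops. -/
theorem for_induct {x : ℕ} {e : Expr} {p : Stmt} {s : State} (I : ℕ → State → Prop)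
    (h0 : I 0 s) (hp : ∀ i < e.eval s, ∀ t, I i t → I (i + 1) (p.eval (t.setReg x i))) :
    I (e.eval s) ((for_ x e p).eval s) := by
  have key : ∀ i ≤ e.eval s, I i (iter x p.eval s i) := by
    intro i
    induction i with
    | zero => intro _; exact h0
    | succ i ih => intro hi; exact hp i hi _ (ih (by omega))
  exact key _ le_rfl

/-- The arrays a statement writes to. -/
def arrs : Stmt → List ℕ
  | assign _ _ => []
  | store a _ _ => [a]
  | skip => []
  | seq p q => p.arrs ++ q.arrs
  | cond _ p q => p.arrs ++ q.arrs
  | for_ _ _ p => p.arrs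

/-- The registers a statement writes to. -/
def regs : Stmt → List ℕ
  | assign x _ => [x]
  | store _ _ _ => []
  | skip => []
  | seq p q => p.regs ++ q.regs
  | cond _ p q => p.regs ++ q.regs
  | for_ x _ p => x :: p.regs

/-- A frame rule whose hypothesis is decidable for a concrete program. -/
theorem eval_arr {p : Stmt} {a : ℕ} : ∀ {s : State}, a ∉ p.arrs → (p.eval s).arr a = s.arr a := by
  induction p with
  | assign x e => intro s _; rfl
  | store b e f =>
    intro s h
    simp only [arrs, List.mem_singleton] at h
    simp only [eval, State.setArr_arr, h, if_false]
  | skip => intro s _; rfl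
  | seq p q ihp ihq =>
    intro s h
    simp only [arrs, List.mem_append, not_or] at h
    simp only [eval]; rw [ihq h.2, ihp h.1]
  | cond e p q ihp ihq =>
    intro s h
    simp only [arrs, List.mem_append, not_or] at h
    simp only [eval]
    split
    · exact ihp h.1
    · exact ihq h.2
  | for_ x e p ih =>
    intro s h
    exact for_induct (fun _ t => t.arr a = s.arr a) rfl fun i _ t ht => (ih h).trans ht

theorem eval_reg {p : Stmt} {y : ℕ} : ∀ {s : State}, y ∉ p.regs → (p.eval s).reg y = s.reg y := by
  induction p with
  | assign x e =>
    intro s h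
    simp only [regs, List.mem_singleton] at h
    simp [eval, h]
  | store b e f => intro s h; rfl
  | skip => intro s _; rfl
  | seq p q ihp ihq =>
    intro s h
    simp only [regs, List.mem_append, not_or] at h
    simp only [eval]; rw [ihq h.2, ihp h.1]
  | cond e p q ihp ihq =>
    intro s h
    simp only [regs, List.mem_append, not_or] at h
    simp only [eval]
    split
    · exact ihp h.1
    · exact ihq h.2
  | for_ x e p ih =>
    intro s h
    simp only [regs, List.mem_cons, not_or] at h
    refine for_induct (fun _ t => t.reg y = s.reg y) rfl fun i _ t ht => ?_
    rw [ih h.2, State.setReg_reg, if_neg h.1, ht]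

end Stmt

end RAM

/-! ### Colourings and their keys -/

section Colouring

open scoped Classical

variable {n : ℕ}

/-- The number of neighbours of `v` with colour `q`. -/
noncomputable def colourDegree (G : SimpleGraph (Fin n)) (σ : Fin n → ℕ) (q : ℕ) (v : Fin n) : ℕ :=
  (Finset.univ.filter fun w => G.Adj v w ∧ σ w = q).card

/-- The number of vertices of colour `1`. -/
noncomputable def weight (σ : Fin n → ℕ) : ℕ :=
  (Finset.univ.filter fun v => σ v = 1).card

/-- The vertex `r` is the first one outside of `X` in its clique of `G - X`, and `v` is in the same
clique. -/
def InBlock (G : SimpleGraph (Fin n)) (X : Finset (Fin n)) (r v : Fin n) : Prop :=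
  v ∉ X ∧ r ∉ X ∧ (r = v ∨ G.Adj r v) ∧ ∀ u < r, u ∉ X → ¬ G.Adj u r

/-- The state of a vertex: its colour, and its number of neighbours of the other colour, where only
the values `0`, `1`, and at least `2` are distinguished. -/
noncomputable def digit (G : SimpleGraph (Fin n)) (σ : Fin n → ℕ) (x : Fin n) : ℕ :=
  (if σ x = 1 then 1 + 3 * min (colourDegree G σ 2 x) 2 else 0) +
    (if σ x = 2 then 2 + 3 * min (colourDegree G σ 1 x) 2 else 0)

/-- Whether colour `q` occurs in the block of `r`. -/
noncomputable def blockFlag (G : SimpleGraph (Fin n)) (X : Finset (Fin n)) (r : Fin n)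
    (σ : Fin n → ℕ) (q : ℕ) : ℕ :=
  if ∃ v, InBlock G X r v ∧ σ v = q then 1 else 0

/-- The number that encodes the states of the vertices in `X` and the colours in the block
of `r`. -/
noncomputable def key (G : SimpleGraph (Fin n)) (X : Finset (Fin n)) (P : Fin n → ℕ) (r : Fin n)
    (σ : Fin n → ℕ) : ℕ :=
  (∑ x, if x ∈ X then P x * digit G σ x else 0) +
    (blockFlag G X r σ 1 + 2 * blockFlag G X r σ 2)

/-- The number of `x ∈ X` with `x < i`. -/
noncomputable def rankIn (X : Finset (Fin n)) (i : ℕ) : ℕ := (X.filter fun x : Fin n => (x : ℕ) < i).card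

theorem rankIn_succ (X : Finset (Fin n)) (x : Fin n) :
    rankIn X (x + 1) = rankIn X x + if x ∈ X then 1 else 0 := by
  unfold rankIn
  split_ifs with h
  · have : X.filter (fun y : Fin n => (y : ℕ) < x + 1) = insert x (X.filter fun y : Fin n => (y : ℕ) < x) := by
      ext y
      simp only [Finset.mem_filter, Finset.mem_insert, Nat.lt_succ_iff_lt_or_eq, Fin.ext_iff]
      constructor
      · rintro ⟨a, b | b⟩
        · exact Or.inr ⟨a, b⟩
        · exact Or.inl b
      · rintro (b | ⟨a, b⟩)
        · exact ⟨by rwa [Fin.ext b], Or.inr b⟩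
        · exact ⟨a, Or.inl b⟩
    rw [this, Finset.card_insert_of_notMem (by simp)]
  · congr 1
    ext y
    simp only [Finset.mem_filter, Nat.lt_succ_iff_lt_or_eq]
    constructor
    · rintro ⟨a, b | b⟩
      · exact ⟨a, b⟩
      · exact absurd (Fin.ext b ▸ a) h
    · rintro ⟨a, b⟩
      exact ⟨a, Or.inl b⟩

theorem rankIn_zero (X : Finset (Fin n)) : rankIn X 0 = 0 := by simp [rankIn]

theorem rankIn_self (X : Finset (Fin n)) : rankIn X n = X.card := by
  unfold rankIn
  congr 1
  exact Finset.filter_true_of_mem fun x _ => x.2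

/-- The weight of the digit of `x` in the key. -/
noncomputable def place (X : Finset (Fin n)) (x : Fin n) : ℕ := 4 * 9 ^ rankIn X x

/-- Colour 1 gives 1, 4, 7 and colour 2 gives 2, 5, 8; every other vertex gives 0. The residue
modulo 3 is the colour and the quotient is the capped degree. -/
theorem digit_lt (G : SimpleGraph (Fin n)) (σ : Fin n → ℕ) (x : Fin n) : digit G σ x < 9 := by
  unfold digit
  have h1 := min_le_right (colourDegree G σ 2 x) 2
  have h2 := min_le_right (colourDegree G σ 1 x) 2
  by_cases a : σ x = 1
  · simp [a]; omega
  · by_cases b : σ x = 2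
    · simp [b]; omega
    · simp [a, b]

/-- Uniqueness of mixed-radix expansions: the lowest digit `f` has base 4, and above it the vertices
of `X` contribute digits in base 9, ordered by rank. Everything below the leading digit is less than
its place value, so equal sums have equal leading digits. -/
theorem sum_place_aux (X : Finset (Fin n)) (d d' : Fin n → ℕ) (f f' : ℕ) (hd : ∀ x, d x < 9)
    (hd' : ∀ x, d' x < 9) (hf : f < 4) (hf' : f' < 4) : ∀ i, i ≤ n →
    (∑ x : Fin n, if x ∈ X ∧ (x : ℕ) < i then place X x * d x else 0) + f < 4 * 9 ^ rankIn X i ∧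
    ((∑ x : Fin n, if x ∈ X ∧ (x : ℕ) < i then place X x * d x else 0) + f =
      (∑ x : Fin n, if x ∈ X ∧ (x : ℕ) < i then place X x * d' x else 0) + f' →
      f = f' ∧ ∀ x ∈ X, (x : ℕ) < i → d x = d' x) := by
  have hsum : ∀ (e : Fin n → ℕ) (x : Fin n),
      (∑ y : Fin n, if y ∈ X ∧ (y : ℕ) < x + 1 then place X y * e y else 0) =
      (∑ y : Fin n, if y ∈ X ∧ (y : ℕ) < x then place X y * e y else 0) +
        if x ∈ X then place X x * e x else 0 := by
    intro e x
    rw [← Finset.sum_erase_add _ _ (Finset.mem_univ x),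
      ← Finset.sum_erase_add (f := fun y : Fin n => if y ∈ X ∧ (y : ℕ) < x then place X y * e y
        else 0) _ (Finset.mem_univ x)]
    simp only [lt_self_iff_false, and_false, if_false, add_zero, Nat.lt_succ_self, and_true]
    congr 1
    refine Finset.sum_congr rfl fun y hy => ?_
    have hne : (y : ℕ) ≠ x := fun h => (Finset.mem_erase.1 hy).1 (Fin.ext h)
    have : (y : ℕ) < x + 1 ↔ (y : ℕ) < x := by omega
    simp only [this]
  -- The induction needs the size bound for both expansions.
  have main : ∀ i, i ≤ n →
    (∑ x : Fin n, if x ∈ X ∧ (x : ℕ) < i then place X x * d x else 0) + f < 4 * 9 ^ rankIn X i ∧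
    (∑ x : Fin n, if x ∈ X ∧ (x : ℕ) < i then place X x * d' x else 0) + f' < 4 * 9 ^ rankIn X i ∧
    ((∑ x : Fin n, if x ∈ X ∧ (x : ℕ) < i then place X x * d x else 0) + f =
      (∑ x : Fin n, if x ∈ X ∧ (x : ℕ) < i then place X x * d' x else 0) + f' →
      f = f' ∧ ∀ x ∈ X, (x : ℕ) < i → d x = d' x) := by
    intro i
    induction i with
    | zero => intro _; simp [rankIn_zero, hf, hf']
    | succ i ih =>
      intro hi
      obtain ⟨h1, h2, h3⟩ := ih (by omega)
      have e1 := hsum d ⟨i, hi⟩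
      have e2 := hsum d' ⟨i, hi⟩
      have e3 := rankIn_succ X ⟨i, hi⟩
      simp only at e1 e2 e3
      rw [e1, e2, e3]
      by_cases hx : (⟨i, hi⟩ : Fin n) ∈ X
      · simp only [hx, if_true]
        have hp : place X ⟨i, hi⟩ = 4 * 9 ^ rankIn X i := rfl
        rw [hp]
        have hdx := hd ⟨i, hi⟩
        have hdx' := hd' ⟨i, hi⟩
        generalize hQ : 4 * 9 ^ rankIn X i = Q at *
        have hQ' : 4 * 9 ^ (rankIn X i + 1) = Q * 9 := by rw [← hQ]; ring
        rw [hQ']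
        refine ⟨by nlinarith, by nlinarith, fun h => ?_⟩
        have hdd : d ⟨i, hi⟩ = d' ⟨i, hi⟩ := by
          rcases lt_trichotomy (d ⟨i, hi⟩) (d' ⟨i, hi⟩) with hlt | heq | hlt
          · have := Nat.mul_le_mul_left Q (Nat.succ_le_of_lt hlt)
            rw [Nat.mul_succ] at this; omega
          · exact heq
          · have := Nat.mul_le_mul_left Q (Nat.succ_le_of_lt hlt)
            rw [Nat.mul_succ] at this; omega
        have := h3 (by rw [hdd] at h; omega)
        refine ⟨this.1, fun x hx hxi => ?_⟩
        rcases Nat.lt_succ_iff_lt_or_eq.1 hxi with hlt | heq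
        · exact this.2 x hx hlt
        · have : x = ⟨i, hi⟩ := Fin.ext heq
          rw [this, hdd]
      · simp only [hx, if_false, add_zero]
        refine ⟨h1, h2, fun h => ⟨(h3 h).1, fun x hxX hxi => ?_⟩⟩
        rcases Nat.lt_succ_iff_lt_or_eq.1 hxi with hlt | heq
        · exact (h3 h).2 x hxX hlt
        · have : x = ⟨i, hi⟩ := Fin.ext heq
          exact absurd (this ▸ hxX) hx
  exact fun i hi => ⟨(main i hi).1, (main i hi).2.2⟩

theorem blockFlag_le (G : SimpleGraph (Fin n)) (X : Finset (Fin n)) (r : Fin n) (σ : Fin n → ℕ)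
    (q : ℕ) : blockFlag G X r σ q ≤ 1 := by
  unfold blockFlag; split <;> omega

theorem key_lt (G : SimpleGraph (Fin n)) (X : Finset (Fin n)) (r : Fin n) (σ : Fin n → ℕ) :
    key G X (place X) r σ < 4 * 9 ^ X.card := by
  have h1 := blockFlag_le G X r σ 1
  have h2 := blockFlag_le G X r σ 2
  have := (sum_place_aux X (digit G σ) (digit G σ)
    (blockFlag G X r σ 1 + 2 * blockFlag G X r σ 2)
    (blockFlag G X r σ 1 + 2 * blockFlag G X r σ 2) (digit_lt G σ) (digit_lt G σ) (by omega)
    (by omega) n le_rfl).1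
  simpa [rankIn_self, key] using this

/-- The number itself serves only as an array index; arguments about keys use this decoding. -/
theorem key_eq_iff {G : SimpleGraph (Fin n)} {X : Finset (Fin n)} {r : Fin n} {σ τ : Fin n → ℕ} :
    key G X (place X) r σ = key G X (place X) r τ ↔
      (∀ x ∈ X, digit G σ x = digit G τ x) ∧ blockFlag G X r σ 1 = blockFlag G X r τ 1 ∧
        blockFlag G X r σ 2 = blockFlag G X r τ 2 := by
  constructor
  · intro h
    have h1 := blockFlag_le G X r σ 1
    have h2 := blockFlag_le G X r σ 2
    have h3 := blockFlag_le G X r τ 1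
    have h4 := blockFlag_le G X r τ 2
    have := (sum_place_aux X (digit G σ) (digit G τ)
      (blockFlag G X r σ 1 + 2 * blockFlag G X r σ 2)
      (blockFlag G X r τ 1 + 2 * blockFlag G X r τ 2) (digit_lt G σ) (digit_lt G τ) (by omega)
      (by omega) n le_rfl).2 (by simpa [key] using h)
    exact ⟨fun x hx => this.2 x hx x.2, by omega, by omega⟩
  · rintro ⟨h1, h2, h3⟩
    unfold key
    rw [h2, h3]
    congr 1
    refine Finset.sum_congr rfl fun x _ => ?_
    split_ifs with hx
    · rw [h1 x hx]
    · rfl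

end Colouring

/-! ### Expressions that compute degrees, blocks and keys -/

namespace RAM

open scoped Classical

namespace Expr

/-- Negation of a truth value. -/
def not (e : Expr) : Expr := .eq e (.lit 0)

/-- Disjunction of truth values. -/
def or (e f : Expr) : Expr := .lt (.lit 0) (.add e f)

/-- The entry of the adjacency matrix in row `e` and column `f`. -/
def adj (e f : Expr) : Expr := .get 0 (.add (.mul e (.var 0)) f)

/-- The code of a pair of numbers. -/
def pair (e f : Expr) : Expr :=
  .add (.mul (.lt e f) (.add (.mul f f) e)) (.mul (.not (.lt e f)) (.add (.add (.mul e e) e) f))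

theorem eval_pair (e f : Expr) (s : State) :
    (pair e f).eval s = Nat.pair (e.eval s) (f.eval s) := by
  simp only [pair, not, eval, Nat.pair]
  by_cases h : e.eval s < f.eval s <;> simp [h]

/-- The number of neighbours of `e` with colour `q`; the colouring is in array `9`. -/
def colourDegree (q : ℕ) (e : Expr) : Expr :=
  .sum 8 (.var 0) (.mul (adj e (.var 8)) (.eq (.get 9 (.var 8)) (.lit q)))

/-- The number of values below register `0` of register `11` for which `f` has the value `1`. -/
def weight (f : Expr) : Expr := .sum 11 (.var 0) (.eq f (.lit 1))

/-- Whether `e` is in the block of the vertex in register `2`. -/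
def inBlock (e : Expr) : Expr :=
  .mul (.mul (.not (.get 3 e)) (.not (.get 3 (.var 2))))
    (.mul (.or (.eq (.var 2) e) (adj (.var 2) e))
      (.not (.sum 10 (.var 2) (.mul (.not (.get 3 (.var 10))) (adj (.var 10) (.var 2))))))

/-- The minimum of `e` and `2`. -/
def cap (e : Expr) : Expr := .add (.lt (.lit 0) e) (.lt (.lit 1) e)

/-- The digit of the vertex `e`. -/
def digit (e : Expr) : Expr :=
  .add (.mul (.eq (.get 9 e) (.lit 1)) (.add (.lit 1) (.mul (.lit 3) (.cap (.colourDegree 2 e)))))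
    (.mul (.eq (.get 9 e) (.lit 2)) (.add (.lit 2) (.mul (.lit 3) (.cap (.colourDegree 1 e)))))

/-- Whether colour `q` occurs in the block of the vertex in register `2`. -/
def blockFlag (q : ℕ) : Expr :=
  .lt (.lit 0) (.sum 9 (.var 0) (.mul (.inBlock (.var 9)) (.eq (.get 9 (.var 9)) (.lit q))))

/-- The key of the colouring in array `9`. -/
def key : Expr :=
  .add (.sum 9 (.var 0) (.mul (.get 3 (.var 9)) (.mul (.get 4 (.var 9)) (.digit (.var 9)))))
    (.add (.blockFlag 1) (.mul (.lit 2) (.blockFlag 2)))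

end Expr

variable {n : ℕ}

/-- The first `n` cells of array `a`. -/
def State.col (s : State) (a : ℕ) : Fin n → ℕ := fun v => s.arr a v

/-- Row `c` of the table in array `a`. -/
def State.row (s : State) (a c : ℕ) : Fin n → ℕ := fun v => s.arr a (Nat.pair c v)

/-- Register `0` holds `n`, and array `0` holds the adjacency matrix. -/
structure IsInput (G : SimpleGraph (Fin n)) (s : State) : Prop where
  reg_zero : s.reg 0 = n
  adj : ∀ u v : Fin n, s.arr 0 (u * n + v) = if G.Adj u v then 1 else 0

/-- Moreover array `3` holds the indicator vector of `X`. -/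
structure IsMarked (G : SimpleGraph (Fin n)) (X : Finset (Fin n)) (s : State) : Prop
    extends IsInput G s where
  mem : ∀ v : Fin n, s.arr 3 v = if v ∈ X then 1 else 0

/-- Moreover array `4` holds the weights of the digits of keys, and register `1` the number
of keys. -/
structure IsReady (G : SimpleGraph (Fin n)) (X : Finset (Fin n)) (s : State) : Prop
    extends IsMarked G X s where
  place : ∀ v ∈ X, s.arr 4 v = place X v
  reg_one : s.reg 1 = 4 * 9 ^ X.card

variable {G : SimpleGraph (Fin n)} {X : Finset (Fin n)} {s s' : State}

theorem IsInput.congr (h : IsInput G s) (h0 : s'.reg 0 = s.reg 0) (ha : s'.arr 0 = s.arr 0) :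
    IsInput G s' :=
  ⟨h0.trans h.1, by rw [ha]; exact h.2⟩

theorem IsMarked.congr (h : IsMarked G X s) (h0 : s'.reg 0 = s.reg 0) (ha : s'.arr 0 = s.arr 0)
    (h3 : s'.arr 3 = s.arr 3) : IsMarked G X s' :=
  ⟨h.1.congr h0 ha, by rw [h3]; exact h.2⟩

theorem IsReady.congr (h : IsReady G X s) (h0 : s'.reg 0 = s.reg 0) (h1 : s'.reg 1 = s.reg 1)
    (ha : s'.arr 0 = s.arr 0) (h3 : s'.arr 3 = s.arr 3) (h4 : s'.arr 4 = s.arr 4) :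
    IsReady G X s' :=
  ⟨h.1.congr h0 ha h3, by rw [h4]; exact h.2, h1.trans h.3⟩

namespace Expr

theorem eval_adj (h : IsInput G s) {e f : Expr} {u v : Fin n} (he : e.eval s = u)
    (hf : f.eval s = v) : (adj e f).eval s = if G.Adj u v then 1 else 0 := by
  simp only [adj, eval, he, hf, h.reg_zero, h.adj]

/-- The condition on `e` says that the summation register 8 does not affect it. Nested sums use
different registers (8 for degrees, 9 for keys and flags, 10 for the block test, 11 for weights), so
none overwrites another. -/
theorem eval_colourDegree (h : IsInput G s) {e : Expr} {v : Fin n}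
    (he : ∀ i, e.eval (s.setReg 8 i) = v) (q : ℕ) :
    (colourDegree q e).eval s = _root_.colourDegree G (s.col 9) q v := by
  have hs : ∀ i, IsInput G (s.setReg 8 i) := fun i => h.congr (by simp) rfl
  simp only [colourDegree, eval, h.reg_zero, Finset.sum_range, _root_.colourDegree,
    Finset.card_filter]
  refine Finset.sum_congr rfl fun w _ => ?_
  rw [eval_adj (hs w) (he w) (v := w) (by simp [eval])]
  simp only [State.setReg_arr, State.setReg_reg, if_true, State.col]
  by_cases h1 : G.Adj v w <;> by_cases h2 : s.arr 9 w = q <;> simp [h1, h2]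

theorem eval_weight {f : Expr} (hn : s.reg 0 = n) {σ : Fin n → ℕ}
    (hf : ∀ i : Fin n, f.eval (s.setReg 11 i) = σ i) : (weight f).eval s = _root_.weight σ := by
  simp only [weight, eval, hn, Finset.sum_range, _root_.weight, Finset.card_filter, hf]

theorem eval_inBlock (h : IsMarked G X s) {r v : Fin n} (hr : s.reg 2 = r) {e : Expr}
    (he : e.eval s = v) : (inBlock e).eval s = if InBlock G X r v then 1 else 0 := by
  have hs : ∀ i, IsInput G (s.setReg 10 i) := fun i => h.1.congr (by simp) rfl
  -- The sum counts the earlier neighbours of `r` outside `X`; it vanishes exactly when `r` is the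
  -- first vertex of its clique.
  have hsum : (Expr.sum 10 (.var 2) (.mul (.not (.get 3 (.var 10)))
      (adj (.var 10) (.var 2)))).eval s = 0 ↔ ∀ u < r, u ∉ X → ¬ G.Adj u r := by
    simp only [eval, hr, Finset.sum_eq_zero_iff, Finset.mem_range]
    constructor
    · intro H u hu huX huG
      have := H u hu
      rw [eval_adj (hs u) (u := u) (v := r) (by simp [eval]) (by simp [eval, hr])] at this
      simp [not, eval, h.mem, huX, huG] at this
    · intro H i hi
      have hi' : i < n := hi.trans r.2
      have := H ⟨i, hi'⟩ hi
      rw [eval_adj (hs i) (u := ⟨i, hi'⟩) (v := r) (by simp [eval]) (by simp [eval, hr])]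
      have hm := h.mem ⟨i, hi'⟩
      simp only at hm
      by_cases hX : (⟨i, hi'⟩ : Fin n) ∈ X
      · simp [not, eval, hm, hX]
      · simp [this hX]
  have hadj := eval_adj h.1 (e := .var 2) (f := e) (u := r) (v := v) hr he
  have h1 := h.mem v
  have h2 := h.mem r
  have hdef : (inBlock e).eval s = ((if s.arr 3 (e.eval s) = 0 then 1 else 0) *
      (if s.arr 3 (s.reg 2) = 0 then 1 else 0)) *
      ((if 0 < (if s.reg 2 = e.eval s then 1 else 0) + (adj (.var 2) e).eval s then 1 else 0) *
      (if (Expr.sum 10 (.var 2) (.mul (.not (.get 3 (.var 10)))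
        (adj (.var 10) (.var 2)))).eval s = 0 then 1 else 0)) := rfl
  simp only [hdef, hsum, hadj, he, hr, h1, h2, ← Fin.ext_iff, InBlock]
  by_cases a1 : v ∈ X
  · simp [a1]
  by_cases a2 : r ∈ X
  · simp [a2]
  by_cases a3 : r = v <;> by_cases a4 : G.Adj r v <;>
    by_cases a5 : ∀ u < r, u ∉ X → ¬ G.Adj u r <;> simp [a1, a2, a3, a4, a5]

theorem eval_cap (e : Expr) : (cap e).eval s = min (e.eval s) 2 := by
  simp only [cap, eval]
  rcases e.eval s with _ | _ | x <;> simp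

theorem eval_digit (h : IsInput G s) {e : Expr} {v : Fin n} (hev : e.eval s = v)
    (he : ∀ i, e.eval (s.setReg 8 i) = v) :
    (digit e).eval s = _root_.digit G (s.col 9) v := by
  simp only [digit, eval, eval_cap, eval_colourDegree h he, _root_.digit, hev, State.col]
  by_cases h1 : s.arr 9 v = 1 <;> by_cases h2 : s.arr 9 v = 2 <;> simp [h1, h2]

theorem eval_blockFlag (h : IsMarked G X s) {r : Fin n} (hr : s.reg 2 = r) (q : ℕ) :
    (blockFlag q).eval s = _root_.blockFlag G X r (s.col 9) q := by
  have hs : ∀ i, IsMarked G X (s.setReg 9 i) := fun i => h.congr (by simp) rfl rfl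
  have hsum : ((Expr.sum 9 (.var 0) (.mul (.inBlock (.var 9))
      (.eq (.get 9 (.var 9)) (.lit q)))).eval s) =
      ∑ v : Fin n, if InBlock G X r v ∧ s.col 9 v = q then 1 else 0 := by
    simp only [eval, h.reg_zero, Finset.sum_range]
    refine Finset.sum_congr rfl fun v _ => ?_
    rw [eval_inBlock (hs v) (r := r) (v := v) (by simp [hr]) (by simp [eval])]
    simp only [State.setReg_arr, State.setReg_reg, if_true, State.col]
    by_cases h1 : InBlock G X r v <;> by_cases h2 : s.arr 9 v = q <;> simp [h1, h2]
  have hdef : (blockFlag q).eval s = if 0 < ((Expr.sum 9 (.var 0) (.mul (.inBlock (.var 9))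
      (.eq (.get 9 (.var 9)) (.lit q)))).eval s) then 1 else 0 := rfl
  rw [hdef, hsum, _root_.blockFlag]
  congr 1
  rw [← Finset.card_filter, Finset.card_pos, Finset.filter_nonempty_iff]
  simp

theorem eval_key (h : IsReady G X s) {r : Fin n} (hr : s.reg 2 = r) :
    key.eval s = _root_.key G X (_root_.place X) r (s.col 9) := by
  have hs : ∀ i, IsReady G X (s.setReg 9 i) := fun i => h.congr (by simp) (by simp) rfl rfl rfl
  have h1 : (blockFlag 1).eval s = _ := eval_blockFlag h.1 hr 1
  have h2 : (blockFlag 2).eval s = _ := eval_blockFlag h.1 hr 2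
  simp only [key, eval, h1, h2, h.reg_zero, Finset.sum_range, _root_.key]
  congr 1
  refine Finset.sum_congr rfl fun v _ => ?_
  have hd : (digit (.var 9)).eval (s.setReg 9 v) = _ :=
    eval_digit (hs v).1.1 (v := v) (by simp [eval]) (by simp [eval])
  rw [hd]
  simp only [State.setReg_arr, State.setReg_reg, if_true, h.mem]
  split_ifs with hX
  · rw [h.place v hX, one_mul]; rfl
  · simp

end Expr

end RAM

/-! ### The table of colourings -/

namespace RAM

open scoped Classical

variable {n : ℕ} {G : SimpleGraph (Fin n)} {X : Finset (Fin n)} {s s' : State}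

namespace Stmt

/-- The loop changes only array `a` and register `x`, so `H` is required in all states that differ
from `s` only there. Injectivity of `h` keeps later writes from destroying earlier ones. -/
theorem eval_fill {x a N : ℕ} {b e f : Expr} {s : State} (hN : b.eval s = N) (h g : ℕ → ℕ)
    (hinj : Function.Injective h)
    (H : ∀ t : State, (∀ b ≠ a, t.arr b = s.arr b) → (∀ y ≠ x, t.reg y = s.reg y) →
      e.eval t = h (t.reg x) ∧ f.eval t = g (t.reg x)) :
    (∀ i < N, ((for_ x b (store a e f)).eval s).arr a (h i) = g i) ∧
      ∀ j, (∀ i < N, j ≠ h i) → ((for_ x b (store a e f)).eval s).arr a j = s.arr a j := by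
  have key := for_induct (x := x) (e := b) (p := store a e f) (s := s)
    (fun k t => ((∀ b ≠ a, t.arr b = s.arr b) ∧ ∀ y ≠ x, t.reg y = s.reg y) ∧
      (∀ i < k, t.arr a (h i) = g i) ∧ ∀ j, (∀ i < k, j ≠ h i) → t.arr a j = s.arr a j)
    ⟨⟨fun _ _ => rfl, fun _ _ => rfl⟩, fun i hi => absurd hi (Nat.not_lt_zero i), fun _ _ => rfl⟩
    (by
      rintro i - t ⟨⟨h1, h2⟩, h3, h4⟩
      have hr : ∀ y ≠ x, (t.setReg x i).reg y = s.reg y := fun y hy => by simp [hy, h2 y hy]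
      obtain ⟨he, hf⟩ := H (t.setReg x i) h1 hr
      have hx : (t.setReg x i).reg x = i := by simp
      rw [hx] at he hf
      simp only [eval, he, hf, State.setArr_arr, if_true, State.setReg_arr]
      refine ⟨⟨fun c hc => by simp [hc, h1 c hc], hr⟩, fun j hj => ?_, fun j hj => ?_⟩
      · rw [Function.update_apply]
        split_ifs with hji
        · rw [hinj hji]
        · exact h3 j (by
            rcases Nat.lt_succ_iff_lt_or_eq.1 hj with hlt | heq
            · exact hlt
            · exact absurd (congrArg h heq) hji)
      · rw [Function.update_of_ne (hj i (Nat.lt_succ_self i))]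
        exact h4 j fun k hk => hj k (hk.trans (Nat.lt_succ_self i)))
  rw [hN] at key
  exact key.2

/-- Copy row `c` of the table to array `9`, where register `5` holds `c`. -/
def loadRow : Stmt := for_ 6 (.var 0) (store 9 (.var 6) (.get 6 (.pair (.var 5) (.var 6))))

theorem col_loadRow (hn : s.reg 0 = n) :
    ((loadRow.eval s).col 9 : Fin n → ℕ) = s.row 6 (s.reg 5) := by
  have := (eval_fill (x := 6) (a := 9) (b := .var 0) (e := .var 6)
    (f := .get 6 (.pair (.var 5) (.var 6))) (s := s) (N := n) hn id
    (fun i => s.arr 6 (Nat.pair (s.reg 5) i)) Function.injective_id (by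
      intro t h1 h2
      refine ⟨rfl, ?_⟩
      simp only [Expr.eval, Expr.eval_pair, h1 6 (by decide), h2 5 (by decide)])).1
  funext v
  exact this v v.2

/-- Copy array `9` to the row of the new table whose number is its key. -/
def saveRow : Stmt := for_ 6 (.var 0) (store 8 (.pair .key (.var 6)) (.get 9 (.var 6)))

/-- The key is evaluated anew for every cell, but it reads neither array 8 nor register 6, so all
writes go to the same row. -/
theorem row_saveRow (h : IsReady G X s) {r : Fin n} (hr : s.reg 2 = r) (c : ℕ) :
    ((saveRow.eval s).row 8 c : Fin n → ℕ) =
      if c = key G X (place X) r (s.col 9) then s.col 9 else s.row 8 c := by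
  set κ := key G X (place X) r (s.col 9) with hκ
  have := eval_fill (x := 6) (a := 8) (b := .var 0) (e := .pair .key (.var 6))
    (f := .get 9 (.var 6)) (s := s) (N := n) h.reg_zero (Nat.pair κ) (s.arr 9)
    (fun i j hij => (Nat.pair_eq_pair.1 hij).2) (by
      intro t h1 h2
      have ht : IsReady G X t := h.congr (h2 0 (by decide)) (h2 1 (by decide)) (h1 0 (by decide))
        (h1 3 (by decide)) (h1 4 (by decide))
      have hk := Expr.eval_key ht (r := r) ((h2 2 (by decide)).trans hr)
      have hc : (t.col 9 : Fin n → ℕ) = s.col 9 :=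
        funext fun v => congrFun (h1 9 (by decide)) v
      rw [hc] at hk
      refine ⟨?_, ?_⟩
      · simp only [Expr.eval_pair, hk, Expr.eval, hκ]
      · simp only [Expr.eval, h1 9 (by decide)])
  funext v
  split_ifs with hc
  · subst hc; exact this.1 v v.2
  · exact this.2 _ fun i _ hi => hc (Nat.pair_eq_pair.1 hi).1

/-- Enter the colouring in array `9` into the new table, unless there is a colouring with the same
key and at least the same weight. -/
def enter : Stmt :=
  cond (.or (.not (.get 7 .key)) (.lt (.weight (.get 8 (.pair .key (.var 11))))
    (.weight (.get 9 (.var 11))))) (seq saveRow (store 7 .key (.lit 1))) skip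

/-- All entries of the new table satisfy `Φ` and are stored under their keys. -/
def NewTable (G : SimpleGraph (Fin n)) (X : Finset (Fin n)) (r : Fin n) (Φ : (Fin n → ℕ) → Prop)
    (s : State) : Prop :=
  ∀ c, 0 < s.arr 7 c → Φ (s.row 8 c) ∧ key G X (place X) r (s.row 8 c) = c

/-- The new table has an entry with the same key and at least the same weight as `σ`. -/
def Dominated (G : SimpleGraph (Fin n)) (X : Finset (Fin n)) (r : Fin n) (s : State)
    (σ : Fin n → ℕ) : Prop :=
  0 < s.arr 7 (key G X (place X) r σ) ∧ weight σ ≤ weight (n := n) (s.row 8 (key G X (place X) r σ))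

/-- A row is overwritten only when it is empty or by a heavier colouring with the same key, so
domination is never lost; a rejected colouring is already dominated. -/
theorem enter_spec (h : IsReady G X s) {r : Fin n} (hr : s.reg 2 = r) {Φ : (Fin n → ℕ) → Prop}
    (hΦ : Φ (s.col 9)) (hs : NewTable G X r Φ s) :
    NewTable G X r Φ (enter.eval s) ∧ Dominated G X r (enter.eval s) (s.col 9) ∧
      ∀ σ, Dominated G X r s σ → Dominated G X r (enter.eval s) σ := by
  set κ := key G X (place X) r (s.col 9) with hκ
  have hk := Expr.eval_key h hr
  have hk' : ∀ i, Expr.key.eval (s.setReg 11 i) = κ := fun i =>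
    Expr.eval_key (h.congr (s' := s.setReg 11 i) (by simp) (by simp) rfl rfl rfl) (by simpa using hr)
  have hw1 : (Expr.weight (.get 8 (.pair .key (.var 11)))).eval s = weight (n := n) (s.row 8 κ) :=
    Expr.eval_weight h.reg_zero fun i => by
      simp only [Expr.eval, Expr.eval_pair, hk', State.setReg_arr, State.setReg_reg, if_true]
      rfl
  have hw2 : (Expr.weight (.get 9 (.var 11))).eval s = weight (n := n) (s.col 9) :=
    Expr.eval_weight h.reg_zero fun i => by
      simp only [Expr.eval, State.setReg_arr, State.setReg_reg, if_true]
      rfl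
  have hcond : 0 < (Expr.or (.not (.get 7 .key)) (.lt (.weight (.get 8 (.pair .key (.var 11))))
      (.weight (.get 9 (.var 11))))).eval s ↔
      s.arr 7 κ = 0 ∨ weight (n := n) (s.row 8 κ) < weight (n := n) (s.col 9) := by
    simp only [Expr.or, Expr.not, Expr.eval, hk, hw1, hw2, ← hκ]
    by_cases h1 : s.arr 7 κ = 0 <;>
      by_cases h2 : weight (n := n) (s.row 8 κ) < weight (n := n) (s.col 9) <;> simp [h1, h2]
  have hdef : enter.eval s = if 0 < (Expr.or (.not (.get 7 .key))
      (.lt (.weight (.get 8 (.pair .key (.var 11)))) (.weight (.get 9 (.var 11))))).eval s then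
      (seq saveRow (store 7 .key (.lit 1))).eval s else s := rfl
  rw [hdef]
  simp only [hcond]
  split_ifs with hc
  · set t := (seq saveRow (store 7 .key (.lit 1))).eval s with ht
    have h7 : ∀ c, t.arr 7 c = if c = κ then 1 else s.arr 7 c := by
      intro c
      have hk2 : Expr.key.eval (saveRow.eval s) = κ := by
        rw [hκ]
        have : (State.col (saveRow.eval s) 9 : Fin n → ℕ) = s.col 9 :=
          funext fun v => congrFun (eval_arr (p := saveRow) (a := 9) (by decide)) v
        rw [← this]
        exact Expr.eval_key (h.congr (eval_reg (by decide)) (eval_reg (by decide))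
          (eval_arr (by decide)) (eval_arr (by decide)) (eval_arr (by decide)))
          ((eval_reg (by decide)).trans hr)
      simp only [ht, eval, State.setArr_arr, if_true, hk2, Function.update_apply, Expr.eval,
        eval_arr (p := saveRow) (a := 7) (by decide)]
    have h8 : ∀ c, (t.row 8 c : Fin n → ℕ) = if c = κ then s.col 9 else s.row 8 c := by
      intro c
      rw [hκ, ← row_saveRow h hr c]
      funext v
      simp only [ht, State.row, eval, State.setArr_arr]
      rfl
    refine ⟨fun c hc' => ?_, ⟨?_, ?_⟩, fun σ hσ => ⟨?_, ?_⟩⟩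
    · rw [h7] at hc'
      rw [h8]
      split_ifs at hc' ⊢ with hck
      · exact ⟨hΦ, hck.symm⟩
      · exact hs c hc'
    · rw [h7, if_pos hκ.symm]; exact one_pos
    · rw [h8, if_pos hκ.symm]
    · rw [h7]; split_ifs
      · exact one_pos
      · exact hσ.1
    · rw [h8]; split_ifs with hck
      · rcases hc with hc | hc
        · have := hσ.1
          rw [hck] at this; omega
        · have := hσ.2
          rw [hck] at this; omega
      · exact hσ.2
  · rw [not_or, not_lt] at hc
    exact ⟨hs, ⟨by rw [← hκ]; omega, hc.2⟩, fun σ hσ => hσ⟩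

/-- Replace the table by the new table, and make the new table empty. -/
def swap : Stmt :=
  for_ 5 (.var 1) (seq (store 5 (.var 5) (.get 7 (.var 5))) (seq (store 7 (.var 5) (.lit 0))
    (for_ 6 (.var 0) (store 6 (.pair (.var 5) (.var 6)) (.get 8 (.pair (.var 5) (.var 6)))))))

/-- Only flags below `K` are cleared. The third conjunct leaves the others to a separate argument:
no key reaches `K`, so they were never set. -/
theorem swap_spec (hn : s.reg 0 = n) {K : ℕ} (hK : s.reg 1 = K) :
    (∀ c < K, (swap.eval s).arr 5 c = s.arr 7 c) ∧ (∀ c < K, (swap.eval s).arr 7 c = 0) ∧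
      (∀ c, K ≤ c → (swap.eval s).arr 7 c = s.arr 7 c) ∧
      ∀ c < K, ((swap.eval s).row 6 c : Fin n → ℕ) = s.row 8 c := by
  have key := for_induct (x := 5) (e := .var 1) (s := s)
    (p := seq (store 5 (.var 5) (.get 7 (.var 5))) (seq (store 7 (.var 5) (.lit 0))
      (for_ 6 (.var 0) (store 6 (.pair (.var 5) (.var 6)) (.get 8 (.pair (.var 5) (.var 6)))))))
    (fun k t => t.reg 0 = n ∧ t.arr 8 = s.arr 8 ∧ (∀ c < k, t.arr 5 c = s.arr 7 c) ∧
      (∀ c < k, t.arr 7 c = 0) ∧ (∀ c, k ≤ c → t.arr 7 c = s.arr 7 c) ∧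
      ∀ c < k, (t.row 6 c : Fin n → ℕ) = s.row 8 c)
    ⟨hn, rfl, fun i hi => absurd hi (Nat.not_lt_zero i), fun i hi => absurd hi (Nat.not_lt_zero i),
      fun _ _ => rfl, fun i hi => absurd hi (Nat.not_lt_zero i)⟩
    (by
      rintro k - t ⟨h0, h1, h2, h3, h4, h5⟩
      set t₁ := (store 5 (.var 5) (.get 7 (.var 5))).eval (t.setReg 5 k) with ht₁
      set t₂ := (store 7 (.var 5) (.lit 0)).eval t₁ with ht₂
      have r5 : t₂.reg 5 = k := by simp [ht₂, ht₁, eval]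
      have r0 : t₂.reg 0 = n := by simp [ht₂, ht₁, eval, h0]
      have a5 : t₂.arr 5 = Function.update (t.arr 5) k (t.arr 7 k) := by
        simp [ht₂, ht₁, eval, State.setArr_arr, Expr.eval]
      have a7 : t₂.arr 7 = Function.update (t.arr 7) k 0 := by
        simp [ht₂, ht₁, eval, State.setArr_arr, Expr.eval]
      have a6 : t₂.arr 6 = t.arr 6 := by
        simp [ht₂, ht₁, eval, State.setArr_arr]
      have a8 : t₂.arr 8 = t.arr 8 := by
        simp [ht₂, ht₁, eval, State.setArr_arr]
      have hf := eval_fill (x := 6) (a := 6) (b := .var 0) (e := .pair (.var 5) (.var 6))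
        (f := .get 8 (.pair (.var 5) (.var 6))) (s := t₂) (N := n) r0 (Nat.pair k)
        (fun i => s.arr 8 (Nat.pair k i)) (fun i j hij => (Nat.pair_eq_pair.1 hij).2) (by
          intro t' b1 b2
          simp only [Expr.eval, Expr.eval_pair, b1 8 (by decide), b2 5 (by decide), r5, a8, h1,
            and_self])
      set t₃ := (for_ 6 (.var 0) (store 6 (.pair (.var 5) (.var 6))
        (.get 8 (.pair (.var 5) (.var 6))))).eval t₂ with ht₃
      have c5 : t₃.arr 5 = t₂.arr 5 := eval_arr (by decide)
      have c7 : t₃.arr 7 = t₂.arr 7 := eval_arr (by decide)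
      have c8 : t₃.arr 8 = t₂.arr 8 := eval_arr (by decide)
      have c0 : t₃.reg 0 = t₂.reg 0 := eval_reg (by decide)
      change t₃.reg 0 = n ∧ t₃.arr 8 = s.arr 8 ∧ (∀ c < k + 1, t₃.arr 5 c = s.arr 7 c) ∧
        (∀ c < k + 1, t₃.arr 7 c = 0) ∧ (∀ c, k + 1 ≤ c → t₃.arr 7 c = s.arr 7 c) ∧
        ∀ c < k + 1, (t₃.row 6 c : Fin n → ℕ) = s.row 8 c
      refine ⟨c0.trans r0, (c8.trans a8).trans h1, fun c hc => ?_, fun c hc => ?_, fun c hc => ?_,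
        fun c hc => ?_⟩
      · rw [c5, a5, Function.update_apply]
        split_ifs with hck
        · rw [hck, h4 k le_rfl]
        · exact h2 c (by omega)
      · rw [c7, a7, Function.update_apply]
        split_ifs with hck
        · rfl
        · exact h3 c (by omega)
      · rw [c7, a7, Function.update_of_ne (by omega)]
        exact h4 c (by omega)
      · funext v
        by_cases hck : c = k
        · subst hck; exact hf.1 v v.2
        · have := hf.2 (Nat.pair c v) fun i _ hi => hck (Nat.pair_eq_pair.1 hi).1
          rw [a6] at this
          exact this.trans (congrFun (h5 c (by omega)) v))
  have hK' : (Expr.var 1).eval s = K := hK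
  rw [hK'] at key
  exact ⟨key.2.2.1, key.2.2.2.1, key.2.2.2.2.1, key.2.2.2.2.2⟩

end Stmt

end RAM

/-! ### One round of the dynamic programme -/

namespace RAM

open scoped Classical

variable {n : ℕ} {G : SimpleGraph (Fin n)} {X : Finset (Fin n)} {s s' : State}

namespace Stmt

/-- Give the vertices in registers `3` and `4` the colours `p` and `q`. -/
def paint (p q : ℕ) : Stmt := seq (store 9 (.var 3) (.lit p)) (store 9 (.var 4) (.lit q))

theorem col_paint {v w : Fin n} (hv : s.reg 3 = v) (hw : s.reg 4 = w) (p q : ℕ) :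
    (((paint p q).eval s).col 9 : Fin n → ℕ) =
      Function.update (Function.update (s.col 9) v p) w q := by
  funext u
  simp only [paint, State.col, eval, State.setArr_arr, if_true, State.setArr_reg, Expr.eval, hv, hw,
    Function.update_apply, Fin.ext_iff]

/-- Enter the colouring in row `c` of the table into the new table, where register `5` holds `c`,
and also the colouring that `paint` makes of it, provided that `e` is positive. -/
def extend (e : Expr) (p q : ℕ) : Stmt :=
  cond (.get 5 (.var 5)) (seq loadRow (seq enter (cond e (seq (paint p q) enter) skip))) skip

/-- Extend all entries of the table. -/
def step (e : Expr) (p q : ℕ) : Stmt := seq (for_ 5 (.var 1) (extend e p q)) swap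

/-- The colouring `σ` is an entry of the table. -/
def IsEntry (X : Finset (Fin n)) (s : State) (σ : Fin n → ℕ) : Prop :=
  ∃ c < 4 * 9 ^ X.card, 0 < s.arr 5 c ∧ (s.row 6 c : Fin n → ℕ) = σ

theorem arr_extend (e : Expr) (p q : ℕ) {a : ℕ} (ha : a ∉ [7, 8, 9]) :
    ((extend e p q).eval s).arr a = s.arr a := by
  refine eval_arr fun h => ha ?_
  simp [extend, loadRow, enter, saveRow, paint, arrs] at h ⊢
  omega

theorem reg_extend (e : Expr) (p q : ℕ) {y : ℕ} (hy : y ≠ 6) :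
    ((extend e p q).eval s).reg y = s.reg y := by
  refine eval_reg fun h => hy ?_
  simpa [extend, loadRow, enter, saveRow, paint, regs] using h

theorem arr_step (e : Expr) (p q : ℕ) {a : ℕ} (ha : a ∉ [5, 6, 7, 8, 9]) :
    ((step e p q).eval s).arr a = s.arr a := by
  refine eval_arr fun h => ha ?_
  simp [step, extend, loadRow, enter, saveRow, paint, swap, arrs] at h ⊢
  omega

theorem reg_step (e : Expr) (p q : ℕ) {y : ℕ} (hy : y ∉ [5, 6]) :
    ((step e p q).eval s).reg y = s.reg y := by
  refine eval_reg fun h => hy ?_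
  simp [step, extend, loadRow, enter, saveRow, paint, swap, regs] at h ⊢
  omega

theorem _root_.RAM.IsReady.congr' (h : IsReady G X s) (hr : ∀ y < 2, s'.reg y = s.reg y)
    (ha : ∀ a < 5, s'.arr a = s.arr a) : IsReady G X s' :=
  h.congr (hr 0 (by omega)) (hr 1 (by omega)) (ha 0 (by omega)) (ha 3 (by omega)) (ha 4 (by omega))

/-- The predicate `C` is the meaning of the test `e` for the colouring in array 9. It is kept
abstract so that the same code serves for colouring `X` and for adding matching edges. -/
theorem extend_spec (h : IsReady G X s) {r v w : Fin n} (hr : s.reg 2 = r) (hv : s.reg 3 = v)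
    (hw : s.reg 4 = w) {e : Expr} {p q : ℕ} {C : (Fin n → ℕ) → Prop}
    (hC : ∀ t, IsReady G X t → t.reg 2 = r → t.reg 3 = v → t.reg 4 = w →
      (0 < e.eval t ↔ C (t.col 9)))
    {Φ : (Fin n → ℕ) → Prop} (hs : NewTable G X r Φ s)
    (hΦ : 0 < s.arr 5 (s.reg 5) → Φ (s.row 6 (s.reg 5)))
    (hΦ' : 0 < s.arr 5 (s.reg 5) → C (s.row 6 (s.reg 5)) →
      Φ (Function.update (Function.update (s.row 6 (s.reg 5)) v p) w q)) :
    NewTable G X r Φ ((extend e p q).eval s) ∧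
      (∀ σ, Dominated G X r s σ → Dominated G X r ((extend e p q).eval s) σ) ∧
      (0 < s.arr 5 (s.reg 5) → Dominated G X r ((extend e p q).eval s) (s.row 6 (s.reg 5)) ∧
        (C (s.row 6 (s.reg 5)) → Dominated G X r ((extend e p q).eval s)
          (Function.update (Function.update (s.row 6 (s.reg 5)) v p) w q))) := by
  have hdef : (extend e p q).eval s = if 0 < s.arr 5 (s.reg 5) then
      (cond e (seq (paint p q) enter) skip).eval (enter.eval (loadRow.eval s)) else s := rfl
  rw [hdef]
  by_cases h5 : 0 < s.arr 5 (s.reg 5)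
  swap
  · rw [if_neg h5]
    exact ⟨hs, fun σ hσ => hσ, fun h => absurd h h5⟩
  rw [if_pos h5]
  set t := loadRow.eval s with ht
  have htr : ∀ y < 5, t.reg y = s.reg y := fun y hy => eval_reg (by
    simp [loadRow, regs]; omega)
  have hta : ∀ a, a ≠ 9 → t.arr a = s.arr a := fun a ha => eval_arr (by
    simp [loadRow, arrs]; omega)
  have hcol : (t.col 9 : Fin n → ℕ) = s.row 6 (s.reg 5) := col_loadRow h.reg_zero
  have htR : IsReady G X t := h.congr' (fun y hy => htr y (by omega)) fun a ha => hta a (by omega)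
  have htN : NewTable G X r Φ t := by
    intro c hc
    rw [hta 7 (by decide)] at hc
    have : (t.row 8 c : Fin n → ℕ) = s.row 8 c := funext fun u => congrFun (hta 8 (by decide)) _
    rw [this]; exact hs c hc
  have htD : ∀ σ, Dominated G X r s σ → Dominated G X r t σ := by
    intro σ hσ
    refine ⟨by rw [hta 7 (by decide)]; exact hσ.1, ?_⟩
    have : ∀ c, (t.row 8 c : Fin n → ℕ) = s.row 8 c :=
      fun c => funext fun u => congrFun (hta 8 (by decide)) _
    rw [this]; exact hσ.2
  obtain ⟨u1, u2, u3⟩ := enter_spec htR ((htr 2 (by omega)).trans hr)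
    (by rw [hcol]; exact hΦ h5) htN
  rw [hcol] at u2
  set u := enter.eval t with hu
  have hur : ∀ y < 5, u.reg y = s.reg y := fun y hy => (eval_reg (by
    simp [enter, saveRow, regs]; omega)).trans (htr y hy)
  have hua : ∀ a, a ≠ 7 → a ≠ 8 → u.arr a = t.arr a := fun a ha hb => eval_arr (by
    simp [enter, saveRow, arrs]; omega)
  have huR : IsReady G X u := h.congr' (fun y hy => hur y (by omega))
    fun a ha => (hua a (by omega) (by omega)).trans (hta a (by omega))
  have hucol : (u.col 9 : Fin n → ℕ) = s.row 6 (s.reg 5) := by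
    rw [← hcol]; exact funext fun u => congrFun (hua 9 (by decide) (by decide)) _
  have huC := hC u huR ((hur 2 (by omega)).trans hr) ((hur 3 (by omega)).trans hv)
    ((hur 4 (by omega)).trans hw)
  rw [hucol] at huC
  have hdef2 : (cond e (seq (paint p q) enter) skip).eval u = if 0 < e.eval u then
    enter.eval ((paint p q).eval u) else u := rfl
  rw [hdef2]
  simp only [huC]
  by_cases hcC : C (s.row 6 (s.reg 5))
  swap
  · rw [if_neg hcC]
    exact ⟨u1, fun σ hσ => u3 σ (htD σ hσ), fun _ => ⟨u2, fun h => absurd h hcC⟩⟩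
  rw [if_pos hcC]
  have hpcol := col_paint ((hur 3 (by omega)).trans hv) ((hur 4 (by omega)).trans hw) p q
  rw [hucol] at hpcol
  set z := (paint p q).eval u with hz
  have hza : ∀ a, a ≠ 9 → z.arr a = u.arr a := fun a ha => eval_arr (by
    simp [paint, arrs]; omega)
  have hzr : ∀ y, z.reg y = u.reg y := fun y => rfl
  have hzR : IsReady G X z := huR.congr' (fun y _ => hzr y) fun a ha => hza a (by omega)
  have hzN : NewTable G X r Φ z := by
    intro c hc
    rw [hza 7 (by decide)] at hc
    have : (z.row 8 c : Fin n → ℕ) = u.row 8 c := funext fun u => congrFun (hza 8 (by decide)) _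
    rw [this]; exact u1 c hc
  have hzD : ∀ σ, Dominated G X r u σ → Dominated G X r z σ := by
    intro σ hσ
    refine ⟨by rw [hza 7 (by decide)]; exact hσ.1, ?_⟩
    have : ∀ c, (z.row 8 c : Fin n → ℕ) = u.row 8 c :=
      fun c => funext fun u => congrFun (hza 8 (by decide)) _
    rw [this]; exact hσ.2
  obtain ⟨z1, z2, z3⟩ := enter_spec hzR ((hzr 2).trans ((hur 2 (by omega)).trans hr))
    (by rw [hpcol]; exact hΦ' h5 hcC) hzN
  rw [hpcol] at z2
  exact ⟨z1, fun σ hσ => z3 σ (hzD σ (u3 σ (htD σ hσ))), fun _ => ⟨z3 _ (hzD _ u2), fun _ => z2⟩⟩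

/-- Soundness is about exact colourings, but completeness holds only up to key and weight, since a
colouring can be displaced by one with the same key and at least its weight. The old table need not
be indexed by keys for the present `r`: all its rows are read and entered afresh. -/
theorem step_spec (h : IsReady G X s) {r v w : Fin n} (hr : s.reg 2 = r) (hv : s.reg 3 = v)
    (hw : s.reg 4 = w) (h7 : ∀ c, s.arr 7 c = 0) {e : Expr} {p q : ℕ} {C : (Fin n → ℕ) → Prop}
    (hC : ∀ t, IsReady G X t → t.reg 2 = r → t.reg 3 = v → t.reg 4 = w →
      (0 < e.eval t ↔ C (t.col 9))) :
    (∀ c, ((step e p q).eval s).arr 7 c = 0) ∧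
      (∀ σ', IsEntry X ((step e p q).eval s) σ' → ∃ σ, IsEntry X s σ ∧
        (σ' = σ ∨ C σ ∧ σ' = Function.update (Function.update σ v p) w q)) ∧
      (∀ σ, IsEntry X s σ → ∃ σ', IsEntry X ((step e p q).eval s) σ' ∧
        key G X (place X) r σ' = key G X (place X) r σ ∧ weight σ ≤ weight σ') ∧
      (∀ σ, IsEntry X s σ → C σ → ∃ σ', IsEntry X ((step e p q).eval s) σ' ∧
        key G X (place X) r σ' =
          key G X (place X) r (Function.update (Function.update σ v p) w q) ∧
        weight (Function.update (Function.update σ v p) w q) ≤ weight σ') := by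
  set Φ : (Fin n → ℕ) → Prop := fun σ' => ∃ σ, IsEntry X s σ ∧
        (σ' = σ ∨ C σ ∧ σ' = Function.update (Function.update σ v p) w q) with hΦ
  have hloop := for_induct (x := 5) (e := .var 1) (p := extend e p q) (s := s)
    (fun k t => (∀ y < 5, t.reg y = s.reg y) ∧ (∀ a < 7, t.arr a = s.arr a) ∧
      NewTable G X r Φ t ∧ ∀ c < k, 0 < s.arr 5 c → Dominated G X r t (s.row 6 c) ∧
        (C (s.row 6 c) → Dominated G X r t
          (Function.update (Function.update (s.row 6 c) v p) w q)))
    ⟨fun _ _ => rfl, fun _ _ => rfl, fun c hc => by rw [h7] at hc; exact absurd hc (by simp),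
      fun c hc => absurd hc (Nat.not_lt_zero c)⟩
    (by
      rintro k hk t ⟨h1, h2, h3, h4⟩
      have hk' : k < 4 * 9 ^ X.card := by
        rw [← h.reg_one]; exact hk
      set u := t.setReg 5 k with hu
      have hur : ∀ y < 5, u.reg y = s.reg y := fun y hy => by
        rw [hu, State.setReg_reg, if_neg (by omega), h1 y hy]
      have hu5 : u.reg 5 = k := by simp [hu]
      have ha5 : u.arr 5 = s.arr 5 := h2 5 (by omega)
      have hrow : (u.row 6 k : Fin n → ℕ) = s.row 6 k :=
        funext fun x => congrFun (h2 6 (by omega)) _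
      have := extend_spec (s := u) (h.congr' (fun y hy => hur y (by omega))
        fun a ha => h2 a (by omega)) ((hur 2 (by omega)).trans hr) ((hur 3 (by omega)).trans hv)
        ((hur 4 (by omega)).trans hw) hC (p := p) (q := q) (Φ := Φ) h3
        (by
          rw [hu5, ha5, hrow]
          exact fun hc => ⟨_, ⟨k, hk', hc, rfl⟩, Or.inl rfl⟩)
        (by
          rw [hu5, ha5, hrow]
          exact fun hc hcC => ⟨_, ⟨k, hk', hc, rfl⟩, Or.inr ⟨hcC, rfl⟩⟩)
      rw [hu5, ha5, hrow] at this
      refine ⟨fun y hy => (reg_extend e p q (by omega)).trans (hur y hy),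
        fun a ha => (arr_extend e p q (by simp; omega)).trans (h2 a ha), this.1, fun c hc h5 => ?_⟩
      rcases Nat.lt_succ_iff_lt_or_eq.1 hc with hlt | heq
      · exact ⟨this.2.1 _ (h4 c hlt h5).1, fun hcC => this.2.1 _ ((h4 c hlt h5).2 hcC)⟩
      · subst heq
        exact this.2.2 h5)
  have hK : (Expr.var 1).eval s = 4 * 9 ^ X.card := h.reg_one
  rw [hK] at hloop
  obtain ⟨h1, h2, h3, h4⟩ := hloop
  set t := (for_ 5 (.var 1) (extend e p q)).eval s with ht
  have hdef : (step e p q).eval s = swap.eval t := rfl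
  rw [hdef]
  obtain ⟨b1, b2, b3, b4⟩ := swap_spec (s := t) (n := n) ((h1 0 (by omega)).trans h.reg_zero)
    ((h1 1 (by omega)).trans h.reg_one)
  have hdom : ∀ σ, Dominated G X r t σ → ∃ σ', IsEntry X (swap.eval t) σ' ∧
      key G X (place X) r σ' = key G X (place X) r σ ∧ weight σ ≤ weight σ' := by
    rintro σ ⟨d1, d2⟩
    have hlt := key_lt G X r σ
    refine ⟨_, ⟨_, hlt, by rw [b1 _ hlt]; exact d1, rfl⟩, ?_, ?_⟩
    · rw [b4 _ hlt]; exact (h3 _ d1).2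
    · rw [b4 _ hlt]; exact d2
  refine ⟨fun c => ?_, ?_, ?_, ?_⟩
  · by_cases hc : c < 4 * 9 ^ X.card
    · exact b2 c hc
    · rw [b3 c (by omega)]
      by_contra hne
      have := (h3 c (by omega)).2
      have := key_lt G X r (t.row 8 c)
      omega
  · rintro σ' ⟨c, hc, hc5, rfl⟩
    rw [b1 c hc] at hc5
    rw [b4 c hc]
    exact (h3 c hc5).1
  · rintro σ ⟨c, hc, hc5, rfl⟩
    exact hdom _ (h4 c hc hc5).1
  · rintro σ ⟨c, hc, hc5, rfl⟩ hcC
    exact hdom _ ((h4 c hc hc5).2 hcC)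

end Stmt

end RAM

/-! ### Greedy packing of induced paths, and the place values of keys -/

namespace RAM

open scoped Classical

variable {n : ℕ} {G : SimpleGraph (Fin n)} {X : Finset (Fin n)} {s s' : State}

namespace Stmt

/-- Unlike `for_induct`, this speaks of all intermediate states, as needed for `Safe`. -/
theorem iter_induct {x N : ℕ} {f : State → State} {s : State} (I : ℕ → State → Prop)
    (h0 : I 0 s) (hp : ∀ i < N, ∀ t, I i t → I (i + 1) (f (t.setReg x i))) :
    ∀ i ≤ N, I i (iter x f s i) := by
  intro i
  induction i with
  | zero => intro _; exact h0
  | succ i ih => intro hi; exact hp i hi _ (ih (by omega))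

/-- The induction principle for two nested loops over all pairs of vertices. -/
theorem for_for_induct {p : Stmt} (h0 : s.reg 0 = n) (hp0 : 0 ∉ p.regs) (hp2 : 2 ∉ p.regs)
    (hp3 : 3 ∉ p.regs) (I : Set (Fin n × Fin n) → State → Prop)
    (hI : ∀ E t i, I E t → I E (t.setReg 3 i) ∧ I E (t.setReg 4 i))
    (hp : ∀ E (v w : Fin n) (t : State), t.reg 0 = n → t.reg 2 = s.reg 2 → t.reg 3 = v → t.reg 4 = w → (v, w) ∉ E →
      I E t → I (insert (v, w) E) (p.eval t))
    (hs : I ∅ s) : I Set.univ ((for_ 3 (.var 0) (for_ 4 (.var 0) p)).eval s) := by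
  have outer := for_induct (x := 3) (e := .var 0) (p := for_ 4 (.var 0) p) (s := s)
    (fun i t => t.reg 0 = n ∧ t.reg 2 = s.reg 2 ∧ I {a | (a.1 : ℕ) < i} t)
    ⟨h0, rfl, by simpa using hs⟩
    (by
      rintro i hi t ⟨t0, t2, tI⟩
      have hi' : i < n := by rwa [← h0]
      -- The treated pairs form an initial segment of the lexicographic order.
      have inner := for_induct (x := 4) (e := .var 0) (p := p) (s := t.setReg 3 i)
        (fun j u => u.reg 0 = n ∧ u.reg 2 = s.reg 2 ∧ u.reg 3 = i ∧
          I {a | (a.1 : ℕ) < i ∨ (a.1 : ℕ) = i ∧ (a.2 : ℕ) < j} u)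
        ⟨by simp [t0], by simp [t2], by simp, by simpa using (hI _ _ i tI).1⟩
        (by
          rintro j hj u ⟨u0, u2, u3, uI⟩
          have hj' : j < n := by
            have : (t.setReg 3 i).reg 0 = n := by simp [t0]
            rwa [← this]
          refine ⟨?_, ?_, ?_, ?_⟩
          · rw [eval_reg hp0]; simp [u0]
          · rw [eval_reg hp2]; simp [u2]
          · rw [eval_reg hp3]; simp [u3]
          · have := hp _ ⟨i, hi'⟩ ⟨j, hj'⟩ (u.setReg 4 j) (by simp [u0]) (by simp [u2])
              (by simp [u3]) (by simp) (by simp) (hI _ _ j uI).2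
            convert this using 1
            ext ⟨a, b⟩
            simp only [Set.mem_ofPred_eq, Set.mem_insert_iff, Prod.mk.injEq, Fin.ext_iff]
            omega)
      have h0' : (Expr.var 0).eval (t.setReg 3 i) = n := by simp [Expr.eval, t0]
      rw [h0'] at inner
      refine ⟨inner.1, inner.2.1, ?_⟩
      have hE : {a : Fin n × Fin n | (a.1 : ℕ) < i + 1} =
          {a | (a.1 : ℕ) < i ∨ (a.1 : ℕ) = i ∧ (a.2 : ℕ) < n} := by
        ext ⟨a, b⟩
        have := b.2
        simp only [Set.mem_ofPred_eq]
        omega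
      rw [hE]
      exact inner.2.2.2)
  have h0' : (Expr.var 0).eval s = n := h0
  rw [h0'] at outer
  have hE : {a : Fin n × Fin n | (a.1 : ℕ) < n} = Set.univ := by
    ext ⟨a, b⟩
    simp
  rw [← hE]
  exact outer.2.2

/-- The condition that the vertices in registers `2`, `3`, `4` are unmarked and induce a path. -/
def pathTest : Expr :=
  .mul (.mul (.mul (.not (.get 3 (.var 2))) (.not (.get 3 (.var 3)))) (.not (.get 3 (.var 4))))
    (.mul (.mul (.adj (.var 2) (.var 3)) (.adj (.var 3) (.var 4)))
      (.mul (.not (.eq (.var 2) (.var 4))) (.not (.adj (.var 2) (.var 4)))))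

/-- Mark the vertices of vertex-disjoint induced paths on three vertices, until there are no more
such paths on unmarked vertices. -/
def mark : Stmt :=
  for_ 2 (.var 0) (for_ 3 (.var 0) (for_ 4 (.var 0) (cond pathTest
    (seq (store 3 (.var 2) (.lit 1)) (seq (store 3 (.var 3) (.lit 1))
      (store 3 (.var 4) (.lit 1)))) skip)))

/-- The vertices `u`, `v`, `w` induce a path in this order. -/
def _root_.IsInducedPath (G : SimpleGraph (Fin n)) (u v w : Fin n) : Prop :=
  G.Adj u v ∧ G.Adj v w ∧ u ≠ w ∧ ¬ G.Adj u w

/-- Being in the same clique is transitive, so an induced path on three vertices cannot avoid `D`.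
-/
theorem _root_.IsClusterDeletionSet.mem_or {D : Finset (Fin n)} (hD : IsClusterDeletionSet G D)
    {u v w : Fin n} (h : IsInducedPath G u v w) : u ∈ D ∨ v ∈ D ∨ w ∈ D := by
  by_contra! hc
  obtain ⟨hu, hv, hw⟩ := hc
  obtain ⟨R, hR⟩ := hD
  obtain ⟨h1, h2, h3, h4⟩ := h
  have e1 := (hR ⟨u, hu⟩ ⟨v, hv⟩).1 h1
  have e2 := (hR ⟨v, hv⟩ ⟨w, hw⟩).1 h2
  exact h4 ((hR ⟨u, hu⟩ ⟨w, hw⟩).2 ⟨fun h => h3 (congrArg Subtype.val h), R.trans e1.2 e2.2⟩)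

/-- At most two thirds of the vertices of `X` are outside of any cluster deletion set. -/
def _root_.IsPacked (G : SimpleGraph (Fin n)) (X : Finset (Fin n)) : Prop :=
  ∀ D, IsClusterDeletionSet G D → X.card ≤ 3 * (X ∩ D).card

/-- `X` gains at most three vertices, and `X ∩ D` gains at least one because `D` meets the path. -/
theorem _root_.IsPacked.insert_path (hX : IsPacked G X) {u v w : Fin n}
    (h : IsInducedPath G u v w) (hu : u ∉ X) (hv : v ∉ X) (hw : w ∉ X) :
    IsPacked G (insert u (insert v (insert w X))) := by
  intro D hD
  have h1 := hX D hD
  have h2 : (insert u (insert v (insert w X))).card ≤ X.card + 3 := by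
    have a1 := Finset.card_insert_le u (insert v (insert w X))
    have a2 := Finset.card_insert_le v (insert w X)
    have a3 := Finset.card_insert_le w X
    omega
  have h3 : (X ∩ D).card + 1 ≤ (insert u (insert v (insert w X)) ∩ D).card := by
    have key : ∀ z, z ∉ X → z ∈ D → z ∈ insert u (insert v (insert w X)) →
        (X ∩ D).card + 1 ≤ (insert u (insert v (insert w X)) ∩ D).card := by
      intro z hzX hzD hz
      rw [← Finset.card_insert_of_notMem (a := z) (s := X ∩ D) (by simp [hzX])]
      refine Finset.card_le_card fun y hy => ?_
      rcases Finset.mem_insert.1 hy with rfl | hy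
      · exact Finset.mem_inter.2 ⟨hz, hzD⟩
      · have := Finset.mem_inter.1 hy
        simp [this.1, this.2]
    rcases hD.mem_or h with hz | hz | hz
    · exact key u hu hz (by simp)
    · exact key v hv hz (by simp)
    · exact key w hw hz (by simp)
  omega

theorem pathTest_pos (h : IsMarked G X s) {u v w : Fin n} (hu : s.reg 2 = u) (hv : s.reg 3 = v)
    (hw : s.reg 4 = w) :
    0 < pathTest.eval s ↔ (u ∉ X ∧ v ∉ X ∧ w ∉ X) ∧ IsInducedPath G u v w := by
  have a1 := Expr.eval_adj h.1 (e := .var 2) (f := .var 3) hu hv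
  have a2 := Expr.eval_adj h.1 (e := .var 3) (f := .var 4) hv hw
  have a3 := Expr.eval_adj h.1 (e := .var 2) (f := .var 4) hu hw
  simp only [pathTest, Expr.not, Expr.eval, a1, a2, a3, hu, hv, hw, h.mem, IsInducedPath,
    ← Fin.ext_iff]
  by_cases b1 : u ∈ X
  · simp [b1]
  by_cases b2 : v ∈ X
  · simp [b2]
  by_cases b3 : w ∈ X
  · simp [b3]
  by_cases b4 : G.Adj u v <;> by_cases b5 : G.Adj v w <;> by_cases b6 : u = w <;>
    by_cases b7 : G.Adj u w <;> simp [b1, b2, b3, b4, b5, b6, b7]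

theorem _root_.RAM.IsMarked.store (h : IsMarked G X s) (v : Fin n) :
    IsMarked G (insert v X) (s.setArr 3 v 1) := by
  refine ⟨h.1.congr rfl (by simp [State.setArr_arr]), fun u => ?_⟩
  simp only [State.setArr_arr, if_true, Function.update_apply, h.mem, Finset.mem_insert,
    ← Fin.ext_iff]
  by_cases h1 : u = v <;> simp [h1]

/-- Marks are never removed, so a triple that has been examined once stays hit. A single pass over
all triples therefore yields a maximal packing. -/
theorem mark_spec (h : IsMarked G ∅ s) : ∃ X, IsMarked G X (mark.eval s) ∧ IsPacked G X ∧
    ∀ u v w, IsInducedPath G u v w → u ∈ X ∨ v ∈ X ∨ w ∈ X := by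
  have outer := for_induct (x := 2) (e := .var 0) (s := s)
    (p := for_ 3 (.var 0) (for_ 4 (.var 0) (cond pathTest
      (seq (store 3 (.var 2) (.lit 1)) (seq (store 3 (.var 3) (.lit 1))
        (store 3 (.var 4) (.lit 1)))) skip)))
    (fun i t => ∃ X, IsMarked G X t ∧ IsPacked G X ∧
      ∀ u v w : Fin n, (u : ℕ) < i → IsInducedPath G u v w → u ∈ X ∨ v ∈ X ∨ w ∈ X)
    ⟨∅, h, fun D _ => by simp, fun _ _ _ hu => absurd hu (Nat.not_lt_zero _)⟩
    (by
      rintro i hi t ⟨X, tM, tP, tX⟩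
      have hi' : i < n := by rw [← h.reg_zero]; exact hi
      have hM : IsMarked G X (t.setReg 2 i) := tM.congr (by simp) rfl rfl
      have := for_for_induct (s := t.setReg 2 i) (n := n) (p := cond pathTest
        (seq (store 3 (.var 2) (.lit 1)) (seq (store 3 (.var 3) (.lit 1))
          (store 3 (.var 4) (.lit 1)))) skip) hM.reg_zero (by decide) (by decide) (by decide)
        (fun E u => ∃ X, IsMarked G X u ∧ IsPacked G X ∧ ∀ a b c : Fin n,
          ((a : ℕ) < i ∨ (a : ℕ) = i ∧ (b, c) ∈ E) → IsInducedPath G a b c →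
            a ∈ X ∨ b ∈ X ∨ c ∈ X)
        (by
          rintro E u j ⟨Y, uM, uP, uY⟩
          exact ⟨⟨Y, uM.congr (by simp) rfl rfl, uP, uY⟩, ⟨Y, uM.congr (by simp) rfl rfl, uP, uY⟩⟩)
        (by
          rintro E v w u u0 u2 u3 u4 - ⟨Y, uM, uP, uY⟩
          have hu2 : u.reg 2 = (⟨i, hi'⟩ : Fin n) := by rw [u2]; simp
          have hpos := pathTest_pos uM hu2 u3 u4
          have hdef : (cond pathTest (seq (store 3 (.var 2) (.lit 1)) (seq (store 3 (.var 3)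
              (.lit 1)) (store 3 (.var 4) (.lit 1)))) skip).eval u = if 0 < pathTest.eval u then
              ((u.setArr 3 (u.reg 2) 1).setArr 3 (u.reg 3) 1).setArr 3 (u.reg 4) 1 else u := rfl
          rw [hdef]
          simp only [hpos]
          split_ifs with hc
          · rw [hu2, u3, u4]
            refine ⟨_, ((uM.store _).store _).store _, ?_, ?_⟩
            · have := uP.insert_path hc.2 hc.1.1 hc.1.2.1 hc.1.2.2
              have e : insert w (insert v (insert (⟨i, hi'⟩ : Fin n) Y)) =
                  insert ⟨i, hi'⟩ (insert v (insert w Y)) := by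
                rw [Finset.insert_comm w, Finset.insert_comm w, Finset.insert_comm v]
              rw [e]; exact this
            · rintro a b c habc hpath
              have hsub : ∀ z ∈ Y, z ∈ insert w (insert v (insert (⟨i, hi'⟩ : Fin n) Y)) :=
                fun z hz => Finset.mem_insert_of_mem (Finset.mem_insert_of_mem
                  (Finset.mem_insert_of_mem hz))
              have hold := fun h : a ∈ Y ∨ b ∈ Y ∨ c ∈ Y =>
                h.imp (hsub a) (Or.imp (hsub b) (hsub c))
              rcases habc with ha | ⟨ha, hbc⟩
              · exact hold (uY a b c (Or.inl ha) hpath)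
              · rcases Set.mem_insert_iff.1 hbc with heq | hbc
                · left
                  have : a = ⟨i, hi'⟩ := Fin.ext ha
                  simp [this]
                · exact hold (uY a b c (Or.inr ⟨ha, hbc⟩) hpath)
          · refine ⟨Y, uM, uP, ?_⟩
            rintro a b c (ha | ⟨ha, hbc⟩) hpath
            · exact uY a b c (Or.inl ha) hpath
            · rcases Set.mem_insert_iff.1 hbc with heq | hbc
              · have ha' : a = ⟨i, hi'⟩ := Fin.ext ha
                obtain ⟨rfl, rfl⟩ := Prod.mk.injEq _ _ _ _ ▸ heq
                subst ha'
                by_contra hno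
                exact hc ⟨⟨fun h => hno (Or.inl h), fun h => hno (Or.inr (Or.inl h)),
                  fun h => hno (Or.inr (Or.inr h))⟩, hpath⟩
              · exact uY a b c (Or.inr ⟨ha, hbc⟩) hpath)
        ⟨X, hM, tP, by
          rintro a b c (ha | ⟨-, hbc⟩) hpath
          · exact tX a b c ha hpath
          · exact absurd hbc (Set.notMem_empty _)⟩
      obtain ⟨Y, yM, yP, yY⟩ := this
      refine ⟨Y, yM, yP, fun a b c ha hpath => yY a b c ?_ hpath⟩
      rcases Nat.lt_succ_iff_lt_or_eq.1 ha with hlt | heq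
      · exact Or.inl hlt
      · exact Or.inr ⟨heq, Set.mem_univ _⟩)
  have h0' : (Expr.var 0).eval s = n := h.reg_zero
  rw [h0'] at outer
  obtain ⟨X, h1, h2, h3⟩ := outer
  exact ⟨X, h1, h2, fun u v w => h3 u v w u.2⟩

/-- The body of the loop of `weights`. -/
def weightsBody : Stmt :=
  cond (.get 3 (.var 2)) (seq (store 4 (.var 2) (.var 1)) (assign 1 (.mul (.lit 9) (.var 1)))) skip

/-- Compute the weights of the digits of keys, and the number of keys. -/
def weights : Stmt := seq (assign 1 (.lit 4)) (for_ 2 (.var 0) weightsBody)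

theorem rankIn_le_card (X : Finset (Fin n)) (i : ℕ) : rankIn X i ≤ X.card :=
  Finset.card_le_card (Finset.filter_subset _ _)

/-- This part is not `Small`, because it stores products, so its bound is proved by hand. Register 1
runs through 4 · 9^rank and ends as the number of keys, never exceeding 4 · 9^|X|. -/
theorem weights_spec (h : IsMarked G X s) {M : ℕ} (hM : 4 * 9 ^ X.card ≤ M)
    (hs : Bounded 12 M s) :
    IsReady G X (weights.eval s) ∧ weights.Safe 12 M s ∧ Bounded 12 M (weights.eval s) := by
  have hpow : ∀ i, 4 * 9 ^ rankIn X i ≤ M := fun i =>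
    (Nat.mul_le_mul_left 4 (Nat.pow_le_pow_right (by omega) (rankIn_le_card X i))).trans hM
  set s₁ := s.setReg 1 4 with hs₁
  have hn : n ≤ M := by
    have := hs.1 0 (by omega)
    rwa [h.reg_zero] at this
  have hb₁ : Bounded 12 M s₁ := hs.setReg 1 (by have := hpow 0; simpa [rankIn_zero] using this)
  have hM₁ : IsMarked G X s₁ := h.congr (by simp [hs₁]) rfl rfl
  have hn₁ : (Expr.var 0).eval s₁ = n := hM₁.reg_zero
  have key := iter_induct (x := 2) (N := n) (f := weightsBody.eval) (s := s₁)
    (fun i t => IsMarked G X t ∧ Bounded 12 M t ∧ t.reg 1 = 4 * 9 ^ rankIn X i ∧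
      ∀ v ∈ X, (v : ℕ) < i → t.arr 4 v = place X v)
    ⟨hM₁, hb₁, by simp [hs₁, rankIn_zero], fun v _ hv => absurd hv (Nat.not_lt_zero _)⟩
    (by
      rintro i hi t ⟨t1, t2, t3, t4⟩
      have e3 := rankIn_succ X ⟨i, hi⟩
      simp only at e3
      have hm := t1.mem ⟨i, hi⟩
      simp only at hm
      have hdef : weightsBody.eval (t.setReg 2 i) = if 0 < t.arr 3 i then
          ((t.setReg 2 i).setArr 4 i (t.reg 1)).setReg 1 (9 * t.reg 1) else t.setReg 2 i := by
        simp [weightsBody, eval, Expr.eval]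
      rw [hdef, hm, e3]
      have hX4 : 4 * 9 ^ rankIn X i ≤ M := hpow i
      by_cases hX : (⟨i, hi⟩ : Fin n) ∈ X
      · simp only [hX, if_true, zero_lt_one]
        have h9 : 9 * t.reg 1 = 4 * 9 ^ (rankIn X i + 1) := by rw [t3]; ring
        refine ⟨t1.congr (by simp) (by simp [State.setArr_arr]) (by simp [State.setArr_arr]), ?_,
          by simp [h9], fun v hv hvi => ?_⟩
        · refine Bounded.setReg (Bounded.setArr (t2.setReg 2 (by omega)) _ _ ?_) _ ?_
          · rw [t3]; exact hpow i
          · rw [h9]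
            have := hpow (i + 1)
            rw [e3, if_pos hX] at this
            exact this
        · simp only [State.setReg_arr, State.setArr_arr, if_true, Function.update_apply]
          split_ifs with hvi'
          · rw [t3, place, hvi']
          · exact t4 v hv (by omega)
      · simp only [hX, if_false, lt_self_iff_false, add_zero]
        refine ⟨t1.congr (by simp) rfl rfl, t2.setReg 2 (by omega), by simp [t3],
          fun v hv hvi => t4 v hv ?_⟩
        rcases Nat.lt_succ_iff_lt_or_eq.1 hvi with hlt | heq
        · exact hlt
        · have : v = ⟨i, hi⟩ := Fin.ext heq
          exact absurd (this ▸ hv) hX)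
  have hdef : weights.eval s = iter 2 weightsBody.eval s₁ n := by
    rw [← hn₁]; rfl
  have hfin := key n le_rfl
  rw [rankIn_self] at hfin
  rw [hdef]
  refine ⟨⟨hfin.1, fun v hv => hfin.2.2.2 v hv v.2, hfin.2.2.1⟩, ⟨hs, hb₁, fun i hi => ?_⟩,
    hfin.2.1⟩
  have hi' : i < n := by rw [← hn₁]; exact hi
  have hbi := (key i hi'.le).2.1.setReg 2 (v := i) (by omega)
  refine ⟨hbi, fun _ => ⟨hbi, hbi.setArr _ _ ?_⟩, fun _ => trivial⟩
  exact hbi.1 1 (by omega)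

end Stmt

end RAM

/-! ### The exchange argument -/

section Exchange

open scoped Classical

variable {n : ℕ} {G : SimpleGraph (Fin n)} {X : Finset (Fin n)}

theorem colourDegree_eq_zero {σ : Fin n → ℕ} {q : ℕ} {v : Fin n} :
    colourDegree G σ q v = 0 ↔ ∀ w, G.Adj v w → σ w ≠ q := by
  simp [colourDegree, Finset.filter_eq_empty_iff]

theorem colourDegree_eq_one {σ : Fin n → ℕ} {q : ℕ} {v : Fin n} :
    colourDegree G σ q v = 1 ↔ ∃ w, (G.Adj v w ∧ σ w = q) ∧ ∀ y, G.Adj v y → σ y = q → y = w := by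
  rw [colourDegree, Finset.card_eq_one]
  refine exists_congr fun w => ?_
  rw [Finset.eq_singleton_iff_unique_mem]
  simp

theorem colourDegree_unique {σ : Fin n → ℕ} {q : ℕ} {v w y : Fin n}
    (h : colourDegree G σ q v = 1) (hw : G.Adj v w) (hwq : σ w = q) (hy : G.Adj v y)
    (hyq : σ y = q) : y = w := by
  obtain ⟨z, -, hz⟩ := colourDegree_eq_one.1 h
  rw [hz y hy hyq, hz w hw hwq]

theorem digit_eq {σ τ : Fin n → ℕ} {x : Fin n} (h : digit G σ x = digit G τ x) :
    (σ x = 1 ↔ τ x = 1) ∧ (σ x = 2 ↔ τ x = 2) ∧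
      (σ x = 1 → min (colourDegree G σ 2 x) 2 = min (colourDegree G τ 2 x) 2) ∧
      (σ x = 2 → min (colourDegree G σ 1 x) 2 = min (colourDegree G τ 1 x) 2) := by
  unfold digit at h
  generalize hA : min (colourDegree G σ 2 x) 2 = A at *
  generalize hB : min (colourDegree G σ 1 x) 2 = B at *
  generalize hC : min (colourDegree G τ 2 x) 2 = C at *
  generalize hD : min (colourDegree G τ 1 x) 2 = D at *
  clear hA hB hC hD
  by_cases a : σ x = 1
  · by_cases b : τ x = 1
    · simp [a, b] at h ⊢; exact h
    · by_cases c : τ x = 2 <;> simp [a, b, c] at h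
      omega
  · by_cases b : τ x = 1
    · by_cases c : σ x = 2 <;> simp [a, b, c] at h <;> omega
    · by_cases c : σ x = 2 <;> by_cases d : τ x = 2 <;> simp [a, b, c, d] at h ⊢ <;> omega

/-- The colouring `σ'` arises from `σ` by joining `v` and `w` as partners with colours `p`
and `q`. -/
structure Joins (G : SimpleGraph (Fin n)) (X : Finset (Fin n)) (p q : ℕ) (v w : Fin n)
    (σ σ' : Fin n → ℕ) : Prop where
  adj : G.Adj v w
  left : σ v = if v ∈ X then p else 0
  right : σ w = if w ∈ X then q else 0
  degree_left : colourDegree G σ q v = if w ∈ X then 1 else 0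
  degree_right : colourDegree G σ p w = if v ∈ X then 1 else 0
  new_left : σ' v = p
  new_right : σ' w = q
  other : ∀ u, u ≠ v → u ≠ w → σ' u = σ u

theorem Joins.symm {p q : ℕ} {v w : Fin n} {σ σ' : Fin n → ℕ} (h : Joins G X p q v w σ σ') :
    Joins G X q p w v σ σ' :=
  ⟨h.adj.symm, h.right, h.left, h.degree_right, h.degree_left, h.new_right, h.new_left,
    fun u h1 h2 => h.other u h2 h1⟩

/-- If `w` is in `X`, it already has colour `q` and is the only such neighbour of `v`; otherwise `v`
has none and `w` becomes the first. This is the reason for the form of `degree_left`. -/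
theorem Joins.degree_new {p q : ℕ} {v w : Fin n} {σ σ' : Fin n → ℕ}
    (h : Joins G X p q v w σ σ') : colourDegree G σ' q v = 1 := by
  refine colourDegree_eq_one.2 ⟨w, ⟨h.adj, h.new_right⟩, fun y hy hyq => ?_⟩
  by_contra hne
  rw [h.other y hy.ne.symm hne] at hyq
  have h1 := h.degree_left
  split_ifs at h1 with hw
  · have := h.right
    rw [if_pos hw] at this
    exact hne (colourDegree_unique h1 h.adj this hy hyq)
  · exact colourDegree_eq_zero.1 h1 y hy hyq

/-- The join could matter to `z` only through a newly coloured neighbour `w`. But before the join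
`w` has no neighbour of colour `p` except possibly `v`, so `z` is not adjacent to it. -/
theorem Joins.degree_other {p q : ℕ} {v w : Fin n} {σ σ' : Fin n → ℕ}
    (h : Joins G X p q v w σ σ') (hpq : p ≠ q) (hq : q ≠ 0) {z : Fin n} (hz : z ≠ v)
    (hzp : σ z = p) : colourDegree G σ' q z = colourDegree G σ q z := by
  unfold colourDegree
  congr 1
  ext y
  simp only [Finset.mem_filter, Finset.mem_univ, true_and]
  refine and_congr_right fun hy => ?_
  by_cases hyw : y = w
  · subst hyw
    have h1 := h.right
    split_ifs at h1 with hX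
    · simp [h.new_right, h1]
    · exfalso
      have h2 := h.degree_right
      split_ifs at h2 with hv
      · have h3 := h.left
        rw [if_pos hv] at h3
        exact hz (colourDegree_unique h2 h.adj.symm h3 hy.symm hzp)
      · exact colourDegree_eq_zero.1 h2 z hy.symm hzp
  · by_cases hyv : y = v
    · subst hyv
      have h1 := h.left
      have h2 := h.new_left
      split_ifs at h1 with hX
      · rw [h1, h2]
      · rw [h1, h2]; simp [hpq, hq.symm]
    · rw [h.other y hyv hyw]

/-- The values 4 = 1 + 3 · 1 and 5 = 2 + 3 · 1 encode colours 1 and 2 with exactly one neighbour of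
the other colour. -/
theorem Joins.digit {v w : Fin n} {σ σ' : Fin n → ℕ} (h : Joins G X 1 2 v w σ σ') (x : Fin n) :
    digit G σ' x = if x = v then 4 else if x = w then 5 else digit G σ x := by
  split_ifs with h1 h2
  · subst h1
    simp [_root_.digit, h.new_left, h.degree_new]
  · subst h2
    simp [_root_.digit, h.new_right, h.symm.degree_new]
  · have h3 := h.other x h1 h2
    unfold _root_.digit
    rw [h3]
    by_cases a : σ x = 1
    · simp [a, h.degree_other (by decide) (by decide) h1 a]
    · by_cases b : σ x = 2
      · simp [b, h.symm.degree_other (by decide) (by decide) h2 b]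
      · simp [a, b]

theorem Joins.blockFlag {p q : ℕ} {v w : Fin n} {σ σ' : Fin n → ℕ} (h : Joins G X p q v w σ σ')
    (hpq : p ≠ q) (hp : p ≠ 0) (r : Fin n) :
    blockFlag G X r σ' p = if InBlock G X r v then 1 else blockFlag G X r σ p := by
  have hw : σ w ≠ p := by
    rw [h.right]; split_ifs
    · exact hpq.symm
    · exact hp.symm
  split_ifs with hv
  · rw [_root_.blockFlag, if_pos ⟨v, hv, h.new_left⟩]
  · unfold _root_.blockFlag
    congr 1
    refine propext (exists_congr fun y => and_congr_right fun hy => ?_)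
    have hyv : y ≠ v := fun e => hv (e ▸ hy)
    by_cases hyw : y = w
    · subst hyw
      simp [h.new_right, hw, hpq.symm]
    · rw [h.other y hyv hyw]

theorem Joins.weight {v w : Fin n} {σ σ' : Fin n → ℕ} (h : Joins G X 1 2 v w σ σ') :
    weight σ' = weight σ + if v ∈ X then 0 else 1 := by
  have hw : σ w ≠ 1 := by
    rw [h.right]; split_ifs <;> decide
  unfold _root_.weight
  split_ifs with hv
  · rw [add_zero]
    congr 1
    ext y
    simp only [Finset.mem_filter, Finset.mem_univ, true_and]
    by_cases hyv : y = v
    · subst hyv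
      simp [h.new_left, h.left, hv]
    · by_cases hyw : y = w
      · subst hyw
        simp [h.new_right, hw]
      · rw [h.other y hyv hyw]
  · have h1 : σ v ≠ 1 := by rw [h.left, if_neg hv]; decide
    rw [← Finset.card_insert_of_notMem (a := v) (by simp [h1])]
    congr 1
    ext y
    simp only [Finset.mem_filter, Finset.mem_univ, true_and, Finset.mem_insert]
    by_cases hyv : y = v
    · subst hyv
      simp [h.new_left]
    · by_cases hyw : y = w
      · subst hyw
        simp [h.new_right, hw, hyv]
      · simp [h.other y hyv hyw, hyv]

/-- Every vertex outside of `X` that has a colour has exactly one neighbour of the other colour. -/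
def IsMatchedOutside (G : SimpleGraph (Fin n)) (X : Finset (Fin n)) (σ : Fin n → ℕ) : Prop :=
  ∀ v ∉ X, (σ v = 1 → colourDegree G σ 2 v = 1) ∧ (σ v = 2 → colourDegree G σ 1 v = 1)

theorem Joins.isMatchedOutside {v w : Fin n} {σ σ' : Fin n → ℕ} (h : Joins G X 1 2 v w σ σ')
    (hσ : IsMatchedOutside G X σ) : IsMatchedOutside G X σ' := by
  intro u hu
  refine ⟨fun h1 => ?_, fun h2 => ?_⟩
  · by_cases huv : u = v
    · subst huv; exact h.degree_new
    · have huw : u ≠ w := by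
        rintro rfl
        rw [h.new_right] at h1; exact absurd h1 (by decide)
      rw [h.other u huv huw] at h1
      rw [h.degree_other (by decide) (by decide) huv h1]
      exact (hσ u hu).1 h1
  · by_cases huw : u = w
    · subst huw; exact h.symm.degree_new
    · have huv : u ≠ v := by
        rintro rfl
        rw [h.new_left] at h2; exact absurd h2 (by decide)
      rw [h.other u huv huw] at h2
      rw [h.symm.degree_other (by decide) (by decide) huw h2]
      exact (hσ u hu).2 h2

/-! ### Blocks: the cliques of G - X -/

/-- Deleting `X` leaves no induced path on three vertices. -/
def Separates (G : SimpleGraph (Fin n)) (X : Finset (Fin n)) : Prop :=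
  ∀ u v w, IsInducedPath G u v w → u ∈ X ∨ v ∈ X ∨ w ∈ X

/-- Adjacency outside of `X` is transitive, so the components there are cliques. -/
theorem Separates.adj (h : Separates G X) {u v w : Fin n} (hu : u ∉ X) (hv : v ∉ X) (hw : w ∉ X)
    (huv : G.Adj u v) (hvw : G.Adj v w) (huw : u ≠ w) : G.Adj u w := by
  by_contra hc
  rcases h u v w ⟨huv, hvw, huw, hc⟩ with h | h | h
  · exact hu h
  · exact hv h
  · exact hw h

theorem Separates.block_adj (h : Separates G X) {r u v : Fin n} (hu : InBlock G X r u)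
    (hv : InBlock G X r v) (huv : u ≠ v) : G.Adj u v := by
  obtain ⟨hu1, hr, hu2, -⟩ := hu
  obtain ⟨hv1, -, hv2, -⟩ := hv
  rcases hu2 with rfl | hu2
  · exact hv2.resolve_left huv
  · rcases hv2 with rfl | hv2
    · exact hu2.symm
    · exact h.adj hu1 hr hv1 hu2.symm hv2 huv

theorem Separates.block_of_adj (h : Separates G X) {r u v : Fin n} (hu : InBlock G X r u)
    (hv : v ∉ X) (huv : G.Adj u v) : InBlock G X r v := by
  obtain ⟨hu1, hr, hu2, hmin⟩ := hu
  refine ⟨hv, hr, ?_, hmin⟩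
  rcases hu2 with rfl | hu2
  · exact Or.inr huv
  · by_cases hrv : r = v
    · exact Or.inl hrv
    · exact Or.inr (h.adj hr hu1 hv hu2 huv hrv)

theorem Separates.exists_block (h : Separates G X) {v : Fin n} (hv : v ∉ X) :
    ∃ r, InBlock G X r v := by
  obtain ⟨r, ⟨hrX, hrv⟩, hmin⟩ := WellFounded.has_min (wellFounded_lt (α := Fin n))
    {u | u ∉ X ∧ (u = v ∨ G.Adj u v)} ⟨v, hv, Or.inl rfl⟩
  refine ⟨r, hv, hrX, hrv, fun u hur huX hadj => hmin u ⟨huX, ?_⟩ hur⟩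
  rcases hrv with rfl | hrv
  · exact Or.inr hadj
  · by_cases huv : u = v
    · exact Or.inl huv
    · exact Or.inr (h.adj huX hrX hv hadj hrv huv)

theorem Separates.block_not_lt (h : Separates G X) {r r' v : Fin n} (hr : InBlock G X r v)
    (hr' : InBlock G X r' v) : ¬ r < r' := by
  intro hlt
  obtain ⟨hv, hrX, hr1, -⟩ := hr
  obtain ⟨-, hrX', hr1', hmin⟩ := hr'
  refine hmin r hlt hrX ?_
  rcases hr1 with rfl | hr1
  · exact (hr1'.resolve_left hlt.ne').symm
  · rcases hr1' with rfl | hr1'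
    · exact hr1
    · exact h.adj hrX hv hrX' hr1 hr1'.symm hlt.ne

theorem Separates.block_unique (h : Separates G X) {r r' v : Fin n} (hr : InBlock G X r v)
    (hr' : InBlock G X r' v) : r = r' :=
  le_antisymm (not_lt.1 (h.block_not_lt hr' hr)) (not_lt.1 (h.block_not_lt hr hr'))

/-! ### Exchanging partial solutions with equal keys -/

/-- The edge `vw` has an end in the block of `r`, and the other end there or in `X`. -/
def IsLink (G : SimpleGraph (Fin n)) (X : Finset (Fin n)) (r v w : Fin n) : Prop :=
  G.Adj v w ∧ (InBlock G X r v ∨ v ∈ X) ∧ (InBlock G X r w ∨ w ∈ X) ∧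
    (InBlock G X r v ∨ InBlock G X r w)

theorem IsLink.symm {r v w : Fin n} (h : IsLink G X r v w) : IsLink G X r w v :=
  ⟨h.1.symm, h.2.2.1, h.2.1, h.2.2.2.symm⟩

/-- If the colouring `σ` looks like the partial solution `ρ`, as seen from `X` and the block
of `r`, then the edge `vw` of the full solution `τ` can be added at `v`. -/
theorem exchange_aux (hX : Separates G X) {r v w : Fin n} {p q : ℕ} {τ ρ σ : Fin n → ℕ}
    (hp : p ≠ 0) (hq : q ≠ 0) (hpq : p ≠ q) (hl : IsLink G X r v w) (hv : τ v = p) (hw : τ w = q)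
    (hτv : colourDegree G τ q v = 1) (hτw : colourDegree G τ p w = 1)
    (h1 : ∀ x ∈ X, ρ x = τ x) (h2 : ∀ u, ρ u ≠ 0 → ρ u = τ u) (h3 : v ∉ X → ρ v = 0)
    (h4 : w ∉ X → ρ w = 0) (k1 : ∀ x ∈ X, σ x = p ↔ ρ x = p) (k2 : ∀ x ∈ X, σ x = q ↔ ρ x = q)
    (k3 : ∀ x ∈ X, σ x = p → colourDegree G ρ q x = 0 → colourDegree G σ q x = 0)
    (k4 : ∀ x ∈ X, σ x = q → colourDegree G ρ p x = 0 → colourDegree G σ p x = 0)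
    (k5 : ∀ y, InBlock G X r y → σ y = p → ∃ z, InBlock G X r z ∧ ρ z = p)
    (k6 : ∀ y, InBlock G X r y → σ y = q → ∃ z, InBlock G X r z ∧ ρ z = q)
    (hσ : ∀ u, σ u = 0 ∨ σ u = p ∨ σ u = q) :
    σ v = (if v ∈ X then p else 0) ∧ colourDegree G σ q v = if w ∈ X then 1 else 0 := by
  obtain ⟨hadj, hlv, hlw, hlvw⟩ := hl
  have hρτ : ∀ {u c}, c ≠ 0 → ρ u = c → τ u = c := fun hc hu => by
    rw [← h2 _ (by rw [hu]; exact hc), hu]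
  by_cases hvX : v ∈ X
  · have hwb : InBlock G X r w := hlvw.resolve_left fun h => h.1 hvX
    have hσv : σ v = p := (k1 v hvX).2 ((h1 v hvX).trans hv)
    rw [if_pos hvX, if_neg hwb.1]
    refine ⟨hσv, k3 v hvX hσv (colourDegree_eq_zero.2 fun y hy hyq => ?_)⟩
    have := colourDegree_unique hτv hadj hw hy (hρτ hq hyq)
    rw [this, h4 hwb.1] at hyq
    exact hq hyq.symm
  · have hvb : InBlock G X r v := hlv.resolve_right hvX
    -- If colour `q` occurred in the block, the flag would give such a vertex `z` for `ρ`, hence for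
    -- `τ`. The block is a clique, so `z` would be the partner `w` of `v`, which is uncoloured in
    -- `ρ`.
    have hnoq : ∀ y, InBlock G X r y → σ y ≠ q := by
      intro y hy hyq
      obtain ⟨z, hz, hzq⟩ := k6 y hy hyq
      have hzτ := hρτ hq hzq
      have hvz : v ≠ z := by
        rintro rfl
        exact hpq (hv.symm.trans hzτ)
      have := colourDegree_unique hτv hadj hw (hX.block_adj hvb hz hvz) hzτ
      rw [this] at hz hzq
      rw [h4 hz.1] at hzq
      exact hq hzq.symm
    -- If `w` is in `X`, then `w` has `p`-degree 0 in `ρ`, hence in `σ`, which excludes colour `p`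
    -- at `v`. If `w` is in the block, the clique argument applies with `w` and `p`.
    have hvp : σ v ≠ p := by
      intro hc
      by_cases hwX : w ∈ X
      · have hσw : σ w = q := (k2 w hwX).2 ((h1 w hwX).trans hw)
        have := k4 w hwX hσw (colourDegree_eq_zero.2 fun y hy hyp => by
          have := colourDegree_unique hτw hadj.symm hv hy (hρτ hp hyp)
          rw [this, h3 hvX] at hyp
          exact hp hyp.symm)
        exact colourDegree_eq_zero.1 this v hadj.symm hc
      · have hwb : InBlock G X r w := hlw.resolve_right hwX
        obtain ⟨z, hz, hzp⟩ := k5 v hvb hc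
        have hzτ := hρτ hp hzp
        have hwz : w ≠ z := by
          rintro rfl
          exact hpq (hzτ.symm.trans hw)
        have := colourDegree_unique hτw hadj.symm hv (hX.block_adj hwb hz hwz) hzτ
        rw [this, h3 hvX] at hzp
        exact hp hzp.symm
    -- Since the block has no colour `q`, a `q`-neighbour of `v` lies in `X`, where having colour
    -- `q` means the same for `σ` and `τ`.
    have hother : ∀ y, G.Adj v y → σ y = q → y = w ∧ w ∈ X := by
      intro y hy hyq
      by_cases hyX : y ∈ X
      · have hyτ : τ y = q := (h1 y hyX).symm.trans ((k2 y hyX).1 hyq)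
        have := colourDegree_unique hτv hadj hw hy hyτ
        exact ⟨this, this ▸ hyX⟩
      · exact absurd hyq (hnoq y (hX.block_of_adj hvb hyX hy))
    rw [if_neg hvX]
    refine ⟨?_, ?_⟩
    · rcases hσ v with h | h | h
      · exact h
      · exact absurd h hvp
      · exact absurd h (hnoq v hvb)
    · split_ifs with hwX
      · exact colourDegree_eq_one.2 ⟨w, ⟨hadj, (k2 w hwX).2 ((h1 w hwX).trans hw)⟩,
          fun y hy hyq => (hother y hy hyq).1⟩
      · exact colourDegree_eq_zero.2 fun y hy hyq => hwX (hother y hy hyq).2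

/-- Every vertex that has a colour has exactly one neighbour of the other colour. -/
def IsMatched (G : SimpleGraph (Fin n)) (τ : Fin n → ℕ) : Prop :=
  ∀ v, (τ v = 1 → colourDegree G τ 2 v = 1) ∧ (τ v = 2 → colourDegree G τ 1 v = 1)

/-- The partial solution consisting of the vertices in `X` and of the matching edges in `D`. -/
noncomputable def restrictTo (G : SimpleGraph (Fin n)) (X : Finset (Fin n)) (τ : Fin n → ℕ)
    (D : Set (Fin n × Fin n)) (u : Fin n) : ℕ :=
  if u ∈ X ∨ ∃ w, G.Adj u w ∧ (τ u = 1 ∧ τ w = 2 ∧ (u, w) ∈ D ∨ τ w = 1 ∧ τ u = 2 ∧ (w, u) ∈ D)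
  then τ u else 0

theorem restrictTo_of_mem {τ : Fin n → ℕ} {D : Set (Fin n × Fin n)} {x : Fin n} (hx : x ∈ X) :
    restrictTo G X τ D x = τ x := if_pos (Or.inl hx)

theorem restrictTo_of_ne_zero {τ : Fin n → ℕ} {D : Set (Fin n × Fin n)} {u : Fin n}
    (h : restrictTo G X τ D u ≠ 0) : restrictTo G X τ D u = τ u := by
  unfold restrictTo at h ⊢
  split_ifs at h ⊢ with hc
  · rfl
  · exact absurd rfl h

/-- Partners in `τ` are unique, so outside of `X` the ends of an edge not yet in `D` cannot have
been coloured by another edge. -/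
theorem restrictTo_eq_zero {τ : Fin n → ℕ} (hτ : IsMatched G τ) {D : Set (Fin n × Fin n)}
    {v w : Fin n} (hadj : G.Adj v w) (hv : τ v = 1) (hw : τ w = 2) (hD : (v, w) ∉ D) :
    (v ∉ X → restrictTo G X τ D v = 0) ∧ (w ∉ X → restrictTo G X τ D w = 0) := by
  refine ⟨fun hX => if_neg ?_, fun hX => if_neg ?_⟩
  · rintro (h | ⟨y, hy, ⟨-, h2, h3⟩ | ⟨-, h2, -⟩⟩)
    · exact hX h
    · rw [colourDegree_unique ((hτ v).1 hv) hadj hw hy h2] at h3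
      exact hD h3
    · rw [hv] at h2; exact absurd h2 (by decide)
  · rintro (h | ⟨y, hy, ⟨h2, -, -⟩ | ⟨h2, -, h3⟩⟩)
    · exact hX h
    · rw [hw] at h2; exact absurd h2 (by decide)
    · rw [colourDegree_unique ((hτ w).2 hw) hadj.symm hv hy h2] at h3
      exact hD h3

theorem restrictTo_insert {τ : Fin n → ℕ} {D : Set (Fin n × Fin n)}
    {v w : Fin n} (hadj : G.Adj v w) (hv : τ v = 1) (hw : τ w = 2) :
    restrictTo G X τ (insert (v, w) D) =
      Function.update (Function.update (restrictTo G X τ D) v 1) w 2 := by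
  funext u
  by_cases huw : u = w
  · subst huw
    rw [Function.update_self, restrictTo, if_pos, hw]
    exact Or.inr ⟨v, hadj.symm, Or.inr ⟨hv, hw, Set.mem_insert _ _⟩⟩
  · rw [Function.update_of_ne huw]
    by_cases huv : u = v
    · subst huv
      rw [Function.update_self, restrictTo, if_pos, hv]
      exact Or.inr ⟨w, hadj, Or.inl ⟨hv, hw, Set.mem_insert _ _⟩⟩
    · rw [Function.update_of_ne huv, restrictTo, restrictTo]
      simp [huw, huv]

theorem restrictTo_insert_of_not {τ : Fin n → ℕ} {D : Set (Fin n × Fin n)} {v w : Fin n}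
    (h : ¬ (G.Adj v w ∧ τ v = 1 ∧ τ w = 2)) :
    restrictTo G X τ (insert (v, w) D) = restrictTo G X τ D := by
  funext u
  unfold restrictTo
  congr 1
  refine propext (or_congr_right (exists_congr fun y => and_congr_right fun hy => ?_))
  simp only [Set.mem_insert_iff, Prod.mk.injEq]
  constructor
  · rintro (⟨a, b, ⟨rfl, rfl⟩ | c⟩ | ⟨a, b, ⟨rfl, rfl⟩ | c⟩)
    · exact absurd ⟨hy, a, b⟩ h
    · exact Or.inl ⟨a, b, c⟩
    · exact absurd ⟨hy.symm, a, b⟩ h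
    · exact Or.inr ⟨a, b, c⟩
  · rintro (⟨a, b, c⟩ | ⟨a, b, c⟩)
    · exact Or.inl ⟨a, b, Or.inr c⟩
    · exact Or.inr ⟨a, b, Or.inr c⟩

theorem blockFlag_eq {r : Fin n} {σ ρ : Fin n → ℕ} {q : ℕ}
    (h : blockFlag G X r σ q = blockFlag G X r ρ q) (y : Fin n) (hy : InBlock G X r y)
    (hyq : σ y = q) : ∃ z, InBlock G X r z ∧ ρ z = q := by
  unfold blockFlag at h
  rw [if_pos ⟨y, hy, hyq⟩] at h
  by_contra hc
  rw [if_neg hc] at h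
  exact absurd h (by decide)

/-- If `σ` has the same key as a partial solution, then the next matching edge of the solution can
be added to `σ`. -/
theorem exchange (hX : Separates G X) {r v w : Fin n} {τ σ : Fin n → ℕ} (hτ : IsMatched G τ)
    {D : Set (Fin n × Fin n)} (hl : IsLink G X r v w) (hv : τ v = 1) (hw : τ w = 2)
    (hD : (v, w) ∉ D)
    (hkey : key G X (place X) r σ = key G X (place X) r (restrictTo G X τ D))
    (hσ : ∀ u, σ u ≤ 2) :
    Joins G X 1 2 v w σ (Function.update (Function.update σ v 1) w 2) := by
  obtain ⟨hdig, hf1, hf2⟩ := key_eq_iff.1 hkey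
  have hz := restrictTo_eq_zero (X := X) hτ hl.1 hv hw hD
  have hσ' : ∀ u, σ u = 0 ∨ σ u = 1 ∨ σ u = 2 := fun u => by have := hσ u; omega
  have h1 : ∀ x ∈ X, restrictTo G X τ D x = τ x := fun x hx => restrictTo_of_mem hx
  have h2 : ∀ u, restrictTo G X τ D u ≠ 0 → restrictTo G X τ D u = τ u :=
    fun u hu => restrictTo_of_ne_zero hu
  have d1 : ∀ x ∈ X, σ x = 1 → colourDegree G (restrictTo G X τ D) 2 x = 0 →
      colourDegree G σ 2 x = 0 := fun x hx hx1 h0 => by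
    have := (digit_eq (hdig x hx)).2.2.1 hx1
    rw [h0] at this; omega
  have d2 : ∀ x ∈ X, σ x = 2 → colourDegree G (restrictTo G X τ D) 1 x = 0 →
      colourDegree G σ 1 x = 0 := fun x hx hx1 h0 => by
    have := (digit_eq (hdig x hx)).2.2.2 hx1
    rw [h0] at this; omega
  have c1 : ∀ x ∈ X, σ x = 1 ↔ restrictTo G X τ D x = 1 := fun x hx => (digit_eq (hdig x hx)).1
  have c2 : ∀ x ∈ X, σ x = 2 ↔ restrictTo G X τ D x = 2 := fun x hx => (digit_eq (hdig x hx)).2.1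
  -- The argument at `v` and then, with the colours interchanged, at `w` gives the two halves of
  -- `Joins`.
  obtain ⟨a1, a2⟩ := exchange_aux hX (by decide) (by decide) (by decide) hl hv hw ((hτ v).1 hv)
    ((hτ w).2 hw) h1 h2 hz.1 hz.2 c1 c2 d1 d2 (blockFlag_eq hf1) (blockFlag_eq hf2) hσ'
  obtain ⟨b1, b2⟩ := exchange_aux hX (by decide) (by decide) (by decide) hl.symm hw hv
    ((hτ w).2 hw) ((hτ v).1 hv) h1 h2 hz.2 hz.1 c2 c1 d2 d1 (blockFlag_eq hf2) (blockFlag_eq hf1)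
    (fun u => by have := hσ u; omega)
  refine ⟨hl.1, a1, b1, a2, b2, ?_, Function.update_self _ _ _, fun u hu hu' => ?_⟩
  · rw [Function.update_of_ne hl.1.ne, Function.update_self]
  · rw [Function.update_of_ne hu', Function.update_of_ne hu]

/-- After a join, digits and flags are determined by those before it and by the pair `v`, `w`. -/
theorem Joins.key_congr {r v w : Fin n} {σ σ' ρ ρ' : Fin n → ℕ} (h : Joins G X 1 2 v w σ σ')
    (h' : Joins G X 1 2 v w ρ ρ')
    (hkey : key G X (place X) r σ = key G X (place X) r ρ) :
    key G X (place X) r σ' = key G X (place X) r ρ' := by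
  obtain ⟨hdig, hf1, hf2⟩ := key_eq_iff.1 hkey
  refine key_eq_iff.2 ⟨fun x hx => ?_, ?_, ?_⟩
  · rw [h.digit, h'.digit, hdig x hx]
  · rw [h.blockFlag (by decide) (by decide), h'.blockFlag (by decide) (by decide), hf1]
  · rw [h.symm.blockFlag (by decide) (by decide), h'.symm.blockFlag (by decide) (by decide), hf2]

/-- Outside of `X` there are colours only in the blocks of vertices below `i`. -/
def IsLocated (G : SimpleGraph (Fin n)) (X : Finset (Fin n)) (i : ℕ) (σ : Fin n → ℕ) : Prop :=
  ∀ u ∉ X, σ u ≠ 0 → ∃ r : Fin n, (r : ℕ) < i ∧ InBlock G X r u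

/-- No vertex of a block is coloured before its turn, so the flags start at 0 for all partial
solutions and need not be remembered from block to block. -/
theorem IsLocated.blockFlag (hX : Separates G X) {r : Fin n} {σ : Fin n → ℕ}
    (h : IsLocated G X r σ) {q : ℕ} (hq : q ≠ 0) : blockFlag G X r σ q = 0 := by
  refine if_neg ?_
  rintro ⟨v, hv, hvq⟩
  obtain ⟨r', hr', hb⟩ := h v hv.1 (by rw [hvq]; exact hq)
  rw [hX.block_unique hv hb] at hr'
  exact lt_irrefl _ hr'

/-- The pairs of vertices that have been treated before the block of number `i`. -/
def linksBelow (G : SimpleGraph (Fin n)) (X : Finset (Fin n)) (i : ℕ) : Set (Fin n × Fin n) :=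
  {a | ∃ r : Fin n, (r : ℕ) < i ∧ IsLink G X r a.1 a.2}

theorem isLocated_restrictTo (τ : Fin n → ℕ) (i : ℕ) :
    IsLocated G X i (restrictTo G X τ (linksBelow G X i)) := by
  intro u hu h
  unfold restrictTo at h
  split_ifs at h with hc
  · rcases hc with hc | ⟨w, -, ⟨-, -, r, hr, hl⟩ | ⟨-, -, r, hr, hl⟩⟩
    · exact absurd hc hu
    · exact ⟨r, hr, hl.2.1.resolve_right hu⟩
    · exact ⟨r, hr, hl.2.2.1.resolve_right hu⟩
  · exact absurd rfl h

/-- A coloured vertex outside of `X` lies in some block, and the edge to its partner is a link of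
that block. -/
theorem restrictTo_all (hX : Separates G X) {τ : Fin n → ℕ} (hτ : IsMatched G τ)
    (h2 : ∀ u, τ u ≤ 2) : restrictTo G X τ (linksBelow G X n) = τ := by
  funext u
  unfold restrictTo
  split_ifs with hc
  · rfl
  · rw [not_or] at hc
    by_contra hne
    obtain ⟨r, hr⟩ := hX.exists_block hc.1
    have hlink : ∀ w, G.Adj u w → IsLink G X r u w := fun w hw => by
      refine ⟨hw, Or.inl hr, ?_, Or.inl hr⟩
      by_cases hwX : w ∈ X
      · exact Or.inr hwX
      · exact Or.inl (hX.block_of_adj hr hwX hw)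
    have : τ u = 1 ∨ τ u = 2 := by have := h2 u; omega
    rcases this with h | h
    · obtain ⟨w, ⟨hw, hw2⟩, -⟩ := colourDegree_eq_one.1 ((hτ u).1 h)
      exact hc.2 ⟨w, hw, Or.inl ⟨h, hw2, r, r.2, hlink w hw⟩⟩
    · obtain ⟨w, ⟨hw, hw2⟩, -⟩ := colourDegree_eq_one.1 ((hτ u).2 h)
      exact hc.2 ⟨w, hw, Or.inr ⟨hw2, h, r, r.2, (hlink w hw).symm⟩⟩

/-- If min(d, 2) = 1 then d = 1, so degrees capped at 2 suffice to recognise a matched vertex of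
`X`. -/
theorem IsMatchedOutside.isMatched {σ τ : Fin n → ℕ} (h : IsMatchedOutside G X σ)
    (hτ : IsMatched G τ) (hdig : ∀ x ∈ X, digit G σ x = digit G τ x) : IsMatched G σ := by
  intro v
  by_cases hv : v ∈ X
  · obtain ⟨d1, d2, d3, d4⟩ := digit_eq (hdig v hv)
    refine ⟨fun h1 => ?_, fun h1 => ?_⟩
    · have := d3 h1
      rw [(hτ v).1 (d1.1 h1)] at this; omega
    · have := d4 h1
      rw [(hτ v).2 (d2.1 h1)] at this; omega
  · exact h v hv

end Exchange

/-! ### Enumerating the colourings of X and adding matching edges -/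

namespace RAM

open scoped Classical

variable {n : ℕ} {G : SimpleGraph (Fin n)} {X : Finset (Fin n)} {s s' : State}

namespace Stmt

/-- The colouring has colours up to `2`, and only in `X`. -/
def IsInside (X : Finset (Fin n)) (σ : Fin n → ℕ) : Prop :=
  ∀ u, σ u ≤ 2 ∧ (u ∉ X → σ u = 0)

/-- As long as only `X` is coloured, the key determines the colouring, so the enumeration of
colourings of `X` loses nothing to the one-entry-per-key rule. -/
theorem IsInside.eq_of_key {σ τ : Fin n → ℕ} {r : Fin n} (hσ : IsInside X σ) (hτ : IsInside X τ)
    (h : key G X (place X) r σ = key G X (place X) r τ) : σ = τ := by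
  funext u
  by_cases hu : u ∈ X
  · have := digit_eq ((key_eq_iff.1 h).1 u hu)
    have h1 := (hσ u).1
    have h2 := (hτ u).1
    omega
  · rw [(hσ u).2 hu, (hτ u).2 hu]

/-- The table is in use and the new table is empty. -/
structure IsClean (G : SimpleGraph (Fin n)) (X : Finset (Fin n)) (s : State) : Prop
    extends IsReady G X s where
  empty : ∀ c, s.arr 7 c = 0

theorem IsClean.step (h : IsClean G X s) {e : Expr} {p q : ℕ}
    (h7 : ∀ c, ((step e p q).eval s).arr 7 c = 0) : IsClean G X ((step e p q).eval s) :=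
  ⟨h.1.congr' (fun y hy => reg_step e p q (by simp; omega))
    fun a ha => arr_step e p q (by simp; omega), h7⟩

/-- The vertex `x` plays the roles of `r`, `v` and `w` at once: both writes of `paint` hit `x`, and
as an index of the flags it is immaterial since no block is coloured yet. -/
theorem colour_step_spec (h : IsClean G X s) {x : Fin n} (h2 : s.reg 2 = x) (h3 : s.reg 3 = x)
    (h4 : s.reg 4 = x) {p : ℕ} (hp : p ≤ 2) (hs : ∀ σ, IsEntry X s σ → IsInside X σ) :
    IsClean G X ((step (.get 3 (.var 3)) p p).eval s) ∧
      (∀ σ, IsEntry X ((step (.get 3 (.var 3)) p p).eval s) σ → IsInside X σ) ∧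
      ∀ σ, IsEntry X s σ → IsEntry X ((step (.get 3 (.var 3)) p p).eval s) σ ∧
        (x ∈ X → IsEntry X ((step (.get 3 (.var 3)) p p).eval s) (Function.update σ x p)) := by
  obtain ⟨a1, a2, a3, a4⟩ := step_spec h.1 h2 h3 h4 h.2 (e := .get 3 (.var 3)) (p := p) (q := p)
    (C := fun _ => x ∈ X) (by
      intro t ht _ ht3 _
      simp only [Expr.eval, ht3, ht.mem]
      split_ifs with hx <;> simp [hx])
  simp only [Function.update_idem] at a2 a4
  have hupd : ∀ σ, IsInside X σ → x ∈ X → IsInside X (Function.update σ x p) := by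
    intro σ hσ hx u
    rw [Function.update_apply]
    split_ifs with hu
    · exact ⟨hp, fun hc => absurd (hu ▸ hx) hc⟩
    · exact hσ u
  have hin : ∀ σ, IsEntry X ((step (.get 3 (.var 3)) p p).eval s) σ → IsInside X σ := by
    intro σ' hσ'
    obtain ⟨σ, hσ, rfl | ⟨hx, rfl⟩⟩ := a2 σ' hσ'
    · exact hs _ hσ
    · exact hupd σ (hs σ hσ) hx
  refine ⟨h.step a1, hin, fun σ hσ => ⟨?_, fun hx => ?_⟩⟩
  · obtain ⟨σ', b1, b2, -⟩ := a3 σ hσ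
    rwa [(hin σ' b1).eq_of_key (hs σ hσ) b2] at b1
  · obtain ⟨σ', b1, b2, -⟩ := a4 σ hσ hx
    rwa [(hin σ' b1).eq_of_key (hupd σ (hs σ hσ) hx) b2] at b1

/-- Try all colours for the vertex in register `2`, provided that it is in `X`. -/
def colourVertex : Stmt :=
  seq (assign 3 (.var 2)) (seq (assign 4 (.var 2))
    (seq (step (.get 3 (.var 3)) 1 1) (step (.get 3 (.var 3)) 2 2)))

/-- Enter all colourings of `X` into the table. -/
def colourX : Stmt := for_ 2 (.var 0) colourVertex

theorem colourX_spec (h : IsClean G X s) (hs : ∀ σ, IsEntry X s σ ↔ σ = fun _ => 0) :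
    IsClean G X (colourX.eval s) ∧ (∀ σ, IsEntry X (colourX.eval s) σ → IsInside X σ) ∧
      ∀ τ : Fin n → ℕ, (∀ u, τ u ≤ 2) →
        IsEntry X (colourX.eval s) fun u => if u ∈ X then τ u else 0 := by
  have key := for_induct (x := 2) (e := .var 0) (p := colourVertex) (s := s)
    (fun i t => IsClean G X t ∧ (∀ σ, IsEntry X t σ → IsInside X σ) ∧
      ∀ τ : Fin n → ℕ, (∀ u, τ u ≤ 2) →
        IsEntry X t fun u => if u ∈ X ∧ (u : ℕ) < i then τ u else 0)
    ⟨h, fun σ hσ => by rw [(hs σ).1 hσ]; exact fun u => ⟨by simp, fun _ => rfl⟩,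
      fun τ _ => by rw [hs]; simp⟩
    (by
      rintro i hi t ⟨t1, t2, t3⟩
      have hi' : i < n := by rw [← h.reg_zero]; exact hi
      set x : Fin n := ⟨i, hi'⟩ with hx
      set u := ((t.setReg 2 i).setReg 3 i).setReg 4 i with hu
      have hdef : colourVertex.eval (t.setReg 2 i) =
          (step (.get 3 (.var 3)) 2 2).eval ((step (.get 3 (.var 3)) 1 1).eval u) := by
        simp only [colourVertex, eval, Expr.eval, State.setReg_reg, hu]
        rfl
      rw [hdef]
      have u1 : IsClean G X u := ⟨t1.1.congr' (fun y hy => by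
        have h2 : y ≠ 2 := by omega
        have h3 : y ≠ 3 := by omega
        have h4 : y ≠ 4 := by omega
        simp [hu, h2, h3, h4]) (fun _ _ => rfl), t1.2⟩
      obtain ⟨b1, b2, b3⟩ := colour_step_spec (x := x) (p := 1) u1 (by simp [hu, hx])
        (by simp [hu, hx]) (by simp [hu, hx]) (by decide) t2
      obtain ⟨c1, c2, c3⟩ := colour_step_spec (x := x) (p := 2) b1
        ((reg_step _ _ _ (by decide)).trans (by simp [hu, hx]))
        ((reg_step _ _ _ (by decide)).trans (by simp [hu, hx]))
        ((reg_step _ _ _ (by decide)).trans (by simp [hu, hx])) (by decide) b2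
      refine ⟨c1, c2, fun τ hτ => ?_⟩
      have hold : IsEntry X u fun y => if y ∈ X ∧ (y : ℕ) < i then τ y else 0 := t3 τ hτ
      have hlt : ∀ y : Fin n, y ≠ x → ((y : ℕ) < i + 1 ↔ (y : ℕ) < i) := fun y hy => by
        have : (y : ℕ) ≠ i := fun e => hy (Fin.ext e)
        omega
      -- A nonzero colour is painted in one of the two rounds and kept in the other; otherwise the
      -- old entry, kept in both, already serves.
      by_cases hzero : x ∈ X ∧ τ x ≠ 0
      · obtain ⟨hxX, hτx⟩ := hzero
        have hupd : (fun y => if y ∈ X ∧ (y : ℕ) < i + 1 then τ y else 0) = Function.update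
            (fun y => if y ∈ X ∧ (y : ℕ) < i then τ y else 0) x (τ x) := by
          funext y
          rw [Function.update_apply]
          split_ifs with h1 h2 h3 h4
          · rw [h2]
          · rfl
          · exact absurd ⟨h1.1, (hlt y h2).1 h1.2⟩ h3
          · exact absurd ⟨h4 ▸ hxX, by rw [h4]; simp [hx]⟩ h1
          · next h5 => exact absurd ⟨h5.1, h5.2.trans (Nat.lt_succ_self i)⟩ h1
          · rfl
        rw [hupd]
        have : τ x = 1 ∨ τ x = 2 := by have := hτ x; omega
        rcases this with h1 | h1
        · rw [h1]; exact (c3 _ ((b3 _ hold).2 hxX)).1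
        · rw [h1]; exact (c3 _ (b3 _ hold).1).2 hxX
      · have hsame : (fun y => if y ∈ X ∧ (y : ℕ) < i + 1 then τ y else 0) =
            fun y => if y ∈ X ∧ (y : ℕ) < i then τ y else 0 := by
          funext y
          by_cases hy : y = x
          · by_cases hyX : x ∈ X
            · have : τ x = 0 := by by_contra hc; exact hzero ⟨hyX, hc⟩
              rw [hy, this]; simp
            · rw [hy]; simp [hyX]
          · simp only [hlt y hy]
        rw [hsame]
        exact (c3 _ (b3 _ hold).1).1)
  have h0 : (Expr.var 0).eval s = n := h.reg_zero
  rw [h0] at key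
  exact ⟨key.1, key.2.1, fun τ hτ => by
    have := key.2.2 τ hτ
    simp only [Fin.is_lt, and_true] at this
    exact this⟩

/-- Whether the vertices in registers `3` and `4` are linked in the block of the vertex in
register `2`. -/
def linkTest : Expr :=
  .mul (.adj (.var 3) (.var 4)) (.mul (.mul (.or (.inBlock (.var 3)) (.get 3 (.var 3)))
    (.or (.inBlock (.var 4)) (.get 3 (.var 4)))) (.or (.inBlock (.var 3)) (.inBlock (.var 4))))

/-- Whether the vertices in registers `3` and `4` are linked and can be joined. -/
def joinTest : Expr :=
  .mul linkTest (.mul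
    (.mul (.eq (.get 9 (.var 3)) (.get 3 (.var 3)))
      (.eq (.get 9 (.var 4)) (.mul (.lit 2) (.get 3 (.var 4)))))
    (.mul (.eq (.colourDegree 2 (.var 3)) (.get 3 (.var 4)))
      (.eq (.colourDegree 1 (.var 4)) (.get 3 (.var 3)))))

theorem linkTest_eval (h : IsMarked G X s) {r v w : Fin n} (hr : s.reg 2 = r) (hv : s.reg 3 = v)
    (hw : s.reg 4 = w) : linkTest.eval s = if IsLink G X r v w then 1 else 0 := by
  have a1 := Expr.eval_adj h.1 (e := .var 3) (f := .var 4) hv hw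
  have a2 := Expr.eval_inBlock h hr (e := .var 3) hv
  have a3 := Expr.eval_inBlock h hr (e := .var 4) hw
  simp only [linkTest, Expr.or, Expr.eval, a1, a2, a3, hv, hw, h.mem, IsLink]
  by_cases b1 : G.Adj v w
  swap
  · simp [b1]
  by_cases b2 : InBlock G X r v <;> by_cases b3 : InBlock G X r w <;> by_cases b4 : v ∈ X <;>
    by_cases b5 : w ∈ X <;> simp [b1, b2, b3, b4, b5]

/-- The entries of array 3 are indicators of `X`, so the equations tested are the fields of `Joins`
about the old colouring; those about the new one hold by construction. -/
theorem joinTest_pos (h : IsMarked G X s) {r v w : Fin n} (hr : s.reg 2 = r) (hv : s.reg 3 = v)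
    (hw : s.reg 4 = w) : 0 < joinTest.eval s ↔ IsLink G X r v w ∧
      Joins G X 1 2 v w (s.col 9)
        (Function.update (Function.update (s.col 9) v 1) w 2) := by
  have a1 := linkTest_eval h hr hv hw
  have a2 := Expr.eval_colourDegree h.1 (e := .var 3) (v := v) (by simp [Expr.eval, hv]) 2
  have a3 := Expr.eval_colourDegree h.1 (e := .var 4) (v := w) (by simp [Expr.eval, hw]) 1
  simp only [joinTest, Expr.eval, a1, a2, a3, hv, hw, h.mem]
  have e1 : s.arr 9 v = (s.col 9 : Fin n → ℕ) v := rfl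
  have e2 : s.arr 9 w = (s.col 9 : Fin n → ℕ) w := rfl
  rw [e1, e2]
  generalize (s.col 9 : Fin n → ℕ) = σ
  have e3 : (2 * if w ∈ X then 1 else 0) = if w ∈ X then 2 else 0 := by split_ifs <;> rfl
  rw [e3]
  constructor
  · intro hpos
    by_cases b1 : IsLink G X r v w
    swap
    · simp [b1] at hpos
    by_cases b2 : σ v = if v ∈ X then 1 else 0
    swap
    · simp [b2] at hpos
    by_cases b3 : σ w = if w ∈ X then 2 else 0
    swap
    · simp [b3] at hpos
    by_cases b4 : colourDegree G σ 2 v = if w ∈ X then 1 else 0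
    swap
    · simp [b4] at hpos
    by_cases b5 : colourDegree G σ 1 w = if v ∈ X then 1 else 0
    swap
    · simp [b5] at hpos
    refine ⟨b1, b1.1, b2, b3, b4, b5, ?_, Function.update_self _ _ _, fun u hu hu' => ?_⟩
    · rw [Function.update_of_ne b1.1.ne, Function.update_self]
    · rw [Function.update_of_ne hu', Function.update_of_ne hu]
  · rintro ⟨b1, b2⟩
    simp only [b1, b2.left, b2.right, b2.degree_left, b2.degree_right, if_true]
    decide

/-- The pairs that have been treated in the block of `r` and before, if those in `E` have been
treated in the block of `r`. -/
def treated (G : SimpleGraph (Fin n)) (X : Finset (Fin n)) (r : Fin n) (E : Set (Fin n × Fin n)) :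
    Set (Fin n × Fin n) :=
  {a | a ∈ linksBelow G X r ∨ a ∈ E ∧ IsLink G X r a.1 a.2}

theorem treated_empty (r : Fin n) : treated G X r ∅ = linksBelow G X r := by
  ext a
  exact ⟨fun h => h.resolve_right fun h => h.1, Or.inl⟩

theorem treated_univ (r : Fin n) : treated G X r Set.univ = linksBelow G X (r + 1) := by
  ext a
  constructor
  · rintro (⟨r', h1, h2⟩ | ⟨-, h⟩)
    · exact ⟨r', h1.trans (Nat.lt_succ_self _), h2⟩
    · exact ⟨r, Nat.lt_succ_self _, h⟩
  · rintro ⟨r', h1, h2⟩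
    rcases Nat.lt_succ_iff_lt_or_eq.1 h1 with hlt | heq
    · exact Or.inl ⟨r', hlt, h2⟩
    · exact Or.inr ⟨trivial, Fin.ext heq ▸ h2⟩

theorem treated_insert {r v w : Fin n} (h : IsLink G X r v w) (E : Set (Fin n × Fin n)) :
    treated G X r (insert (v, w) E) = insert (v, w) (treated G X r E) := by
  ext ⟨a, b⟩
  simp only [treated, Set.mem_ofPred_eq, Set.mem_insert_iff, Prod.mk.injEq]
  constructor
  · rintro (h1 | ⟨h1 | h1, h2⟩)
    · exact Or.inr (Or.inl h1)
    · exact Or.inl h1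
    · exact Or.inr (Or.inr ⟨h1, h2⟩)
  · rintro (⟨rfl, rfl⟩ | h1 | ⟨h1, h2⟩)
    · exact Or.inr ⟨Or.inl ⟨rfl, rfl⟩, h⟩
    · exact Or.inl h1
    · exact Or.inr ⟨Or.inr h1, h2⟩

theorem treated_insert_of_not {r v w : Fin n} (h : ¬ IsLink G X r v w) (E : Set (Fin n × Fin n)) :
    treated G X r (insert (v, w) E) = treated G X r E := by
  ext ⟨a, b⟩
  simp only [treated, Set.mem_ofPred_eq, Set.mem_insert_iff, Prod.mk.injEq]
  constructor
  · rintro (h1 | ⟨⟨rfl, rfl⟩ | h1, h2⟩)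
    · exact Or.inl h1
    · exact absurd h2 h
    · exact Or.inr ⟨h1, h2⟩
  · rintro (h1 | ⟨h1, h2⟩)
    · exact Or.inl h1
    · exact Or.inr ⟨Or.inr h1, h2⟩

/-- A link has an end outside of `X`, which determines the block. So no pair is a link of two
blocks. -/
theorem notMem_treated (hX : Separates G X) {r v w : Fin n} (h : IsLink G X r v w)
    {E : Set (Fin n × Fin n)} (hE : (v, w) ∉ E) : (v, w) ∉ treated G X r E := by
  rintro (⟨r', h1, h2⟩ | ⟨h1, -⟩)
  · have : r = r' := by
      rcases h.2.2.2 with hb | hb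
      · exact hX.block_unique hb (h2.2.1.resolve_right hb.1)
      · exact hX.block_unique hb (h2.2.2.1.resolve_right hb.1)
    rw [this] at h1
    exact lt_irrefl _ h1
  · exact hE h1

/-- The entries of the table are partial solutions up to the block of number `i`. -/
def IsSound (G : SimpleGraph (Fin n)) (X : Finset (Fin n)) (i : ℕ) (s : State) : Prop :=
  ∀ σ, IsEntry X s σ → (∀ u, σ u ≤ 2) ∧ IsMatchedOutside G X σ ∧ IsLocated G X i σ

/-- The colouring is one of a pair of perfectly matched sets. -/
def IsSolution (G : SimpleGraph (Fin n)) (τ : Fin n → ℕ) : Prop :=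
  IsMatched G τ ∧ ∀ u, τ u ≤ 2

/-- If the pair is not a link, or not an edge of `τ` with colours 1 and 2 in this order, the part of
`τ` does not change and the retained entry serves. Otherwise `exchange` allows the same edge to be
added to the table entry, with equal new keys and equal gains in weight. -/
theorem join_step_spec (hX : Separates G X) (h : IsClean G X s) {r v w : Fin n}
    (hr : s.reg 2 = r) (hv : s.reg 3 = v) (hw : s.reg 4 = w) {E : Set (Fin n × Fin n)}
    (hE : (v, w) ∉ E) (hs : IsSound G X (r + 1) s)
    (hc : ∀ τ, IsSolution G τ → ∃ σ, IsEntry X s σ ∧ key G X (place X) r σ =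
      key G X (place X) r (restrictTo G X τ (treated G X r E)) ∧
      weight (restrictTo G X τ (treated G X r E)) ≤ weight σ) :
    IsClean G X ((step joinTest 1 2).eval s) ∧ IsSound G X (r + 1) ((step joinTest 1 2).eval s) ∧
      ∀ τ, IsSolution G τ → ∃ σ, IsEntry X ((step joinTest 1 2).eval s) σ ∧
        key G X (place X) r σ =
          key G X (place X) r (restrictTo G X τ (treated G X r (insert (v, w) E))) ∧
        weight (restrictTo G X τ (treated G X r (insert (v, w) E))) ≤ weight σ := by
  obtain ⟨a1, a2, a3, a4⟩ := step_spec h.1 hr hv hw h.2 (e := joinTest) (p := 1) (q := 2)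
    (C := fun σ => IsLink G X r v w ∧ Joins G X 1 2 v w σ
      (Function.update (Function.update σ v 1) w 2))
    (fun t ht h2 h3 h4 => joinTest_pos ht.1 h2 h3 h4)
  refine ⟨h.step a1, fun σ' hσ' => ?_, fun τ hτ => ?_⟩
  · obtain ⟨σ, hσ, rfl | ⟨⟨hl, hj⟩, rfl⟩⟩ := a2 σ' hσ'
    · exact hs _ hσ
    · obtain ⟨b1, b2, b3⟩ := hs σ hσ
      refine ⟨fun u => ?_, hj.isMatchedOutside b2, fun u hu hne => ?_⟩
      · rw [Function.update_apply, Function.update_apply]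
        split_ifs
        · exact le_rfl
        · decide
        · exact b1 u
      · by_cases huw : u = w
        · subst huw
          exact ⟨r, Nat.lt_succ_self _, hl.2.2.1.resolve_right hu⟩
        · by_cases huv : u = v
          · subst huv
            exact ⟨r, Nat.lt_succ_self _, hl.2.1.resolve_right hu⟩
          · rw [hj.other u huv huw] at hne
            exact b3 u hu hne
  · obtain ⟨σ, hσ, hk, hwt⟩ := hc τ hτ
    by_cases hl : IsLink G X r v w
    swap
    · rw [treated_insert_of_not hl]
      obtain ⟨σ', c1, c2, c3⟩ := a3 σ hσ
      exact ⟨σ', c1, c2.trans hk, hwt.trans c3⟩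
    rw [treated_insert hl]
    by_cases hτe : τ v = 1 ∧ τ w = 2
    swap
    · rw [restrictTo_insert_of_not fun h => hτe h.2]
      obtain ⟨σ', c1, c2, c3⟩ := a3 σ hσ
      exact ⟨σ', c1, c2.trans hk, hwt.trans c3⟩
    rw [restrictTo_insert hl.1 hτe.1 hτe.2]
    have hD := notMem_treated hX hl hE
    have j1 := exchange hX hτ.1 hl hτe.1 hτe.2 hD hk (hs σ hσ).1
    -- Applied to the part of `τ` itself, `exchange` shows that its own growth is a join too.
    have j2 := exchange hX hτ.1 hl hτe.1 hτe.2 hD rfl fun u => by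
      unfold restrictTo
      split_ifs
      · exact hτ.2 u
      · decide
    obtain ⟨σ', c1, c2, c3⟩ := a4 σ hσ ⟨hl, j1⟩
    refine ⟨σ', c1, c2.trans (j1.key_congr j2 hk), ?_⟩
    have w1 := j1.weight
    have w2 := j2.weight
    omega

/-- Try all ways to add matching edges with an end outside of `X`. -/
def links : Stmt :=
  for_ 2 (.var 0) (for_ 3 (.var 0) (for_ 4 (.var 0) (step joinTest 1 2)))

/-- Between blocks only the digits are compared, since the flags refer to a particular block. Within
a block full keys are compared, starting from flags that are all 0 by `IsLocated.blockFlag`. -/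
theorem links_spec (hX : Separates G X) (h : IsClean G X s)
    (hs : ∀ σ, IsEntry X s σ → IsInside X σ)
    (hc : ∀ τ : Fin n → ℕ, (∀ u, τ u ≤ 2) → IsEntry X s fun u => if u ∈ X then τ u else 0) :
    IsReady G X (links.eval s) ∧ ∀ τ, IsSolution G τ → ∃ σ, IsEntry X (links.eval s) σ ∧
      IsMatched G σ ∧ weight τ ≤ weight σ := by
  have outer := for_induct (x := 2) (e := .var 0) (s := s)
    (p := for_ 3 (.var 0) (for_ 4 (.var 0) (step joinTest 1 2)))
    (fun i t => IsClean G X t ∧ IsSound G X i t ∧ ∀ τ, IsSolution G τ → ∃ σ, IsEntry X t σ ∧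
      (∀ x ∈ X, digit G σ x = digit G (restrictTo G X τ (linksBelow G X i)) x) ∧
      weight (restrictTo G X τ (linksBelow G X i)) ≤ weight σ)
    ⟨h, fun σ hσ => ⟨fun u => (hs σ hσ u).1,
        fun u hu => by rw [(hs σ hσ u).2 hu]; simp,
        fun u hu hne => absurd ((hs σ hσ u).2 hu) hne⟩,
      fun τ hτ => ⟨_, hc τ hτ.2, by
        have : (fun u => if u ∈ X then τ u else 0) = restrictTo G X τ (linksBelow G X 0) := by
          funext u
          by_cases hu : u ∈ X
          · rw [restrictTo_of_mem hu, if_pos hu]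
          · rw [if_neg hu, restrictTo, if_neg]
            simp [hu, linksBelow]
        rw [this]
        exact ⟨fun _ _ => rfl, le_rfl⟩⟩⟩
    (by
      rintro i hi t ⟨t1, t2, t3⟩
      have hi' : i < n := by rw [← h.reg_zero]; exact hi
      set r : Fin n := ⟨i, hi'⟩ with hr
      have hcl : ∀ (u : State) y j, y = 2 ∨ y = 3 ∨ y = 4 → IsClean G X u →
          IsClean G X (u.setReg y j) := fun u y j hy hu =>
        ⟨hu.1.congr' (fun z hz => by
          have : z ≠ y := by omega
          simp [this]) (fun _ _ => rfl), hu.2⟩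
      have inner := for_for_induct (s := t.setReg 2 i) (n := n) (p := step joinTest 1 2)
        (hcl t 2 i (by simp) t1).reg_zero (by decide) (by decide) (by decide)
        (fun E u => IsClean G X u ∧ IsSound G X (r + 1) u ∧
          ∀ τ, IsSolution G τ → ∃ σ, IsEntry X u σ ∧ key G X (place X) r σ =
            key G X (place X) r (restrictTo G X τ (treated G X r E)) ∧
            weight (restrictTo G X τ (treated G X r E)) ≤ weight σ)
        (fun E u j hu => ⟨⟨hcl u 3 j (by simp) hu.1, hu.2⟩, ⟨hcl u 4 j (by simp) hu.1, hu.2⟩⟩)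
        (fun E v w u _ u2 u3 u4 hE hu =>
          join_step_spec hX hu.1 (by rw [u2]; simp [hr]) u3 u4 hE hu.2.1 hu.2.2)
        ⟨hcl t 2 i (by simp) t1, fun σ hσ => by
          obtain ⟨b1, b2, b3⟩ := t2 σ hσ
          refine ⟨b1, b2, fun u hu hne => ?_⟩
          obtain ⟨r', h1, h2⟩ := b3 u hu hne
          exact ⟨r', h1.trans (Nat.lt_succ_self _), h2⟩, fun τ hτ => by
          obtain ⟨σ, b1, b2, b3⟩ := t3 τ hτ
          have l1 : IsLocated G X r σ := (t2 σ b1).2.2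
          have l2 : IsLocated G X r (restrictTo G X τ (linksBelow G X r)) :=
            isLocated_restrictTo τ r
          rw [treated_empty]
          refine ⟨σ, b1, key_eq_iff.2 ⟨b2, ?_, ?_⟩, b3⟩
          · rw [l1.blockFlag hX (by decide), l2.blockFlag hX (by decide)]
          · rw [l1.blockFlag hX (by decide), l2.blockFlag hX (by decide)]⟩
      rw [treated_univ] at inner
      refine ⟨inner.1, inner.2.1, fun τ hτ => ?_⟩
      obtain ⟨σ, b1, b2, b3⟩ := inner.2.2 τ hτ
      exact ⟨σ, b1, (key_eq_iff.1 b2).1, b3⟩)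
  have h0 : (Expr.var 0).eval s = n := h.reg_zero
  rw [h0] at outer
  refine ⟨outer.1.1, fun τ hτ => ?_⟩
  obtain ⟨σ, b1, b2, b3⟩ := outer.2.2 τ hτ
  rw [restrictTo_all hX hτ.1 hτ.2] at b2 b3
  exact ⟨σ, b1, (outer.2.1 σ b1).2.1.isMatched hτ.1 b2, b3⟩

end Stmt

end RAM

/-! ### Selecting the best entry -/

namespace RAM

open scoped Classical

variable {n : ℕ} {G : SimpleGraph (Fin n)} {X : Finset (Fin n)} {s s' : State}

namespace Stmt

/-- Whether vertices with colour `p` in array `9` have exactly one neighbour with colour `q`. -/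
def matchedTest (p q : ℕ) : Expr :=
  .not (.sum 9 (.var 0) (.mul (.eq (.get 9 (.var 9)) (.lit p))
    (.not (.eq (.colourDegree q (.var 9)) (.lit 1)))))

theorem matchedTest_eval (h : IsInput G s) (p q : ℕ) : (matchedTest p q).eval s =
    if ∀ v : Fin n, (s.col 9 : Fin n → ℕ) v = p → colourDegree G (s.col 9) q v = 1
      then 1 else 0 := by
  have hs : ∀ i, IsInput G (s.setReg 9 i) := fun i => h.congr (by simp) rfl
  have hd : ∀ v : Fin n, (Expr.colourDegree q (.var 9)).eval (s.setReg 9 v) =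
      colourDegree G (s.col 9) q v := fun v =>
    Expr.eval_colourDegree (hs v) (v := v) (by simp [Expr.eval]) q
  simp only [matchedTest, Expr.not, Expr.eval, h.reg_zero, Finset.sum_range, hd,
    Finset.sum_eq_zero_iff, State.setReg_arr, State.setReg_reg, if_true]
  congr 1
  refine propext (forall_congr' fun v => ?_)
  by_cases h1 : s.arr 9 v = p <;> by_cases h2 : colourDegree G (s.col 9) q v = 1 <;>
    simp [State.col, h1, h2]

/-- Copy the set of vertices with colour `q` in array `9` to array `q`. -/
def output (q : ℕ) : Stmt := for_ 6 (.var 0) (store q (.var 6) (.eq (.get 9 (.var 6)) (.lit q)))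

theorem output_spec (hn : s.reg 0 = n) {q : ℕ} (hq : q ≠ 9) (v : Fin n) :
    ((output q).eval s).arr q v = if (s.col 9 : Fin n → ℕ) v = q then 1 else 0 :=
  (eval_fill (x := 6) (a := q) (b := .var 0) (e := .var 6)
    (f := .eq (.get 9 (.var 6)) (.lit q)) (s := s) (N := n) hn id
    (fun i => if s.arr 9 i = q then 1 else 0) Function.injective_id (by
      intro t h1 h2
      refine ⟨rfl, ?_⟩
      simp only [Expr.eval, h1 9 hq.symm])).1 v v.2

/-- The condition that the colouring in array `9` is better than the present output. -/
def betterTest : Expr :=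
  .mul (.mul (matchedTest 1 2) (matchedTest 2 1))
    (.lt (.weight (.get 1 (.var 11))) (.weight (.get 9 (.var 11))))

/-- Replace the output by row `c` of the table if that is better, where register `5` holds `c`. -/
def improve : Stmt :=
  cond (.get 5 (.var 5)) (seq loadRow (cond betterTest (seq (output 1) (output 2)) skip)) skip

/-- Output the best entry of the table. -/
def best : Stmt := for_ 5 (.var 1) improve

/-- The output is the pair of colour classes of `σ`. -/
def IsOutput (s : State) (σ : Fin n → ℕ) : Prop :=
  ∀ v : Fin n, s.arr 1 v = (if σ v = 1 then 1 else 0) ∧ s.arr 2 v = if σ v = 2 then 1 else 0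

theorem improve_spec (h : IsReady G X s) {σ : Fin n → ℕ} (hσ : IsOutput s σ)
    (hm : IsMatched G σ) : ∃ σ', IsOutput (improve.eval s) σ' ∧ IsMatched G σ' ∧
      weight σ ≤ weight σ' ∧ (0 < s.arr 5 (s.reg 5) → IsMatched G (s.row 6 (s.reg 5)) →
        weight (n := n) (s.row 6 (s.reg 5)) ≤ weight σ') := by
  have hdef : improve.eval s = if 0 < s.arr 5 (s.reg 5) then
      (cond betterTest (seq (output 1) (output 2)) skip).eval (loadRow.eval s) else s := rfl
  rw [hdef]
  by_cases h5 : 0 < s.arr 5 (s.reg 5)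
  swap
  · rw [if_neg h5]
    exact ⟨σ, hσ, hm, le_rfl, fun h => absurd h h5⟩
  rw [if_pos h5]
  have hcol := col_loadRow h.reg_zero
  set t := loadRow.eval s with ht
  have hta : ∀ a, a ≠ 9 → t.arr a = s.arr a := fun a ha => eval_arr (by
    simp [loadRow, arrs]; omega)
  have htr : ∀ y < 5, t.reg y = s.reg y := fun y hy => eval_reg (by
    simp [loadRow, regs]; omega)
  have htR : IsReady G X t := h.congr' (fun y hy => htr y (by omega)) fun a ha => hta a (by omega)
  have htσ : IsOutput t σ := fun v => by rw [hta 1 (by decide), hta 2 (by decide)]; exact hσ v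
  rw [← hcol]
  set ρ : Fin n → ℕ := t.col 9 with hρ
  have hw1 : (Expr.weight (.get 1 (.var 11))).eval t = weight σ := by
    rw [Expr.eval_weight (n := n) htR.reg_zero (σ := fun v => if σ v = 1 then 1 else 0)]
    · simp [weight]
    · intro i
      simp only [Expr.eval, State.setReg_arr, State.setReg_reg, if_true, (htσ i).1]
  have hw2 : (Expr.weight (.get 9 (.var 11))).eval t = weight ρ :=
    Expr.eval_weight htR.reg_zero fun i => by
      simp only [Expr.eval, State.setReg_arr, State.setReg_reg, if_true]
      rfl
  have hpos : 0 < betterTest.eval t ↔ IsMatched G ρ ∧ weight σ < weight ρ := by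
    simp only [betterTest, Expr.eval, matchedTest_eval htR.1.1, hw1, hw2, ← hρ]
    have : IsMatched G ρ ↔ (∀ v, ρ v = 1 → colourDegree G ρ 2 v = 1) ∧
        ∀ v, ρ v = 2 → colourDegree G ρ 1 v = 1 := forall_and
    rw [this]
    by_cases b1 : ∀ v, ρ v = 1 → colourDegree G ρ 2 v = 1
    swap
    · simp only [if_neg b1, zero_mul]
      exact ⟨fun h => absurd h (lt_irrefl _), fun h => absurd h.1.1 b1⟩
    by_cases b2 : ∀ v, ρ v = 2 → colourDegree G ρ 1 v = 1
    swap
    · simp only [if_neg b2, zero_mul, mul_zero]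
      exact ⟨fun h => absurd h (lt_irrefl _), fun h => absurd h.1.2 b2⟩
    simp only [if_pos b1, if_pos b2, one_mul]
    split_ifs with b3
    · exact ⟨fun _ => ⟨⟨b1, b2⟩, b3⟩, fun _ => one_pos⟩
    · exact ⟨fun h => absurd h (lt_irrefl _), fun h => absurd h.2 b3⟩
  have hdef2 : (cond betterTest (seq (output 1) (output 2)) skip).eval t =
      if 0 < betterTest.eval t then (output 2).eval ((output 1).eval t) else t := rfl
  rw [hdef2]
  simp only [hpos]
  split_ifs with hc
  · refine ⟨ρ, fun v => ⟨?_, ?_⟩, hc.1, hc.2.le, fun _ _ => le_rfl⟩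
    · rw [eval_arr (p := output 2) (a := 1) (by decide)]
      exact output_spec htR.reg_zero (by decide) v
    · rw [output_spec (n := n) ((eval_reg (by decide)).trans htR.reg_zero) (by decide) v]
      have : (State.col ((output 1).eval t) 9 : Fin n → ℕ) = ρ :=
        funext fun u => congrFun (eval_arr (p := output 1) (a := 9) (by decide)) _
      rw [this]
  · refine ⟨σ, htσ, hm, le_rfl, fun _ hmρ => ?_⟩
    by_contra hlt
    exact hc ⟨hmρ, not_le.1 hlt⟩

theorem best_spec (h : IsReady G X s) {σ : Fin n → ℕ} (hσ : IsOutput s σ) (hm : IsMatched G σ) :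
    ∃ σ', IsOutput (best.eval s) σ' ∧ IsMatched G σ' ∧
      ∀ τ, IsEntry X s τ → IsMatched G τ → weight τ ≤ weight σ' := by
  have key := for_induct (x := 5) (e := .var 1) (p := improve) (s := s)
    (fun i t => IsReady G X t ∧ t.arr 5 = s.arr 5 ∧ t.arr 6 = s.arr 6 ∧
      ∃ σ' : Fin n → ℕ, IsOutput t σ' ∧ IsMatched G σ' ∧ ∀ c < i, 0 < s.arr 5 c →
        IsMatched G (s.row 6 c) → weight (n := n) (s.row 6 c) ≤ weight σ')
    ⟨h, rfl, rfl, σ, hσ, hm, fun c hc => absurd hc (Nat.not_lt_zero c)⟩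
    (by
      rintro i - t ⟨t1, t2, t3, σ', t4, t5, t6⟩
      have u1 : IsReady G X (t.setReg 5 i) := t1.congr' (fun y hy => by
        have : y ≠ 5 := by omega
        simp [this]) fun _ _ => rfl
      obtain ⟨ρ, b1, b2, b3, b4⟩ := improve_spec u1 (σ := σ') t4 t5
      have e5 : (t.setReg 5 i).reg 5 = i := by simp
      have erow : ∀ c, (State.row (t.setReg 5 i) 6 c : Fin n → ℕ) = s.row 6 c := fun c =>
        funext fun v => congrFun t3 _
      rw [e5, erow, State.setReg_arr, t2] at b4
      refine ⟨u1.congr (eval_reg (by decide)) (eval_reg (by decide)) (eval_arr (by decide))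
        (eval_arr (by decide)) (eval_arr (by decide)), (eval_arr (by decide)).trans t2,
        (eval_arr (by decide)).trans t3, ρ, b1, b2, fun c hc hc5 hcm => ?_⟩
      rcases Nat.lt_succ_iff_lt_or_eq.1 hc with hlt | heq
      · exact (t6 c hlt hc5 hcm).trans b3
      · subst heq; exact b4 hc5 hcm)
  have hK : (Expr.var 1).eval s = 4 * 9 ^ X.card := h.reg_one
  rw [hK] at key
  obtain ⟨-, -, -, σ', k1, k2, k3⟩ := key
  refine ⟨σ', k1, k2, ?_⟩
  rintro τ ⟨c, hc, hc5, rfl⟩ hτ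
  exact k3 c hc hc5 hτ

/-- The algorithm: find a cluster deletion set `X`, enter all colourings of `X` into a table,
extend them in all ways to the cliques of `G - X`, where of all partial solutions with the same
key only one of maximum weight is kept, and output the best entry. -/
def algorithm : Stmt :=
  seq mark (seq weights (seq (store 5 (.lit 0) (.lit 1)) (seq colourX (seq links best))))

end Stmt

end RAM

/-! ### Perfectly matched sets as colourings -/

section PerfectlyMatched

open scoped Classical

variable {n : ℕ} {G : SimpleGraph (Fin n)}

/-- The colouring of a pair of sets. -/
noncomputable def colouringOf (A B : Finset (Fin n)) (v : Fin n) : ℕ :=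
  if v ∈ A then 1 else if v ∈ B then 2 else 0

theorem colouringOf_eq_one {A B : Finset (Fin n)} {v : Fin n} :
    colouringOf A B v = 1 ↔ v ∈ A := by
  unfold colouringOf
  by_cases h : v ∈ A <;> by_cases h' : v ∈ B <;> simp [h, h']

theorem colouringOf_eq_two {A B : Finset (Fin n)} (h : Disjoint A B) {v : Fin n} :
    colouringOf A B v = 2 ↔ v ∈ B := by
  unfold colouringOf
  by_cases h1 : v ∈ A
  · simp [h1, Finset.disjoint_left.1 h h1]
  · simp [h1]

theorem colourDegree_eq_one_iff {σ : Fin n → ℕ} {q : ℕ} {v : Fin n} :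
    colourDegree G σ q v = 1 ↔ ∃! w, σ w = q ∧ G.Adj v w := by
  rw [colourDegree_eq_one]
  refine exists_congr fun w => ?_
  constructor
  · rintro ⟨⟨h1, h2⟩, h3⟩
    exact ⟨⟨h2, h1⟩, fun y hy => h3 y hy.2 hy.1⟩
  · rintro ⟨⟨h1, h2⟩, h3⟩
    exact ⟨⟨h2, h1⟩, fun y hy hyq => h3 y ⟨hyq, hy⟩⟩

theorem PerfectlyMatched.isSolution {A B : Finset (Fin n)} (h : PerfectlyMatched G A B) :
    RAM.Stmt.IsSolution G (colouringOf A B) := by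
  obtain ⟨hd, hA, hB⟩ := h
  refine ⟨fun v => ⟨fun hv => ?_, fun hv => ?_⟩, fun u => ?_⟩
  · simp only [colourDegree_eq_one_iff, colouringOf_eq_two hd]
    exact hA v (colouringOf_eq_one.1 hv)
  · simp only [colourDegree_eq_one_iff, colouringOf_eq_one]
    exact hB v ((colouringOf_eq_two hd).1 hv)
  · unfold colouringOf; split_ifs <;> decide

theorem weight_colouringOf (A B : Finset (Fin n)) : weight (colouringOf A B) = A.card := by
  simp [weight, colouringOf_eq_one]

theorem IsMatched.perfectlyMatched {σ : Fin n → ℕ} (h : IsMatched G σ) {A B : Finset (Fin n)}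
    (hA : ∀ v, v ∈ A ↔ σ v = 1) (hB : ∀ v, v ∈ B ↔ σ v = 2) : PerfectlyMatched G A B := by
  refine ⟨Finset.disjoint_left.2 fun v h1 h2 => ?_, fun a ha => ?_, fun b hb => ?_⟩
  · rw [hA] at h1; rw [hB, h1] at h2; exact absurd h2 (by decide)
  · simp only [hB]; exact colourDegree_eq_one_iff.1 ((h a).1 ((hA a).1 ha))
  · simp only [hA]; exact colourDegree_eq_one_iff.1 ((h b).2 ((hB b).1 hb))

end PerfectlyMatched

theorem exists_clusterDeletionSet {n : ℕ} {G : SimpleGraph (Fin n)} {k : ℕ}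
    (h : distanceToCluster G ≤ k) : ∃ D, IsClusterDeletionSet G D ∧ D.card ≤ k := by
  -- Nonemptiness is needed for the infimum to be attained; `sInf` of the empty set would be 0.
  have hne : {m | ∃ X : Finset (Fin n), IsClusterDeletionSet G X ∧ X.card = m}.Nonempty := by
    refine ⟨_, Finset.univ, ⟨⊤, fun u => ?_⟩, rfl⟩
    exact absurd (Finset.mem_univ _) u.2
  obtain ⟨D, h1, h2⟩ := Nat.sInf_mem hne
  exact ⟨D, h1, h2.trans_le h⟩

/-! ### The numerical bound on the running time -/

theorem polynomial_eval_le (p : Polynomial ℕ) :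
    ∃ C e, ∀ m, p.eval m ≤ C * (m + 1) ^ e := by
  refine ⟨∑ i ∈ Finset.range (p.natDegree + 1), p.coeff i, p.natDegree, fun m => ?_⟩
  rw [Polynomial.eval_eq_sum_range, Finset.sum_mul]
  refine Finset.sum_le_sum fun i hi => Nat.mul_le_mul_left _ ?_
  calc m ^ i ≤ (m + 1) ^ i := Nat.pow_le_pow_left (Nat.le_succ m) i
    _ ≤ (m + 1) ^ p.natDegree :=
      Nat.pow_le_pow_right (Nat.succ_pos m) (by have := Finset.mem_range.1 hi; omega)

/-- For b ≤ k compare the bases, for k < b the exponents; 0^0 = 1 covers k = 0. -/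
theorem pow_le_const_mul_self_pow (b k : ℕ) (hb : 0 < b) : b ^ k ≤ b ^ b * k ^ k := by
  rcases le_or_gt b k with h | h
  · calc b ^ k ≤ k ^ k := Nat.pow_le_pow_left h k
      _ ≤ b ^ b * k ^ k := Nat.le_mul_of_pos_left _ (Nat.pow_pos hb)
  · calc b ^ k ≤ b ^ b := Nat.pow_le_pow_right hb h.le
      _ ≤ b ^ b * k ^ k := Nat.le_mul_of_pos_right _ (by
        rcases Nat.eq_zero_or_pos k with rfl | hk
        · simp
        · exact Nat.pow_pos hk)

/-- If `p` grows like the e-th power, its value is at most C (n + 5)^e · b^k with b = 9^(3e). Then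
b^k is absorbed by k^k at the cost of the constant b^b, and the factor 3^k is to spare. -/
theorem exists_polynomial_bound (p : Polynomial ℕ) : ∃ q : Polynomial ℕ, ∀ n k : ℕ,
    p.eval (n + 4 * 9 ^ (3 * k)) ≤ 3 ^ k * k ^ k * q.eval n := by
  obtain ⟨C, e, h⟩ := polynomial_eval_le p
  obtain ⟨b, hb⟩ : ∃ b, b = 9 ^ (3 * e) := ⟨_, rfl⟩
  have hb0 : 0 < b := by rw [hb]; exact Nat.pow_pos (by decide)
  refine ⟨Polynomial.C (C * b ^ b) * (Polynomial.X + Polynomial.C 5) ^ e, fun n k => ?_⟩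
  have h1 : n + 4 * 9 ^ (3 * k) + 1 ≤ (n + 5) * 9 ^ (3 * k) := by
    have : 1 ≤ 9 ^ (3 * k) := Nat.one_le_pow _ _ (by decide)
    nlinarith
  have h2 : (9 ^ (3 * k)) ^ e = b ^ k := by
    rw [hb, ← pow_mul, ← pow_mul]; congr 1; ring
  have h3 := pow_le_const_mul_self_pow b k hb0
  have h4 : 1 ≤ 3 ^ k := Nat.one_le_pow _ _ (by decide)
  simp only [Polynomial.eval_mul, Polynomial.eval_C, Polynomial.eval_pow, Polynomial.eval_add,
    Polynomial.eval_X]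
  calc p.eval (n + 4 * 9 ^ (3 * k)) ≤ C * (n + 4 * 9 ^ (3 * k) + 1) ^ e := h _
    _ ≤ C * ((n + 5) * 9 ^ (3 * k)) ^ e := by gcongr
    _ = C * (n + 5) ^ e * b ^ k := by rw [mul_pow, h2]; ring
    _ ≤ C * (n + 5) ^ e * (b ^ b * k ^ k) := Nat.mul_le_mul_left _ h3
    _ = 1 * (k ^ k * (C * b ^ b * (n + 5) ^ e)) := by ring
    _ ≤ 3 ^ k * (k ^ k * (C * b ^ b * (n + 5) ^ e)) := Nat.mul_le_mul_right _ h4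
    _ = _ := by ring

/-! ### Correctness and boundedness of the whole algorithm -/

namespace RAM

open scoped Classical

variable {n : ℕ}

theorem graphInput_isMarked (G : SimpleGraph (Fin n)) : IsMarked G ∅ (graphInput G) := by
  refine ⟨⟨rfl, fun u v => ?_⟩, fun v => ?_⟩
  · simp only [graphInput, true_and]
    congr 1
    refine propext ⟨?_, fun h => ⟨u, v, rfl, h⟩⟩
    rintro ⟨u', v', h1, h2⟩
    have hu : (u : ℕ) = u' := by
      have l1 := v.2
      have l2 := v'.2
      rcases lt_trichotomy (u : ℕ) u' with hlt | heq | hlt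
      · have := Nat.mul_le_mul_right n (Nat.succ_le_of_lt hlt)
        rw [Nat.succ_mul] at this; omega
      · exact heq
      · have := Nat.mul_le_mul_right n (Nat.succ_le_of_lt hlt)
        rw [Nat.succ_mul] at this; omega
    have hv : (v : ℕ) = v' := by rw [hu] at h1; omega
    rwa [Fin.ext hu, Fin.ext hv]
  · simp [graphInput]

theorem graphInput_bounded (G : SimpleGraph (Fin n)) (m : ℕ) {M : ℕ} (hn : n ≤ M) (hM : 1 ≤ M) :
    Bounded m M (graphInput G) := by
  refine ⟨fun x _ => ?_, fun a i => ?_⟩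
  · simp only [graphInput]; split_ifs <;> omega
  · simp only [graphInput]; split_ifs <;> omega

theorem Stmt.algorithm_spec (G : SimpleGraph (Fin n)) {k : ℕ} (hk : distanceToCluster G ≤ k) :
    algorithm.Safe 12 (n + 4 * 9 ^ (3 * k)) (graphInput G) ∧
      IsMaximumPerfectlyMatched G ((algorithm.eval (graphInput G)).vertexSet 1 n)
        ((algorithm.eval (graphInput G)).vertexSet 2 n) := by
  obtain ⟨D, hD, hDk⟩ := exists_clusterDeletionSet hk
  obtain ⟨X, m1, m2, hX⟩ := mark_spec (graphInput_isMarked G)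
  set M := n + 4 * 9 ^ (3 * k) with hM
  -- |X| ≤ 3 |X ∩ D| ≤ 3 |D| ≤ 3k, with `D` an optimal cluster deletion set.
  have hXk : X.card ≤ 3 * k := by
    have h1 := m2 D hD
    have h2 := Finset.card_le_card (Finset.inter_subset_right (s₁ := X) (s₂ := D))
    omega
  have hXM : 4 * 9 ^ X.card ≤ M := by
    have := Nat.pow_le_pow_right (n := 9) (by decide) hXk
    omega
  have h4M : 4 ≤ M := by
    have : 1 ≤ 9 ^ (3 * k) := Nat.one_le_pow _ _ (by decide)
    omega
  have hb := graphInput_bounded G 12 (M := M) (by omega) (by omega)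
  obtain ⟨m3, m4⟩ := Small.safe (C := 4) h4M (p := mark)
    (by simp [mark, Small, Expr.Small]) (by decide) hb
  obtain ⟨w1, w2, w3⟩ := weights_spec m1 hXM m4
  set s₁ := mark.eval (graphInput G) with hs₁
  set s₂ := weights.eval s₁ with hs₂
  obtain ⟨r1, -⟩ := Small.safe (C := 4) h4M
    (p := seq (store 5 (.lit 0) (.lit 1)) (seq colourX (seq links best)))
    (by simp [colourX, colourVertex, links, best, step, extend, enter, saveRow, loadRow, paint,
      swap, improve, output, Small, Expr.Small]) (by decide) w3
  -- Arrays not yet written are still 0, so both tables and the output are empty.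
  have harr : ∀ a, a ≠ 0 → a ≠ 3 → a ≠ 4 → ∀ i, s₂.arr a i = 0 := by
    intro a h0 h3 h4 i
    rw [hs₂, eval_arr (p := weights) (by simp [weights, weightsBody, arrs]; omega), hs₁,
      eval_arr (p := mark) (by simp [mark, arrs]; omega)]
    simp [graphInput, h0]
  -- Setting one flag makes the zero row 0 the only colouring in the table.
  set s₃ := s₂.setArr 5 0 1 with hs₃
  have t1 : IsClean G X s₃ := by
    refine ⟨w1.congr' (fun _ _ => rfl) fun a ha => ?_, fun c => ?_⟩
    · rw [hs₃, State.setArr_arr, if_neg (by omega)]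
    · rw [hs₃, State.setArr_arr, if_neg (by omega)]
      exact harr 7 (by decide) (by decide) (by decide) c
  have t2 : ∀ σ, IsEntry X s₃ σ ↔ σ = fun _ => 0 := by
    have hrow : ∀ c, (s₃.row 6 c : Fin n → ℕ) = fun _ => 0 := fun c => funext fun v => by
      simp only [State.row, hs₃, State.setArr_arr]
      exact harr 6 (by decide) (by decide) (by decide) _
    have h5 : s₃.arr 5 0 = 1 := by simp [hs₃, State.setArr_arr]
    intro σ
    constructor
    · rintro ⟨c, -, -, rfl⟩
      exact hrow c
    · rintro rfl
      exact ⟨0, by positivity, by rw [h5]; exact one_pos, hrow 0⟩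
  obtain ⟨c1, c2, c3⟩ := colourX_spec t1 t2
  obtain ⟨l1, l2⟩ := links_spec hX c1 c2 c3
  set s₄ := links.eval (colourX.eval s₃) with hs₄
  -- The search for the best entry starts from the pair of empty sets, which is trivially matched.
  have hout : IsOutput s₄ (fun _ : Fin n => 0) := fun v => by
    have : ∀ a, a = 1 ∨ a = 2 → s₄.arr a v = 0 := by
      intro a ha
      rw [hs₄, eval_arr (p := links) (by
          simp [links, step, extend, enter, saveRow, loadRow, paint, swap, arrs]; omega),
        eval_arr (p := colourX) (by
          simp [colourX, colourVertex, step, extend, enter, saveRow, loadRow, paint, swap, arrs]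
          omega), hs₃, State.setArr_arr, if_neg (by omega)]
      exact harr a (by omega) (by omega) (by omega) v
    simp [this 1, this 2]
  obtain ⟨σ, b1, b2, b3⟩ := best_spec l1 hout fun v => by simp
  have hfin : algorithm.eval (graphInput G) = best.eval s₄ := rfl
  rw [hfin]
  have hA : ∀ v, v ∈ (best.eval s₄).vertexSet 1 n ↔ σ v = 1 := fun v => by
    simp [State.vertexSet, (b1 v).1]
  have hB : ∀ v, v ∈ (best.eval s₄).vertexSet 2 n ↔ σ v = 2 := fun v => by
    simp [State.vertexSet, (b1 v).2]
  refine ⟨⟨m3, w2, r1⟩, b2.perfectlyMatched hA hB, fun A' B' h' => ?_⟩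
  obtain ⟨τ, e1, e2, e3⟩ := l2 _ h'.isSolution
  have := b3 τ e1 e2
  rw [weight_colouringOf] at e3
  have hcard : ((best.eval s₄).vertexSet 1 n).card = weight σ := by
    unfold weight
    congr 1
    ext v
    simp [hA]
  omega

end RAM

/-- One program finds, on every finite simple graph, a pair of perfectly matched sets of maximum
size (left in arrays `1` and `2`), and on `n`-vertex graphs with distance to cluster at most `k` it
takes at most `3 ^ k * k ^ k * poly(n)` steps; `k` is not part of the input. -/
theorem mainTheorem6 :
    ∃ (P : RAM.Prog) (poly : Polynomial ℕ),
      ∀ (n : ℕ) (G : SimpleGraph (Fin n)) (k : ℕ), distanceToCluster G ≤ k →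
        ∃ (t : ℕ) (s : RAM.State),
          RAM.Exec P (RAM.graphInput G) t s ∧
          t ≤ 3 ^ k * k ^ k * poly.eval n ∧
          IsMaximumPerfectlyMatched G (s.vertexSet 1 n) (s.vertexSet 2 n) := by
  obtain ⟨q, hq⟩ := exists_polynomial_bound RAM.Stmt.algorithm.cost
  -- All registers named in the algorithm are below 12, so temporaries start there. The program and
  -- `q` are fixed before `k`, which enters only through the bound on the numbers.
  refine ⟨RAM.Stmt.algorithm.compile 12, q, fun n G k hk => ?_⟩
  obtain ⟨h1, h2⟩ := RAM.Stmt.algorithm_spec G hk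
  obtain ⟨t, s, e1, e2, e3, -⟩ := RAM.Stmt.algorithm.compile_runs (m := 12) (d := 12)
    (by decide) le_rfl (RAM.Agree.refl 12 _) h1
  refine ⟨t, s, e1, e2.trans (hq n k), ?_⟩
  have hs : ∀ a, s.vertexSet a n = (RAM.Stmt.algorithm.eval (RAM.graphInput G)).vertexSet a n :=
    fun a => by simp only [RAM.State.vertexSet, e3.2]
  rw [hs, hs]
  exact h2
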